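/- Let $n\ge 11$ be odd and let $K$ be a van Kampen diagram (a finite connected plane diagram) over $F(2,n)=\langle x_1,\dots,x_n\mid x_ix_{i+1}=x_{i+2}\ (i \bmod n)\rangle$. At a vertex, the outward edges of a face $x_ix_{i+1}=x_{i+2}$ at its source are, in order, the edges labelled $x_i$ and $x_{i+2}$ (first, second), and the inward edges at its sink are those labelled $x_{i+2}$ and $x_{i+1}$ (first, second); edges that follow each other in this way across non-outer faces form sequences of consecutive outward or inward edges. Assume that $K$ is reduced (no two identically labelled faces share an edge) and spherically reduced. The latter is meant with respect to the spherical diagram $SD_n$, which has $4n$ faces, two poles $B,P$ and $2n$ vertices $V_j,W_j$ ($j\in\mathbb Z/n$) of degree 5, and the edges $B\to V_j$, $V_j\to V_{j+1}$, $V_j\to W_j$, $W_j\to V_{j+1}$, $W_j\to W_{j+1}$, $P\to W_j$ with the label indices $2j$, $2j+1$, $2j-1$, $2j$, $2j+2$, $2j+1$, respectively: no subdiagram of $K$ matches a subdiagram (disc) of $SD_n$ with more than $2n$ faces. A vertex is interior if it does not lie on the outer face, and a boundary vertex otherwise. A 5 vertex is an interior vertex of degree 5; around it there are, in cyclic order,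 a first, middle and last inward edge and a first and last outward edge. Edges are coloured as follows, for every 5 vertex $V$. The middle inward edge of $V$ is blue if the first inward edge of $V$ is the second edge of a sequence of outward edges at its other end. The last outward edge of $V$ is green if the middle inward edge is not blue and the other end of the last outward edge is not a 5 vertex. The first inward edge of $V$ is yellow if the middle inward edge is not blue, the last outward edge is not green, and the first inward edge is the middle one of five consecutive outward edges at its other end. All other edges are uncoloured. A deg-6 (deg-7) vertex is an interior vertex with exactly 6 (at least 7) uncoloured edge ends. The following are types of deg-6 vertices whose edges are one sequence of $i$ inward and one sequence of $o$ outward edges. The two sequences have the same orientation if the first inward edge is next to the last outward edge and the last inward edge is next to the first outward edge; they have opposite orientations if the two first edges are next to each other and the two last edges are next to each other. - GG: $i=5$, $o=3$, same orientation, the second and fourth inward edges green. - YB: $i=2$, $o=(n+1)/2$, opposite orientations, the last outward edge blue, and all outward edges yellow except the first two and the last three. - Y+: $i=2$, $o=(n+1)/2$, opposite orientations, and all outward edges yellow except the first two and the last two. - Y−: $i=2$, $o=(n+3)/2$, same orientation, and all outward edges yellow except the first two and the last two. - 5G: $i=n$, $o=0$, exactly five edges green (so $n=11$). Arrange the vertices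 in layers: layer 1, boundary and deg-7 vertices; layer 2, GG and YB; layer 3, Y+; layer 4, Y− and 5G; layer 5, 5 vertices. Lemma 5. Every vertex of $K$ belongs to exactly one of the five layers, and every vertex in a layer $l>1$ is joined by an edge to a vertex in a strictly higher layer $m<l$. -/

import Mathlib

/-- The combinatorial data of an oriented surface map with edges labelled by the generators
`x_i` (`i : ZMod n`), given by its darts (directed edges) `D`.
* `rev d` is the dart `d` traversed backwards, so an edge is a pair `{d, rev d}`;
* `rot d` is the next dart, anticlockwise, with the same initial vertex as `d`;
* `pos d` says that `d` points in the direction of the arrow on its edge;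
* `lab d` is the index of the generator on the edge of `d`;
* `outer` is some dart that has the unbounded region on its left. -/
structure LabelledMap (n : ℕ) (D : Type*) where
  rev : Equiv.Perm D
  rot : Equiv.Perm D
  pos : D → Prop
  lab : D → ZMod n
  outer : D
  rev_rev : ∀ d, rev (rev d) = d
  pos_rev : ∀ d, pos (rev d) ↔ ¬ pos d
  lab_rev : ∀ d, lab (rev d) = lab d

namespace LabelledMap

variable {n : ℕ} {D : Type*} (K : LabelledMap n D)

/-- The dart that follows `d` on the boundary of the face on the left of `d`. -/
def face : Equiv.Perm D := K.rot⁻¹ * K.rev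

/-- The face on the left of `d` is the outer one; equivalently, the corner between `d` and
`rot d` lies in the outer face. -/
def IsOuter (d : D) : Prop := K.face.SameCycle K.outer d

/-- Vertices are the cycles of `rot`. -/
def Vertex : Type _ := Quotient (Equiv.Perm.SameCycle.setoid K.rot)

/-- The initial vertex of a dart. -/
def tail (d : D) : K.Vertex := Quotient.mk (Equiv.Perm.SameCycle.setoid K.rot) d

/-- The final vertex of a dart. -/
def head (d : D) : K.Vertex := K.tail (K.rev d)

/-- `a`, `b`, `c` are the edges of a face of the form `x_i x_{i+1} = x_{i+2}`: `a` runs from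
the source to the middle vertex, `b` from the middle vertex to the sink, `c` from the source
to the sink. The face is on the left of `a`. -/
structure PosTri (a b c : D) : Prop where
  pos_a : K.pos a
  pos_b : K.pos b
  pos_c : K.pos c
  lab_b : K.lab b = K.lab a + 1
  lab_c : K.lab c = K.lab a + 2
  face_a : K.face a = b
  face_b : K.face b = K.rev c
  face_c : K.face (K.rev c) = a
  inner : ¬ K.IsOuter a

/-- The same with the other orientation: the face is on the right of `a`. -/
structure NegTri (a b c : D) : Prop where
  pos_a : K.pos a
  pos_b : K.pos b
  pos_c : K.pos c
  lab_b : K.lab b = K.lab a + 1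
  lab_c : K.lab c = K.lab a + 2
  face_c : K.face c = K.rev b
  face_b : K.face (K.rev b) = K.rev a
  face_a : K.face (K.rev a) = c
  inner : ¬ K.IsOuter c

/-- `a`, `b`, `c` are the edges source-middle, middle-sink, source-sink of a (non-outer) face,
read clockwise or anticlockwise. -/
def Tri (a b c : D) : Prop := K.PosTri a b c ∨ K.NegTri a b c

/-- The face on the left of `d` is not the outer one and carries the relator
`x_i x_{i+1} = x_{i+2}`. -/
def HasRelator (d : D) (i : ZMod n) : Prop :=
  ∃ a b c, K.lab a = i ∧
    ((K.PosTri a b c ∧ (d = a ∨ d = b ∨ d = K.rev c)) ∨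
      (K.NegTri a b c ∧ (d = K.rev a ∨ d = K.rev b ∨ d = c)))

end LabelledMap

/-- A van Kampen diagram over the presentation
`⟨x_i (i : ZMod n) | x_i x_{i+1} = x_{i+2} (i : ZMod n)⟩`: a finite connected plane map (this is
Euler's formula, where the outer face is counted) in which every face except the outer one is
labelled by a relator. (The diagram that consists of one vertex and has no dart is left out.) -/
structure VanKampenDiagram (n : ℕ) (D : Type*) extends LabelledMap n D where
  connected : MulAction.IsPretransitive (Subgroup.closure {rev, rot}) D
  euler : Nat.card (Quotient (Equiv.Perm.SameCycle.setoid rot))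
      + Nat.card (Quotient (Equiv.Perm.SameCycle.setoid toLabelledMap.face))
      = Nat.card (Quotient (Equiv.Perm.SameCycle.setoid rev)) + 2
  relator : ∀ d, ¬ toLabelledMap.IsOuter d → ∃ i, toLabelledMap.HasRelator d i

namespace LabelledMap

variable {n : ℕ} {D : Type*} (K : LabelledMap n D)

/-- No two identically labelled faces share an edge. -/
def Reduced : Prop := ∀ d i, ¬ (K.HasRelator d i ∧ K.HasRelator (K.rev d) i)

end LabelledMap

/-! ### The spherical diagram `SDn`

It has two poles `B`, `P` and two rings `V_j`, `W_j` (`j : ZMod n`) of vertices of degree 5. -/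

/-- The directed edges of the spherical diagram: `BV j : B → V_j`, `VV j : V_j → V_{j+1}`,
`VW j : V_j → W_j`, `WV j : W_j → V_{j+1}`, `WW j : W_j → W_{j+1}`, `PW j : P → W_j`. -/
inductive SDEdge (n : ℕ) : Type
  | BV (j : ZMod n)
  | VV (j : ZMod n)
  | VW (j : ZMod n)
  | WV (j : ZMod n)
  | WW (j : ZMod n)
  | PW (j : ZMod n)

/-- The `4 n` faces of the spherical diagram. -/
inductive SDFace (n : ℕ) : Type
  | top (j : ZMod n)
  | upper (j : ZMod n)
  | lower (j : ZMod n)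
  | bottom (j : ZMod n)

namespace SDEdge

/-- The labels of the edges of the spherical diagram. -/
def lab {n : ℕ} : SDEdge n → ZMod n
  | BV j => 2 * j
  | VV j => 2 * j + 1
  | VW j => 2 * j - 1
  | WV j => 2 * j
  | WW j => 2 * j + 2
  | PW j => 2 * j + 1

end SDEdge

namespace SDFace

open SDEdge

/-- The edge of a face from its source to its middle vertex. -/
def fst {n : ℕ} : SDFace n → SDEdge n
  | top j => BV j
  | upper j => VW j
  | lower j => WV (j - 1)
  | bottom j => PW j

/-- The edge of a face from its middle vertex to its sink. -/
def snd {n : ℕ} : SDFace n → SDEdge n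
  | top j => VV j
  | upper j => WV j
  | lower j => VW j
  | bottom j => WW j

/-- The edge of a face from its source to its sink. -/
def trd {n : ℕ} : SDFace n → SDEdge n
  | top j => BV (j + 1)
  | upper j => VV j
  | lower j => WW (j - 1)
  | bottom j => PW (j + 1)

/-- `e` is an edge of the face `t`. -/
def HasEdge {n : ℕ} (t : SDFace n) (e : SDEdge n) : Prop := e = t.fst ∨ e = t.snd ∨ e = t.trd

/-- Two faces of the spherical diagram are adjacent if they share an edge. -/
def graph (n : ℕ) : SimpleGraph (SDFace n) :=
  SimpleGraph.fromRel fun t t' => ∃ e, t.HasEdge e ∧ t'.HasEdge e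

/-- The faces in `T` form a subdiagram (a disc) of the spherical diagram: `T` and its complement
are both connected through edges. -/
def IsSubdiagram {n : ℕ} (T : Set (SDFace n)) : Prop :=
  T.Nonempty ∧ ((graph n).induce T).Preconnected ∧ ((graph n).induce Tᶜ).Preconnected

end SDFace

namespace LabelledMap

variable {n : ℕ} {D : Type*} (K : LabelledMap n D)

/-- Some subdiagram of `K` matches the subdiagram `T` of the spherical diagram: the edges of `T`
are sent to edges of `K` with the same labels, and the faces of `T` to distinct faces of `K`. -/
def ContainsMatch (T : Set (SDFace n)) : Prop :=
  ∃ g : SDEdge n → D,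
    (∀ t ∈ T, ∀ e, t.HasEdge e → K.lab (g e) = e.lab) ∧
    (∀ t ∈ T, K.Tri (g t.fst) (g t.snd) (g t.trd)) ∧
    Set.InjOn (fun t : SDFace n => (g t.fst, g t.snd, g t.trd)) T

/-- No subdiagram of `K` matches a subdiagram of the spherical diagram with more than half of
its `4 n` faces. -/
def SphericallyReduced : Prop :=
  ∀ T : Set (SDFace n), SDFace.IsSubdiagram T → 2 * n < T.ncard → ¬ K.ContainsMatch T

/-! ### Consecutive edges at a vertex

In what follows an edge is represented by its dart in the direction of the arrow. -/

/-- `e` and `e'` are the first and the second outward edge of a face at its source. -/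
def OutNext (e e' : D) : Prop := ∃ b, K.Tri e b e'

/-- `e` and `e'` are the first and the second inward edge of a face at its sink. -/
def InNext (e e' : D) : Prop := ∃ a, K.Tri a e' e

/-- `e` and `e'` are the inward and the outward edge of a face at its middle vertex. -/
def Transit (e e' : D) : Prop := ∃ c, K.Tri e e' c

/-- A vertex is interior if none of its corners lies in the outer face. -/
def IsInterior (v : K.Vertex) : Prop := ∀ d, K.tail d = v → ¬ K.IsOuter d

/-- A vertex on the boundary of the diagram. -/
def IsBoundary (v : K.Vertex) : Prop := ¬ K.IsInterior v

/-- The number of edge ends at `v`. -/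
noncomputable def degree (v : K.Vertex) : ℕ := Nat.card {d : D // K.tail d = v}

/-- A 5 vertex: an interior vertex of degree 5. -/
def IsFive (v : K.Vertex) : Prop := K.IsInterior v ∧ K.degree v = 5

/-- Around some 5 vertex `V`, the edges are, in this cyclic order, the first, middle and last
inward edges `b`, `c`, `d` and the first and last outward edges `e`, `a`. -/
structure FiveStar (b c d e a : D) : Prop where
  five : K.IsFive (K.head b)
  bc : K.InNext b c
  cd : K.InNext c d
  de : K.Transit d e
  ea : K.OutNext e a
  ab : K.Transit b a

/-- `e` is the second edge in a (maximal) sequence of consecutive outward edges. -/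
def IsSecondOut (e : D) : Prop := ∃ p, K.OutNext p e ∧ ∀ q, ¬ K.OutNext q p

/-- `e` is the middle one of five consecutive outward edges. -/
def IsMiddleOut (e : D) : Prop :=
  ∃ p q r s, K.OutNext p q ∧ K.OutNext q e ∧ K.OutNext e r ∧ K.OutNext r s

/-- The middle inward edge `c` of a 5 vertex is blue if the first inward edge `b` is the second
edge in a sequence of outward edges at its other end. -/
def Blue (c : D) : Prop := ∃ b d e a, K.FiveStar b c d e a ∧ K.IsSecondOut b

/-- The last outward edge `a` of a 5 vertex is green if the middle inward edge is not blue and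
`a` does not lead to a 5 vertex. -/
def Green (a : D) : Prop :=
  ∃ b c d e, K.FiveStar b c d e a ∧ ¬ K.Blue c ∧ ¬ K.IsFive (K.head a)

/-- The first inward edge `b` of a 5 vertex is yellow if the last outward edge is not green, the
middle inward edge is not blue, and `b` is the middle one of five consecutive outward edges at
its other end. -/
def Yellow (b : D) : Prop :=
  ∃ c d e a, K.FiveStar b c d e a ∧ ¬ K.Green a ∧ ¬ K.Blue c ∧ K.IsMiddleOut b

/-- The edge of the dart `d` is coloured. -/
def Coloured (d : D) : Prop :=
  (K.Blue d ∨ K.Green d ∨ K.Yellow d) ∨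
    (K.Blue (K.rev d) ∨ K.Green (K.rev d) ∨ K.Yellow (K.rev d))

/-- The number of uncoloured edge ends at `v`. -/
noncomputable def uncoloured (v : K.Vertex) : ℕ :=
  Nat.card {d : D // K.tail d = v ∧ ¬ K.Coloured d}

/-- An interior vertex with exactly 6 uncoloured edges. -/
def IsDegSix (v : K.Vertex) : Prop := K.IsInterior v ∧ K.uncoloured v = 6

/-- An interior vertex with at least 7 uncoloured edges. -/
def IsDegSeven (v : K.Vertex) : Prop := K.IsInterior v ∧ 7 ≤ K.uncoloured v

/-- The edges at `v` are one sequence `x 0, …, x (i - 1)` of consecutive inward edges and one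
sequence `y 0, …, y (o - 1)` of consecutive outward edges. -/
structure IsWheel (v : K.Vertex) (i o : ℕ) (x y : ℕ → D) : Prop where
  in_inj : Set.InjOn x (Set.Iio i)
  in_mem : ∀ d, (K.pos d ∧ K.head d = v) ↔ ∃ k, k < i ∧ x k = d
  in_next : ∀ k, k + 1 < i → K.InNext (x k) (x (k + 1))
  out_inj : Set.InjOn y (Set.Iio o)
  out_mem : ∀ d, (K.pos d ∧ K.tail d = v) ↔ ∃ k, k < o ∧ y k = d
  out_next : ∀ k, k + 1 < o → K.OutNext (y k) (y (k + 1))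

/-- `v` has `i` inward edges `x` and `o` outward edges `y`, in the same orientation: the last
inward edge is followed by the first outward edge, and the last outward edge by the first inward
edge. The angle sum is `(o - 1) * 2 - (i - 1)`. -/
structure SameOrientation (v : K.Vertex) (i o : ℕ) (x y : ℕ → D) : Prop where
  wheel : K.IsWheel v i o x y
  last_first : K.Transit (x (i - 1)) (y 0)
  first_last : K.Transit (x 0) (y (o - 1))

/-- `v` has `i` inward edges `x` and `o` outward edges `y`, in opposite orientations: the two
first edges are next to each other, and so are the two last edges. The angle sum is
`(o - 1) * 2 + (i - 1)`. -/
structure OppositeOrientation (v : K.Vertex) (i o : ℕ) (x y : ℕ → D) : Prop where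
  wheel : K.IsWheel v i o x y
  first_first : K.Transit (x 0) (y 0)
  last_last : K.Transit (x (i - 1)) (y (o - 1))

/-- Type GG: angle sum `2 + 2 - 1 - 1 - 1 - 1`, the second and fourth inward edges are green. -/
def IsGG (v : K.Vertex) : Prop :=
  K.IsDegSix v ∧ ∃ x y, K.SameOrientation v 5 3 x y ∧ K.Green (x 1) ∧ K.Green (x 3)

/-- Type YB: angle sum `1 + ((n - 1) / 2) * 2`, the last outward edge is blue and all outward
edges are yellow except the first two and the last three. -/
def IsYB (v : K.Vertex) : Prop :=
  K.IsDegSix v ∧ ∃ x y, K.OppositeOrientation v 2 ((n + 1) / 2) x y ∧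
    K.Blue (y ((n + 1) / 2 - 1)) ∧
    ∀ k, 2 ≤ k → k + 3 < (n + 1) / 2 → K.Yellow (y k)

/-- Type Y+: angle sum `1 + ((n - 1) / 2) * 2`, all outward edges are yellow except the first
two and the last two. -/
def IsYPlus (v : K.Vertex) : Prop :=
  K.IsDegSix v ∧ ∃ x y, K.OppositeOrientation v 2 ((n + 1) / 2) x y ∧
    ∀ k, 2 ≤ k → k + 2 < (n + 1) / 2 → K.Yellow (y k)

/-- Type Y-: angle sum `((n + 1) / 2) * 2 - 1`, all outward edges are yellow except the first
two and the last two. -/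
def IsYMinus (v : K.Vertex) : Prop :=
  K.IsDegSix v ∧ ∃ x y, K.SameOrientation v 2 ((n + 3) / 2) x y ∧
    ∀ k, 2 ≤ k → k + 2 < (n + 3) / 2 → K.Yellow (y k)

/-- Type 5G: `n` inward edges, of which five are green and six uncoloured (so `n = 11`), and no
outward edges. -/
def IsFiveG (v : K.Vertex) : Prop :=
  K.IsDegSix v ∧ K.degree v = n ∧ (∀ d, K.tail d = v → ¬ K.pos d) ∧
    Nat.card {d : D // K.head d = v ∧ K.Green d} = 5

/-- `K.InLayer l v`: the vertex `v` belongs to layer `l`; layer 1 is the highest. -/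
def InLayer : ℕ → K.Vertex → Prop
  | 1, v => K.IsBoundary v ∨ K.IsDegSeven v
  | 2, v => K.IsGG v ∨ K.IsYB v
  | 3, v => K.IsYPlus v
  | 4, v => K.IsYMinus v ∨ K.IsFiveG v
  | 5, v => K.IsFive v
  | _, _ => False

/-- `v` and `w` are the ends of an edge. -/
def Joined (v w : K.Vertex) : Prop := ∃ d, K.tail d = v ∧ K.head d = w

end LabelledMap

/-!
# Layers of the vertices of a reduced diagram

**Roles.** An edge lies in a face as its edge from the source to the middle vertex (role A), from
the middle vertex to the sink (role B) or from the source to the sink (role C). In a reduced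
diagram the two sides of an edge have different roles, so an edge without outer side lacks exactly
one role (`Inner.roles`), and this tells its position at both ends: lacking C, it is a first
outward and a last inward edge; lacking B, an inner outward and a first inward edge; lacking A, a
last outward and an inner inward edge. Moreover each edge determines the other two edges of the
face in which it has a given role. Hence the relations `OutNext`, `InNext`, `Transit` are partial
injections.

**Arrangement.** Around an interior vertex there are only outward edges, only inward edges, one
sequence of each kind, or at least two of each kind (`interior_cases`). The label changes by `2`,
`-1` and `1` under `OutNext`, `InNext` and `Transit`, and the total change around the vertex is
`0` modulo `n`; with `n ≥ 11` this restricts the lengths of the sequences (`OneChain.dvd_same`,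
`OneChain.dvd_opposite`).

**Counting colours.** At an interior vertex that is not a 5 vertex, only inner inward edges can be
green, and never two consecutive ones (`Green.not_inNext`); a blue edge is a last outward edge
next to a last inward edge (`blue_iff`); yellow edges avoid the first and last two of an outward
sequence, and if the last one is blue, the last but two is not yellow
(`OutChain.last_not_five_of_yellow`). So few edges can be coloured, and with the congruences there
remain at least seven uncoloured ends unless the vertex has one of the listed types or a very long
outward sequence that is almost entirely yellow. Such a sequence is ruled out by spherical
reducedness: the faces at the 5 vertices to which the sequence leads match a disc around the pole
`B` of the spherical diagram (`le_two_mul_of_five`).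

**Neighbours.** The first inward edge of a 5 vertex comes from a vertex that is not a 5 vertex. At
the deg-6 vertices a particular edge leads upwards: the first inward edge for GG
(`IsGG.top_of_first_in`), the last but one outward edge for YB (`IsYB.joined_top`), the first or
second outward edge for Y+ and Y- (`OneChain.joined_upper`), and any edge that follows a green one
for 5G (`IsFiveG.joined_upper`).
-/

namespace LabelledMap

variable {n : ℕ} {D : Type*} {K : LabelledMap n D}

/-! ### Faces and the roles of their edges -/

theorem tail_rot (d : D) : K.tail (K.rot d) = K.tail d :=
  Quotient.sound (s := Equiv.Perm.SameCycle.setoid K.rot)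
    ((Equiv.Perm.sameCycle_apply_left).2 (Equiv.Perm.SameCycle.refl _ _))

theorem rot_face (d : D) : K.rot (K.face d) = K.rev d := by simp [face]

theorem head_rev (d : D) : K.head (K.rev d) = K.tail d := by rw [head, K.rev_rev]

theorem not_pos_rev {d : D} (h : K.pos d) : ¬ K.pos (K.rev d) := by rw [K.pos_rev]; simpa

theorem isOuter_face (d : D) : K.IsOuter (K.face d) ↔ K.IsOuter d :=
  Equiv.Perm.sameCycle_apply_right

theorem PosTri.rot_a {a b c : D} (h : K.PosTri a b c) : K.rot a = c := by
  rw [← h.face_c, rot_face, K.rev_rev]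

theorem PosTri.rot_b {a b c : D} (h : K.PosTri a b c) : K.rot b = K.rev a := by
  rw [← h.face_a, rot_face]

theorem PosTri.rot_c {a b c : D} (h : K.PosTri a b c) : K.rot (K.rev c) = K.rev b := by
  rw [← h.face_b, rot_face]

theorem NegTri.rot_c {a b c : D} (h : K.NegTri a b c) : K.rot c = a := by
  rw [← h.face_a, rot_face, K.rev_rev]

theorem NegTri.rot_b {a b c : D} (h : K.NegTri a b c) : K.rot (K.rev b) = K.rev c := by
  rw [← h.face_c, rot_face]

theorem NegTri.rot_a {a b c : D} (h : K.NegTri a b c) : K.rot (K.rev a) = b := by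
  rw [← h.face_b, rot_face, K.rev_rev]

namespace Tri

variable {a b c a' b' c' : D}

theorem pos_a (h : K.Tri a b c) : K.pos a := h.elim (·.pos_a) (·.pos_a)
theorem pos_b (h : K.Tri a b c) : K.pos b := h.elim (·.pos_b) (·.pos_b)
theorem pos_c (h : K.Tri a b c) : K.pos c := h.elim (·.pos_c) (·.pos_c)
theorem lab_b (h : K.Tri a b c) : K.lab b = K.lab a + 1 := h.elim (·.lab_b) (·.lab_b)
theorem lab_c (h : K.Tri a b c) : K.lab c = K.lab a + 2 := h.elim (·.lab_c) (·.lab_c)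

theorem tail_c (h : K.Tri a b c) : K.tail c = K.tail a := by
  rcases h with h | h
  · rw [← h.rot_a, tail_rot]
  · rw [← h.rot_c, tail_rot]

theorem tail_b (h : K.Tri a b c) : K.tail b = K.head a := by
  rcases h with h | h
  · rw [head, ← h.rot_b, tail_rot]
  · rw [head, ← h.rot_a, tail_rot]

theorem head_c (h : K.Tri a b c) : K.head c = K.head b := by
  rcases h with h | h
  · rw [head, head, ← h.rot_c, tail_rot]
  · rw [head, head, ← h.rot_b, tail_rot]

theorem eq_of_a (hR : K.Reduced) (h : K.Tri a b c) (h' : K.Tri a b' c') : b = b' ∧ c = c' := by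
  rcases h with h | h <;> rcases h' with h' | h'
  · exact ⟨h.face_a.symm.trans h'.face_a, h.rot_a.symm.trans h'.rot_a⟩
  · exact (hR a (K.lab a) ⟨⟨a, b, c, rfl, .inl ⟨h, .inl rfl⟩⟩,
      ⟨a, b', c', rfl, .inr ⟨h', .inl rfl⟩⟩⟩).elim
  · exact (hR a (K.lab a) ⟨⟨a, b', c', rfl, .inl ⟨h', .inl rfl⟩⟩,
      ⟨a, b, c, rfl, .inr ⟨h, .inl rfl⟩⟩⟩).elim
  · exact ⟨h.rot_a.symm.trans h'.rot_a, h.face_a.symm.trans h'.face_a⟩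

theorem eq_of_b (hR : K.Reduced) (h : K.Tri a b c) (h' : K.Tri a' b c') : a = a' ∧ c = c' := by
  have key : ∀ {a b c a' c' : D}, K.PosTri a b c → K.NegTri a' b c' → False := by
    intro a b c a' c' h h'
    refine hR b (K.lab a) ⟨⟨a, b, c, rfl, .inl ⟨h, .inr (.inl rfl)⟩⟩,
      ⟨a', b, c', ?_, .inr ⟨h', .inr (.inl rfl)⟩⟩⟩
    exact add_right_cancel (h'.lab_b.symm.trans h.lab_b)
  rcases h with h | h <;> rcases h' with h' | h'
  · exact ⟨K.rev.injective (h.rot_b.symm.trans h'.rot_b),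
      K.rev.injective (h.face_b.symm.trans h'.face_b)⟩
  · exact (key h h').elim
  · exact (key h' h).elim
  · exact ⟨K.rev.injective (h.face_b.symm.trans h'.face_b),
      K.rev.injective (h.rot_b.symm.trans h'.rot_b)⟩

theorem eq_of_c (hR : K.Reduced) (h : K.Tri a b c) (h' : K.Tri a' b' c) : a = a' ∧ b = b' := by
  have key : ∀ {a b c a' b' : D}, K.PosTri a b c → K.NegTri a' b' c → False := by
    intro a b c a' b' h h'
    refine hR c (K.lab a) ⟨⟨a', b', c, ?_, .inr ⟨h', .inr (.inr rfl)⟩⟩,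
      ⟨a, b, c, rfl, .inl ⟨h, .inr (.inr rfl)⟩⟩⟩
    exact add_right_cancel (h'.lab_c.symm.trans h.lab_c)
  rcases h with h | h <;> rcases h' with h' | h'
  · exact ⟨h.face_c.symm.trans h'.face_c, K.rev.injective (h.rot_c.symm.trans h'.rot_c)⟩
  · exact (key h h').elim
  · exact (key h' h).elim
  · exact ⟨h.rot_c.symm.trans h'.rot_c, K.rev.injective (h.face_c.symm.trans h'.face_c)⟩

end Tri

variable (K) in
/-- Some face has `e` as its edge from the source to the middle vertex. -/
def RoleA (e : D) : Prop := ∃ b c, K.Tri e b c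

variable (K) in
/-- Some face has `e` as its edge from the middle vertex to the sink. -/
def RoleB (e : D) : Prop := ∃ a c, K.Tri a e c

variable (K) in
/-- Some face has `e` as its edge from the source to the sink. -/
def RoleC (e : D) : Prop := ∃ a b, K.Tri a b e

section Relations

variable {e e' f : D}

theorem OutNext.roleA (h : K.OutNext e e') : K.RoleA e := let ⟨b, h⟩ := h; ⟨b, e', h⟩
theorem OutNext.roleC (h : K.OutNext e e') : K.RoleC e' := let ⟨b, h⟩ := h; ⟨e, b, h⟩
theorem InNext.roleC (h : K.InNext e e') : K.RoleC e := let ⟨a, h⟩ := h; ⟨a, e', h⟩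
theorem InNext.roleB (h : K.InNext e e') : K.RoleB e' := let ⟨a, h⟩ := h; ⟨a, e, h⟩
theorem Transit.roleA (h : K.Transit e e') : K.RoleA e := let ⟨c, h⟩ := h; ⟨e', c, h⟩
theorem Transit.roleB (h : K.Transit e e') : K.RoleB e' := let ⟨c, h⟩ := h; ⟨e, c, h⟩

theorem RoleA.outNext (h : K.RoleA e) : ∃ f, K.OutNext e f := let ⟨b, c, h⟩ := h; ⟨c, b, h⟩
theorem RoleA.transit (h : K.RoleA e) : ∃ f, K.Transit e f := let ⟨b, c, h⟩ := h; ⟨b, c, h⟩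
theorem RoleB.transit (h : K.RoleB e) : ∃ f, K.Transit f e := let ⟨a, c, h⟩ := h; ⟨a, c, h⟩
theorem RoleB.inNext (h : K.RoleB e) : ∃ f, K.InNext f e := let ⟨a, c, h⟩ := h; ⟨c, a, h⟩
theorem RoleC.outNext (h : K.RoleC e) : ∃ f, K.OutNext f e := let ⟨a, b, h⟩ := h; ⟨a, b, h⟩
theorem RoleC.inNext (h : K.RoleC e) : ∃ f, K.InNext e f := let ⟨a, b, h⟩ := h; ⟨b, a, h⟩

theorem RoleA.pos (h : K.RoleA e) : K.pos e := let ⟨_, _, h⟩ := h; h.pos_a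
theorem RoleB.pos (h : K.RoleB e) : K.pos e := let ⟨_, _, h⟩ := h; h.pos_b
theorem RoleC.pos (h : K.RoleC e) : K.pos e := let ⟨_, _, h⟩ := h; h.pos_c

theorem OutNext.tail_eq (h : K.OutNext e e') : K.tail e' = K.tail e := let ⟨_, h⟩ := h; h.tail_c
theorem InNext.head_eq (h : K.InNext e e') : K.head e' = K.head e :=
  let ⟨_, h⟩ := h; h.head_c.symm
theorem Transit.tail_eq (h : K.Transit e e') : K.tail e' = K.head e := let ⟨_, h⟩ := h; h.tail_b

theorem OutNext.lab_eq (h : K.OutNext e e') : K.lab e' = K.lab e + 2 := let ⟨_, h⟩ := h; h.lab_c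
theorem InNext.lab_eq (h : K.InNext e e') : K.lab e = K.lab e' + 1 := by
  obtain ⟨_, h⟩ := h
  rw [h.lab_b, h.lab_c]; ring
theorem Transit.lab_eq (h : K.Transit e e') : K.lab e' = K.lab e + 1 := let ⟨_, h⟩ := h; h.lab_b

theorem OutNext.right_unique (hR : K.Reduced) (h : K.OutNext e e') (h' : K.OutNext e f) :
    e' = f := let ⟨_, h⟩ := h; let ⟨_, h'⟩ := h'; (h.eq_of_a hR h').2
theorem OutNext.left_unique (hR : K.Reduced) (h : K.OutNext e f) (h' : K.OutNext e' f) :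
    e = e' := let ⟨_, h⟩ := h; let ⟨_, h'⟩ := h'; (h.eq_of_c hR h').1
theorem InNext.right_unique (hR : K.Reduced) (h : K.InNext e e') (h' : K.InNext e f) :
    e' = f := let ⟨_, h⟩ := h; let ⟨_, h'⟩ := h'; (h.eq_of_c hR h').2
theorem InNext.left_unique (hR : K.Reduced) (h : K.InNext e f) (h' : K.InNext e' f) :
    e = e' := let ⟨_, h⟩ := h; let ⟨_, h'⟩ := h'; (h.eq_of_b hR h').2
theorem Transit.right_unique (hR : K.Reduced) (h : K.Transit e e') (h' : K.Transit e f) :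
    e' = f := let ⟨_, h⟩ := h; let ⟨_, h'⟩ := h'; (h.eq_of_a hR h').1
theorem Transit.left_unique (hR : K.Reduced) (h : K.Transit e f) (h' : K.Transit e' f) :
    e = e' := let ⟨_, h⟩ := h; let ⟨_, h'⟩ := h'; (h.eq_of_b hR h').1

end Relations

section Sides

/-! On a given side of an edge, its role is determined by the directions of the other two edges
of the face. -/

variable {e a b c a' b' c' : D}

theorem PosTri.not_pos_b (h : K.PosTri e b c) (h' : K.PosTri a' e c') : False :=
  not_pos_rev h'.pos_c (by rw [← h'.face_b, h.face_a]; exact h.pos_b)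

theorem PosTri.not_neg_c_of_a (h : K.PosTri e b c) (h' : K.NegTri a' b' e) : False :=
  not_pos_rev h'.pos_b (by rw [← h'.face_c, h.face_a]; exact h.pos_b)

theorem PosTri.not_neg_c_of_b (h : K.PosTri a e c) (h' : K.NegTri a' b' e) : False := by
  refine not_pos_rev h'.pos_a ?_
  rw [← h'.face_b, ← h'.face_c, h.face_b, h.face_c]; exact h.pos_a

theorem NegTri.not_neg_b (h : K.NegTri e b c) (h' : K.NegTri a' e c') : False :=
  not_pos_rev h'.pos_a (by rw [← h'.face_b, h.face_a]; exact h.pos_c)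

theorem NegTri.not_pos_c_of_a (h : K.NegTri e b c) (h' : K.PosTri a' b' e) : False := by
  refine not_pos_rev h.pos_b ?_
  rw [← h.face_c, ← h.face_a, h'.face_c, h'.face_a]; exact h'.pos_b

theorem NegTri.not_pos_c_of_b (h : K.NegTri a e c) (h' : K.PosTri a' b' e) : False :=
  not_pos_rev h.pos_a (by rw [← h.face_b, h'.face_c]; exact h'.pos_a)

/-- An edge has only two sides, so it plays at most two of the three roles. -/
theorem not_all_roles (hA : K.RoleA e) (hB : K.RoleB e) (hC : K.RoleC e) : False := by
  obtain ⟨b, c, hA⟩ := hA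
  obtain ⟨a', c', hB⟩ := hB
  obtain ⟨a'', b'', hC⟩ := hC
  rcases hA with hA | hA <;> rcases hB with hB | hB
  · exact hA.not_pos_b hB
  · exact hC.elim hB.not_pos_c_of_b hA.not_neg_c_of_a
  · exact hC.elim hA.not_pos_c_of_a hB.not_neg_c_of_b
  · exact hA.not_neg_b hB

theorem PosTri.not_neg (hR : K.Reduced) (h : K.PosTri a b c) (h' : K.NegTri a b c) : False :=
  hR a _ ⟨⟨a, b, c, rfl, .inl ⟨h, .inl rfl⟩⟩, ⟨a, b, c, rfl, .inr ⟨h', .inl rfl⟩⟩⟩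

/-- Faces with a common edge that is first in one and third in the other have the same
orientation. -/
theorem posTri_iff_of_a_c (hR : K.Reduced) (h : K.Tri e b c) (h' : K.Tri a' b' e) :
    K.PosTri e b c ↔ K.PosTri a' b' e := by
  rcases h with h | h <;> rcases h' with h' | h'
  · exact iff_of_true h h'
  · exact (h.not_neg_c_of_a h').elim
  · exact (h.not_pos_c_of_a h').elim
  · exact iff_of_false (fun p => p.not_neg hR h) (fun p => p.not_neg hR h')

theorem posTri_iff_of_b_c (hR : K.Reduced) (h : K.Tri a e c) (h' : K.Tri a' b' e) :
    K.PosTri a e c ↔ K.PosTri a' b' e := by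
  rcases h with h | h <;> rcases h' with h' | h'
  · exact iff_of_true h h'
  · exact (h.not_neg_c_of_b h').elim
  · exact (h.not_pos_c_of_b h').elim
  · exact iff_of_false (fun p => p.not_neg hR h) (fun p => p.not_neg hR h')

theorem posTri_iff_of_a_b (hR : K.Reduced) (h : K.Tri e b c) (h' : K.Tri a' e c') :
    K.PosTri e b c ↔ ¬ K.PosTri a' e c' := by
  rcases h with h | h <;> rcases h' with h' | h'
  · exact (h.not_pos_b h').elim
  · exact iff_of_true h (fun p => p.not_neg hR h')
  · exact iff_of_false (fun p => p.not_neg hR h) (not_not.2 h')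
  · exact (h.not_neg_b h').elim

end Sides

variable (K) in
/-- `e` points along its arrow and neither side of it is the outer face. -/
structure Inner (e : D) : Prop where
  pos : K.pos e
  left : ¬ K.IsOuter e
  right : ¬ K.IsOuter (K.rev e)

variable (K) in
/-- Every face but the outer one carries a relator. -/
def Filled : Prop := ∀ d, ¬ K.IsOuter d → ∃ i, K.HasRelator d i

/-- The two sides of an inner edge give it two different roles. The absent role fixes the
position of the edge at both of its ends: without the third role it is a first outward and a last
inward edge, without the second an inner outward and a first inward edge, without the first a last
outward and an inner inward edge. -/
theorem Inner.roles (hR : K.Reduced) (hF : K.Filled) {e : D} (h : K.Inner e) :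
    (K.RoleA e ∧ K.RoleB e ∧ ¬ K.RoleC e) ∨ (K.RoleA e ∧ ¬ K.RoleB e ∧ K.RoleC e) ∨
      (¬ K.RoleA e ∧ K.RoleB e ∧ K.RoleC e) := by
  have h3 := @not_all_roles _ _ K e
  have hp := h.pos
  have hl : (∃ b c, K.PosTri e b c) ∨ (∃ a c, K.PosTri a e c) ∨ (∃ a b, K.NegTri a b e) := by
    obtain ⟨i, a, b, c, -, (⟨h, h' | h' | h'⟩ | ⟨h, h' | h' | h'⟩)⟩ := hF _ h.left
    · subst h'; exact .inl ⟨_, _, h⟩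
    · subst h'; exact .inr (.inl ⟨_, _, h⟩)
    · exact absurd (h' ▸ hp) (not_pos_rev h.pos_c)
    · exact absurd (h' ▸ hp) (not_pos_rev h.pos_a)
    · exact absurd (h' ▸ hp) (not_pos_rev h.pos_b)
    · subst h'; exact .inr (.inr ⟨_, _, h⟩)
  have hr : (∃ b c, K.NegTri e b c) ∨ (∃ a c, K.NegTri a e c) ∨ (∃ a b, K.PosTri a b e) := by
    obtain ⟨i, a, b, c, -, (⟨h, h' | h' | h'⟩ | ⟨h, h' | h' | h'⟩)⟩ := hF _ h.right
    · exact absurd h.pos_a (h' ▸ not_pos_rev hp)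
    · exact absurd h.pos_b (h' ▸ not_pos_rev hp)
    · obtain rfl := K.rev.injective h'; exact .inr (.inr ⟨_, _, h⟩)
    · obtain rfl := K.rev.injective h'; exact .inl ⟨_, _, h⟩
    · obtain rfl := K.rev.injective h'; exact .inr (.inl ⟨_, _, h⟩)
    · exact absurd h.pos_c (h' ▸ not_pos_rev hp)
  have sA : ∀ {b c b' c'}, K.PosTri e b c → K.NegTri e b' c' → False := fun {b c b' c'} h h' =>
    hR e _ ⟨⟨e, b, c, rfl, .inl ⟨h, .inl rfl⟩⟩, ⟨e, b', c', rfl, .inr ⟨h', .inl rfl⟩⟩⟩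
  have sB : ∀ {a c a' c'}, K.PosTri a e c → K.NegTri a' e c' → False := fun {a c a' c'} h h' =>
    hR e (K.lab a) ⟨⟨a, e, c, rfl, .inl ⟨h, .inr (.inl rfl)⟩⟩,
      ⟨a', e, c', add_right_cancel (h'.lab_b.symm.trans h.lab_b),
        .inr ⟨h', .inr (.inl rfl)⟩⟩⟩
  have sC : ∀ {a b a' b'}, K.PosTri a b e → K.NegTri a' b' e → False := fun {a b a' b'} h h' =>
    hR e (K.lab a) ⟨⟨a', b', e, add_right_cancel (h'.lab_c.symm.trans h.lab_c),
      .inr ⟨h', .inr (.inr rfl)⟩⟩, ⟨a, b, e, rfl, .inl ⟨h, .inr (.inr rfl)⟩⟩⟩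
  have tA : (∃ b c, K.PosTri e b c) ∨ (∃ b c, K.NegTri e b c) → K.RoleA e := by
    rintro (⟨b, c, h⟩ | ⟨b, c, h⟩)
    exacts [⟨b, c, .inl h⟩, ⟨b, c, .inr h⟩]
  have tB : (∃ a c, K.PosTri a e c) ∨ (∃ a c, K.NegTri a e c) → K.RoleB e := by
    rintro (⟨b, c, h⟩ | ⟨b, c, h⟩)
    exacts [⟨b, c, .inl h⟩, ⟨b, c, .inr h⟩]
  have tC : (∃ a b, K.PosTri a b e) ∨ (∃ a b, K.NegTri a b e) → K.RoleC e := by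
    rintro (⟨b, c, h⟩ | ⟨b, c, h⟩)
    exacts [⟨b, c, .inl h⟩, ⟨b, c, .inr h⟩]
  have uA : (∃ b c, K.PosTri e b c) → (∃ b c, K.NegTri e b c) → False :=
    fun ⟨_, _, h⟩ ⟨_, _, h'⟩ => sA h h'
  have uB : (∃ a c, K.PosTri a e c) → (∃ a c, K.NegTri a e c) → False :=
    fun ⟨_, _, h⟩ ⟨_, _, h'⟩ => sB h h'
  have uC : (∃ a b, K.PosTri a b e) → (∃ a b, K.NegTri a b e) → False :=
    fun ⟨_, _, h⟩ ⟨_, _, h'⟩ => sC h h'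
  rcases hl with l | l | l <;> rcases hr with r | r | r
  · exact (uA l r).elim
  · exact .inl ⟨tA (.inl l), tB (.inr r), h3 (tA (.inl l)) (tB (.inr r))⟩
  · exact .inr (.inl ⟨tA (.inl l), fun b => h3 (tA (.inl l)) b (tC (.inl r)), tC (.inl r)⟩)
  · exact .inl ⟨tA (.inr r), tB (.inl l), h3 (tA (.inr r)) (tB (.inl l))⟩
  · exact (uB l r).elim
  · exact .inr (.inr ⟨fun a => h3 a (tB (.inl l)) (tC (.inl r)), tB (.inl l), tC (.inl r)⟩)
  · exact .inr (.inl ⟨tA (.inr r), fun b => h3 (tA (.inr r)) b (tC (.inr l)), tC (.inr l)⟩)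
  · exact .inr (.inr ⟨fun a => h3 a (tB (.inr r)) (tC (.inr l)), tB (.inr r), tC (.inr l)⟩)
  · exact (uC r l).elim

/-! ### Edges at an interior vertex -/

theorem isOuter_rev_rot (d : D) : K.IsOuter (K.rev (K.rot d)) ↔ K.IsOuter d := by
  rw [← isOuter_face]; simp [face, K.rev_rev]

variable (K) in
/-- `e` is an outward edge at `v`. -/
def OutAt (v : K.Vertex) (e : D) : Prop := K.pos e ∧ K.tail e = v

variable (K) in
/-- `e` is an inward edge at `v`. -/
def InAt (v : K.Vertex) (e : D) : Prop := K.pos e ∧ K.head e = v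

theorem not_isOuter_rev_of_interior {v : K.Vertex} (hv : K.IsInterior v) {d : D}
    (hd : K.tail d = v) : ¬ K.IsOuter (K.rev d) := by
  have h := hv (K.rot⁻¹ d) (by rw [← hd, ← tail_rot (K.rot⁻¹ d)]; simp)
  rw [← isOuter_rev_rot] at h
  simpa using h

theorem OutAt.inner {v : K.Vertex} (hv : K.IsInterior v) {e : D} (h : K.OutAt v e) : K.Inner e :=
  ⟨h.1, hv e h.2, not_isOuter_rev_of_interior hv h.2⟩

theorem InAt.inner {v : K.Vertex} (hv : K.IsInterior v) {e : D} (h : K.InAt v e) : K.Inner e :=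
  ⟨h.1, by simpa [K.rev_rev] using not_isOuter_rev_of_interior hv h.2, hv _ h.2⟩

theorem OutNext.outAt {v : K.Vertex} {e f : D} (h : K.OutNext e f) (he : K.OutAt v e) :
    K.OutAt v f := ⟨h.roleC.pos, h.tail_eq.trans he.2⟩
theorem OutNext.outAt' {v : K.Vertex} {e f : D} (h : K.OutNext e f) (he : K.OutAt v f) :
    K.OutAt v e := ⟨h.roleA.pos, h.tail_eq.symm.trans he.2⟩
theorem InNext.inAt {v : K.Vertex} {e f : D} (h : K.InNext e f) (he : K.InAt v e) :
    K.InAt v f := ⟨h.roleB.pos, h.head_eq.trans he.2⟩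
theorem InNext.inAt' {v : K.Vertex} {e f : D} (h : K.InNext e f) (he : K.InAt v f) :
    K.InAt v e := ⟨h.roleC.pos, h.head_eq.symm.trans he.2⟩
theorem Transit.outAt {v : K.Vertex} {e f : D} (h : K.Transit e f) (he : K.InAt v e) :
    K.OutAt v f := ⟨h.roleB.pos, h.tail_eq.trans he.2⟩
theorem Transit.inAt {v : K.Vertex} {e f : D} (h : K.Transit e f) (he : K.OutAt v f) :
    K.InAt v e := ⟨h.roleA.pos, h.tail_eq.symm.trans he.2⟩

/-- The edges at an interior vertex form a single cycle: a nonempty family of them that is closed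
under passing to neighbours contains them all. -/
theorem eq_all_of_closed [Finite D] (hF : K.Filled) {v : K.Vertex} (hv : K.IsInterior v)
    (O I : D → Prop) (hne : (∃ e, K.OutAt v e ∧ O e) ∨ ∃ e, K.InAt v e ∧ I e)
    (h1 : ∀ e f, K.OutNext e f → K.OutAt v e → (O e ↔ O f))
    (h2 : ∀ e f, K.InNext e f → K.InAt v e → (I e ↔ I f))
    (h3 : ∀ e f, K.Transit e f → K.InAt v e → (I e ↔ O f)) :
    (∀ e, K.OutAt v e → O e) ∧ ∀ e, K.InAt v e → I e := by
  have step : ∀ d, K.tail d = v → ((K.pos d ∧ O d) ∨ (¬ K.pos d ∧ I (K.rev d))) →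
      ((K.pos (K.rot d) ∧ O (K.rot d)) ∨ (¬ K.pos (K.rot d) ∧ I (K.rev (K.rot d)))) := by
    intro d hd hP
    obtain ⟨i, a, b, c, -, (⟨h, h' | h' | h'⟩ | ⟨h, h' | h' | h'⟩)⟩ := hF d (hv d hd)
    · subst h'
      rw [h.rot_a]
      have := (h1 d c ⟨b, .inl h⟩ ⟨h.pos_a, hd⟩).1
      have := h.pos_a; have := h.pos_c
      tauto
    · subst h'
      rw [h.rot_b, K.rev_rev]
      have ht : K.Tri a d c := .inl h
      have := (h3 a d ⟨c, ht⟩ ⟨h.pos_a, by rw [← ht.tail_b, hd]⟩).2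
      have := h.pos_b; have := not_pos_rev h.pos_a
      tauto
    · subst h'
      rw [h.rot_c, K.rev_rev]
      have ht : K.Tri a b c := .inl h
      have := (h2 c b ⟨a, ht⟩ ⟨h.pos_c, hd⟩).1
      rw [K.rev_rev] at hP
      have := not_pos_rev h.pos_c; have := not_pos_rev h.pos_b
      tauto
    · subst h'
      rw [h.rot_a]
      have ht : K.Tri a b c := .inr h
      have := (h3 a b ⟨c, ht⟩ ⟨h.pos_a, hd⟩).1
      rw [K.rev_rev] at hP
      have := not_pos_rev h.pos_a; have := h.pos_b
      tauto
    · subst h'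
      rw [h.rot_b, K.rev_rev]
      have ht : K.Tri a b c := .inr h
      have := (h2 c b ⟨a, ht⟩ ⟨h.pos_c, ht.head_c.trans hd⟩).2
      rw [K.rev_rev] at hP
      have := not_pos_rev h.pos_c; have := not_pos_rev h.pos_b
      tauto
    · subst h'
      rw [h.rot_c]
      have ht : K.Tri a b d := .inr h
      have := (h1 a d ⟨b, ht⟩ ⟨h.pos_a, ht.tail_c.symm.trans hd⟩).2
      have := h.pos_a; have := h.pos_c
      tauto
  have all : ∀ d, K.tail d = v → ((K.pos d ∧ O d) ∨ (¬ K.pos d ∧ I (K.rev d))) := by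
    obtain ⟨d₀, hd₀, hP⟩ : ∃ d₀, K.tail d₀ = v ∧
        ((K.pos d₀ ∧ O d₀) ∨ (¬ K.pos d₀ ∧ I (K.rev d₀))) := by
      rcases hne with ⟨e, he, hO⟩ | ⟨e, he, hI⟩
      · exact ⟨e, he.2, .inl ⟨he.1, hO⟩⟩
      · exact ⟨K.rev e, he.2, .inr ⟨not_pos_rev he.1, by rwa [K.rev_rev]⟩⟩
    intro d hd
    have hsc : K.rot.SameCycle d₀ d :=
      Quotient.exact (s := Equiv.Perm.SameCycle.setoid K.rot) (hd₀.trans hd.symm)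
    obtain ⟨k, -, rfl⟩ := hsc.exists_pow_eq'
    have : ∀ k : ℕ, K.tail ((K.rot ^ k) d₀) = v ∧ ((K.pos ((K.rot ^ k) d₀) ∧ O ((K.rot ^ k) d₀)) ∨
        (¬ K.pos ((K.rot ^ k) d₀) ∧ I (K.rev ((K.rot ^ k) d₀)))) := by
      intro k
      induction k with
      | zero => exact ⟨hd₀, hP⟩
      | succ k ih =>
        rw [pow_succ', Equiv.Perm.mul_apply, tail_rot]
        exact ⟨ih.1, step _ ih.1 ih.2⟩
    exact (this k).2
  refine ⟨fun e he => ?_, fun e he => ?_⟩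
  · rcases all e he.2 with h | h
    exacts [h.2, absurd he.1 h.1]
  · rcases all (K.rev e) he.2 with h | h
    · exact absurd h.1 (not_pos_rev he.1)
    · simpa [K.rev_rev] using h.2

end LabelledMap

/-! ### Chains and cycles of a partial injection -/

theorem exists_chain_from {α : Type*} [Finite α] {R : α → α → Prop}
    (hinj : ∀ a a' b, R a b → R a' b → a = a') {e : α} (he : ∀ q, ¬ R q e) :
    ∃ (m : ℕ) (y : ℕ → α), y 0 = e ∧ (∀ k < m, R (y k) (y (k + 1))) ∧ (∀ q, ¬ R (y m) q) ∧
      Set.InjOn y (Set.Iic m) := by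
  classical
  let f : α → α := fun a => if h : ∃ b, R a b then h.choose else a
  have hf : ∀ a, (∃ b, R a b) → R a (f a) := fun a h => by
    simp only [f, dif_pos h]; exact h.choose_spec
  let y : ℕ → α := fun k => f^[k] e
  have hy : ∀ k, y (k + 1) = f (y k) := fun k => Function.iterate_succ_apply' f k e
  have back : ∀ m, (∀ k < m, R (y k) (y (k + 1))) → Set.InjOn y (Set.Iic m) := by
    intro m hm
    have key : ∀ j k, j < k → k ≤ m → y j ≠ y k := by
      intro j
      induction j with
      | zero =>
        intro k hk hkm h
        obtain ⟨k, rfl⟩ := Nat.exists_eq_succ_of_ne_zero hk.ne'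
        exact he _ (by simpa [y] using h ▸ hm k (by omega))
      | succ j ih =>
        intro k hk hkm h
        obtain ⟨k, rfl⟩ := Nat.exists_eq_succ_of_ne_zero (by omega : k ≠ 0)
        exact ih k (by omega) (by omega)
          (hinj _ _ _ (hm j (by omega)) (h ▸ hm k (by omega)))
    intro j hj k hk h
    rcases lt_trichotomy j k with h' | h' | h'
    · exact (key j k h' hk h).elim
    · exact h'
    · exact (key k j h' hj h.symm).elim
  have ends : ∃ m, ¬ ∃ q, R (y m) q := by
    by_contra! hall
    have : Function.Injective y := fun j k h =>
      back (max j k) (fun k _ => hy k ▸ hf _ (hall k)) (le_max_left j k) (le_max_right j k) h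
    exact not_injective_infinite_finite y this
  have hlt : ∀ k < Nat.find ends, R (y k) (y (k + 1)) := fun k hk =>
    hy k ▸ hf _ (not_not.1 (Nat.find_min ends hk))
  exact ⟨Nat.find ends, y, rfl, hlt, not_exists.1 (Nat.find_spec ends), back _ hlt⟩

theorem exists_chain_to {α : Type*} [Finite α] {R : α → α → Prop}
    (hinj : ∀ a b b', R a b → R a b' → b = b') {e : α} (he : ∀ q, ¬ R e q) :
    ∃ (m : ℕ) (y : ℕ → α), y m = e ∧ (∀ k < m, R (y k) (y (k + 1))) ∧ (∀ q, ¬ R q (y 0)) ∧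
      Set.InjOn y (Set.Iic m) := by
  obtain ⟨m, y, h0, h1, h2, h3⟩ :=
    exists_chain_from (R := fun a b => R b a) (fun a a' b h h' => hinj b a a' h h') he
  refine ⟨m, fun k => y (m - k), by simpa using h0, fun k hk => ?_, by simpa using h2, ?_⟩
  · have := h1 (m - (k + 1)) (by omega)
    rwa [show m - (k + 1) + 1 = m - k by omega] at this
  · intro j hj k hk h
    simp only [Set.mem_Iic] at hj hk
    have := h3 (show m - j ≤ m by omega) (show m - k ≤ m by omega) h
    omega

theorem exists_cycle {α : Type*} [Finite α] {R : α → α → Prop} {S : α → Prop}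
    (hinj : ∀ a a' b, R a b → R a' b → a = a') (hS : ∀ a, S a → ∃ b, S b ∧ R a b) {e : α}
    (he : S e) :
    ∃ (p : ℕ) (y : ℕ → α), 0 < p ∧ y 0 = e ∧ (∀ k, S (y k)) ∧ (∀ k, R (y k) (y (k + 1))) ∧
      y p = e ∧ Set.InjOn y (Set.Iio p) := by
  choose! f hfS hfR using hS
  let g : {a // S a} → {a // S a} := fun a => ⟨f a, hfS a a.2⟩
  have hg : Function.Injective g := fun a a' h => Subtype.ext
    (hinj _ _ _ (hfR a a.2)
      (by rw [show f a = f a' from congrArg Subtype.val h]; exact hfR a' a'.2))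
  let e' : {a // S a} := ⟨e, he⟩
  have hp : e' ∈ Function.periodicPts g := hg.mem_periodicPts e'
  refine ⟨Function.minimalPeriod g e', fun k => (g^[k] e').1,
    Function.minimalPeriod_pos_of_mem_periodicPts hp, rfl, fun k => (g^[k] e').2, fun k => ?_,
    congrArg Subtype.val (Function.isPeriodicPt_minimalPeriod g e'), ?_⟩
  · simp only [Function.iterate_succ_apply']
    exact hfR _ (g^[k] e').2
  · intro j hj k hk h
    exact Function.iterate_injOn_Iio_minimalPeriod hj hk (Subtype.ext h)

namespace LabelledMap

variable {n : ℕ} {D : Type*} {K : LabelledMap n D}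

/-! ### Sequences of edges at an interior vertex -/

variable (K) in
/-- `y 0, …, y m` is a maximal sequence of consecutive outward edges at `v`, and not a cycle. -/
structure OutChain (v : K.Vertex) (m : ℕ) (y : ℕ → D) : Prop where
  one_le : 1 ≤ m
  mem : ∀ k ≤ m, K.OutAt v (y k)
  inj : Set.InjOn y (Set.Iic m)
  next : ∀ k < m, K.OutNext (y k) (y (k + 1))
  first : ¬ K.RoleC (y 0)
  last : ¬ K.RoleA (y m)

variable (K) in
/-- `x 0, …, x m` is a maximal sequence of consecutive inward edges at `v`, and not a cycle. -/
structure InChain (v : K.Vertex) (m : ℕ) (x : ℕ → D) : Prop where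
  one_le : 1 ≤ m
  mem : ∀ k ≤ m, K.InAt v (x k)
  inj : Set.InjOn x (Set.Iic m)
  next : ∀ k < m, K.InNext (x k) (x (k + 1))
  first : ¬ K.RoleB (x 0)
  last : ¬ K.RoleC (x m)

section Chains

variable {v : K.Vertex} {m : ℕ} {x y : ℕ → D}

theorem OutChain.roleA (h : K.OutChain v m y) {k : ℕ} (hk : k < m) : K.RoleA (y k) :=
  (h.next k hk).roleA

theorem OutChain.roleC (h : K.OutChain v m y) {k : ℕ} (h0 : 0 < k) (hk : k ≤ m) :
    K.RoleC (y k) := by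
  obtain ⟨k, rfl⟩ := Nat.exists_eq_succ_of_ne_zero h0.ne'
  exact (h.next k (by omega)).roleC

theorem InChain.roleC (h : K.InChain v m x) {k : ℕ} (hk : k < m) : K.RoleC (x k) :=
  (h.next k hk).roleC

theorem InChain.roleB (h : K.InChain v m x) {k : ℕ} (h0 : 0 < k) (hk : k ≤ m) :
    K.RoleB (x k) := by
  obtain ⟨k, rfl⟩ := Nat.exists_eq_succ_of_ne_zero h0.ne'
  exact (h.next k (by omega)).roleB

theorem OutChain.eq_end (h : K.OutChain v m y) {k : ℕ} (hk : k ≤ m) (hB : K.RoleB (y k)) :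
    k = 0 ∨ k = m := by
  by_contra! hne
  exact not_all_roles (h.roleA (by omega)) hB (h.roleC (by omega) hk)

theorem InChain.eq_end (h : K.InChain v m x) {k : ℕ} (hk : k ≤ m) (hA : K.RoleA (x k)) :
    k = 0 ∨ k = m := by
  by_contra! hne
  exact not_all_roles hA (h.roleB (by omega) hk) (h.roleC (by omega))

theorem OutChain.closed (hR : K.Reduced) (h : K.OutChain v m y) {e f : D} (hef : K.OutNext e f) :
    (∃ k ≤ m, y k = e) ↔ ∃ k ≤ m, y k = f := by
  constructor
  · rintro ⟨k, hk, rfl⟩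
    rcases hk.lt_or_eq with hk | rfl
    · exact ⟨k + 1, hk, (h.next k hk).right_unique hR hef⟩
    · exact (h.last hef.roleA).elim
  · rintro ⟨k, hk, rfl⟩
    rcases Nat.eq_zero_or_pos k with rfl | h0
    · exact (h.first hef.roleC).elim
    · obtain ⟨k, rfl⟩ := Nat.exists_eq_succ_of_ne_zero h0.ne'
      exact ⟨k, by omega, (h.next k (by omega)).left_unique hR hef⟩

theorem InChain.closed (hR : K.Reduced) (h : K.InChain v m x) {e f : D} (hef : K.InNext e f) :
    (∃ k ≤ m, x k = e) ↔ ∃ k ≤ m, x k = f := by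
  constructor
  · rintro ⟨k, hk, rfl⟩
    rcases hk.lt_or_eq with hk | rfl
    · exact ⟨k + 1, hk, (h.next k hk).right_unique hR hef⟩
    · exact (h.last hef.roleC).elim
  · rintro ⟨k, hk, rfl⟩
    rcases Nat.eq_zero_or_pos k with rfl | h0
    · exact (h.first hef.roleB).elim
    · obtain ⟨k, rfl⟩ := Nat.exists_eq_succ_of_ne_zero h0.ne'
      exact ⟨k, by omega, (h.next k (by omega)).left_unique hR hef⟩

theorem OutChain.lab_eq (h : K.OutChain v m y) {k : ℕ} (hk : k ≤ m) :
    K.lab (y k) = K.lab (y 0) + 2 * k := by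
  induction k with
  | zero => simp
  | succ k ih => rw [(h.next k hk).lab_eq, ih (by omega)]; push_cast; ring

theorem InChain.lab_eq (h : K.InChain v m x) {k : ℕ} (hk : k ≤ m) :
    K.lab (x 0) = K.lab (x k) + k := by
  induction k with
  | zero => simp
  | succ k ih => rw [ih (by omega), (h.next k hk).lab_eq]; push_cast; ring

theorem exists_outChain [Finite D] (hR : K.Reduced) (hF : K.Filled) (hv : K.IsInterior v) {e : D}
    (he : K.OutAt v e) (hB : K.RoleB e) :
    ∃ m y, K.OutChain v m y ∧ (y 0 = e ∨ y m = e) := by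
  have hroles := (he.inner hv).roles hR hF
  by_cases hC : K.RoleC e
  · have hA : ¬ K.RoleA e := fun hA => not_all_roles hA hB hC
    obtain ⟨m, y, hm, hnext, h0, hinj⟩ := exists_chain_to (R := K.OutNext)
      (fun _ _ _ h h' => h.right_unique hR h') (e := e) (fun q hq => hA hq.roleA)
    have hmem : ∀ j ≤ m, K.OutAt v (y (m - j)) := by
      intro j
      induction j with
      | zero => intro _; rw [Nat.sub_zero, hm]; exact he
      | succ j ih =>
        intro hj
        have := hnext (m - (j + 1)) (by omega)
        rw [show m - (j + 1) + 1 = m - j by omega] at this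
        exact this.outAt' (ih (by omega))
    refine ⟨m, y, ⟨?_, fun k hk => ?_, hinj, hnext, fun h => ?_, hm ▸ hA⟩, .inr hm⟩
    · by_contra! hm0
      obtain rfl : m = 0 := by omega
      obtain ⟨q, hq⟩ := hC.outNext
      exact h0 q (hm ▸ hq)
    · simpa [Nat.sub_sub_self hk] using hmem (m - k) (by omega)
    · obtain ⟨q, hq⟩ := h.outNext
      exact h0 q hq
  · have hA : K.RoleA e := by tauto
    obtain ⟨m, y, h0, hnext, hm, hinj⟩ := exists_chain_from (R := K.OutNext)
      (fun _ _ _ h h' => h.left_unique hR h') (e := e) (fun q hq => hC hq.roleC)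
    have hmem : ∀ j ≤ m, K.OutAt v (y j) := by
      intro j
      induction j with
      | zero => intro _; rw [h0]; exact he
      | succ j ih => exact fun hj => (hnext j hj).outAt (ih (by omega))
    refine ⟨m, y, ⟨?_, hmem, hinj, hnext, h0 ▸ hC, fun h => ?_⟩, .inl h0⟩
    · by_contra! hm0
      obtain rfl : m = 0 := by omega
      obtain ⟨q, hq⟩ := hA.outNext
      exact hm q (h0 ▸ hq)
    · obtain ⟨q, hq⟩ := h.outNext
      exact hm q hq

theorem exists_inChain [Finite D] (hR : K.Reduced) (hF : K.Filled) (hv : K.IsInterior v) {e : D}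
    (he : K.InAt v e) (hA : K.RoleA e) :
    ∃ m x, K.InChain v m x ∧ (x 0 = e ∨ x m = e) := by
  have hroles := (he.inner hv).roles hR hF
  by_cases hB : K.RoleB e
  · have hC : ¬ K.RoleC e := fun hC => not_all_roles hA hB hC
    obtain ⟨m, y, hm, hnext, h0, hinj⟩ := exists_chain_to (R := K.InNext)
      (fun _ _ _ h h' => h.right_unique hR h') (e := e) (fun q hq => hC hq.roleC)
    have hmem : ∀ j ≤ m, K.InAt v (y (m - j)) := by
      intro j
      induction j with
      | zero => intro _; rw [Nat.sub_zero, hm]; exact he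
      | succ j ih =>
        intro hj
        have := hnext (m - (j + 1)) (by omega)
        rw [show m - (j + 1) + 1 = m - j by omega] at this
        exact this.inAt' (ih (by omega))
    refine ⟨m, y, ⟨?_, fun k hk => ?_, hinj, hnext, fun h => ?_, hm ▸ hC⟩, .inr hm⟩
    · by_contra! hm0
      obtain rfl : m = 0 := by omega
      obtain ⟨q, hq⟩ := hB.inNext
      exact h0 q (hm ▸ hq)
    · simpa [Nat.sub_sub_self hk] using hmem (m - k) (by omega)
    · obtain ⟨q, hq⟩ := h.inNext
      exact h0 q hq
  · have hC : K.RoleC e := by tauto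
    obtain ⟨m, y, h0, hnext, hm, hinj⟩ := exists_chain_from (R := K.InNext)
      (fun _ _ _ h h' => h.left_unique hR h') (e := e) (fun q hq => hB hq.roleB)
    have hmem : ∀ j ≤ m, K.InAt v (y j) := by
      intro j
      induction j with
      | zero => intro _; rw [h0]; exact he
      | succ j ih => exact fun hj => (hnext j hj).inAt (ih (by omega))
    refine ⟨m, y, ⟨?_, hmem, hinj, hnext, h0 ▸ hB, fun h => ?_⟩, .inl h0⟩
    · by_contra! hm0
      obtain rfl : m = 0 := by omega
      obtain ⟨q, hq⟩ := hC.inNext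
      exact hm q (h0 ▸ hq)
    · obtain ⟨q, hq⟩ := h.inNext
      exact hm q hq

end Chains

variable (K) in
/-- The edges at `v` are one outward chain `y` and one inward chain `x`. -/
structure OneChain (v : K.Vertex) (l m : ℕ) (x y : ℕ → D) : Prop where
  out : K.OutChain v m y
  inw : K.InChain v l x
  out_all : ∀ e, K.OutAt v e → ∃ k ≤ m, y k = e
  in_all : ∀ e, K.InAt v e → ∃ k ≤ l, x k = e
  ends : (K.Transit (x l) (y 0) ∧ K.Transit (x 0) (y m)) ∨
    (K.Transit (x 0) (y 0) ∧ K.Transit (x l) (y m))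

variable (K) in
/-- Two distinct outward chains and two distinct inward chains at `v`, the second inward chain,
the first outward chain, the first inward chain and the second outward chain being adjacent in
this order. -/
structure TwoChains (v : K.Vertex) (l l' m m' : ℕ) (x x' y y' : ℕ → D) : Prop where
  out : K.OutChain v m y
  out' : K.OutChain v m' y'
  inw : K.InChain v l x
  inw' : K.InChain v l' x'
  out_ne : ∀ k ≤ m, ∀ k' ≤ m', y k ≠ y' k'
  in_ne : ∀ k ≤ l, ∀ k' ≤ l', x k ≠ x' k'
  link : (K.Transit (x 0) (y m) ∧ (K.Transit (x l) (y' 0) ∨ K.Transit (x l) (y' m'))) ∨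
    (K.Transit (x l) (y m) ∧ (K.Transit (x 0) (y' 0) ∨ K.Transit (x 0) (y' m')))
  link' : K.Transit (x' 0) (y 0) ∨ K.Transit (x' l') (y 0)

/-- The four ways in which the edges at an interior vertex can be arranged. -/
theorem interior_cases [Finite D] (hR : K.Reduced) (hF : K.Filled) {v : K.Vertex}
    (hv : K.IsInterior v) :
    ((∀ e, ¬ K.InAt v e) ∧ ∀ e, K.OutAt v e → ¬ K.RoleB e) ∨
    ((∀ e, ¬ K.OutAt v e) ∧ ∀ e, K.InAt v e → ¬ K.RoleA e) ∨
    (∃ l m x y, K.OneChain v l m x y) ∨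
    ∃ l l' m m' x x' y y', K.TwoChains v l l' m m' x x' y y' := by
  by_cases hne : ∃ e, K.OutAt v e ∧ K.RoleB e
  swap
  · push Not at hne
    by_cases hout : ∃ e, K.OutAt v e
    · refine .inl ⟨?_, hne⟩
      obtain ⟨e, he⟩ := hout
      refine (eq_all_of_closed hF hv (fun _ => True) (fun _ => False) (.inl ⟨e, he, trivial⟩)
        (fun _ _ _ _ => Iff.rfl) (fun _ _ _ _ => Iff.rfl) (fun a b hab ha => ?_)).2
      exact (hne b (hab.outAt ha) hab.roleB).elim
    · push Not at hout
      refine .inr (.inl ⟨hout, fun e he hA => ?_⟩)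
      obtain ⟨f, hf⟩ := hA.transit
      exact hout f (hf.outAt he)
  obtain ⟨e, he, hB⟩ := hne
  obtain ⟨m, y, hy, -⟩ := exists_outChain hR hF hv he hB
  have hym : K.RoleB (y m) := by
    have h1 := ((hy.mem m le_rfl).inner hv).roles hR hF
    have h2 := hy.last
    tauto
  have hy0 : K.RoleB (y 0) := by
    have h1 := ((hy.mem 0 (by omega)).inner hv).roles hR hF
    have h2 := hy.first
    tauto
  have hne0m : y 0 ≠ y m := fun h => by
    have := hy.inj (Set.mem_Iic.2 (by omega)) (Set.mem_Iic.2 le_rfl) h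
    have := hy.one_le
    omega
  obtain ⟨z, hz⟩ := hym.transit
  have hzv := hz.inAt (hy.mem m le_rfl)
  obtain ⟨l, x, hx, hxz⟩ := exists_inChain hR hF hv hzv hz.roleA
  have hx0l : x 0 ≠ x l := fun h => by
    have := hx.inj (Set.mem_Iic.2 (by omega)) (Set.mem_Iic.2 le_rfl) h
    have := hx.one_le
    omega
  have hxA0 : K.RoleA (x 0) := by
    have h1 := ((hx.mem 0 (by omega)).inner hv).roles hR hF
    have h2 := hx.first
    tauto
  have hxAl : K.RoleA (x l) := by
    have h1 := ((hx.mem l le_rfl).inner hv).roles hR hF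
    have h2 := hx.last
    tauto
  -- The other end `z'` of the inward chain.
  obtain ⟨z', hz'z, hz'A, hz'v, hxz'⟩ : ∃ z', z' ≠ z ∧ K.RoleA z' ∧ K.InAt v z' ∧
      ((x 0 = z ∧ x l = z') ∨ (x l = z ∧ x 0 = z')) := by
    rcases hxz with h | h
    · exact ⟨x l, fun h' => hx0l (h.trans h'.symm), hxAl, hx.mem l le_rfl, .inl ⟨h, rfl⟩⟩
    · exact ⟨x 0, fun h' => hx0l (h'.trans h.symm), hxA0, hx.mem 0 (by omega), .inr ⟨h, rfl⟩⟩
  obtain ⟨w, hw⟩ := hz'A.transit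
  have hwv := hw.outAt hz'v
  have hends : ∀ u, (∃ k ≤ l, x k = u) → K.RoleA u → u = z ∨ u = z' := by
    rintro u ⟨k, hk, rfl⟩ hA
    rcases hx.eq_end hk hA with rfl | rfl <;> rcases hxz' with ⟨h, h'⟩ | ⟨h, h'⟩ <;> simp [h, h']
  have hzmem : (∃ k ≤ l, x k = z) ∧ ∃ k ≤ l, x k = z' := by
    rcases hxz' with ⟨h, h'⟩ | ⟨h, h'⟩
    exacts [⟨⟨0, by omega, h⟩, ⟨l, le_rfl, h'⟩⟩, ⟨⟨l, le_rfl, h⟩, ⟨0, by omega, h'⟩⟩]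
  by_cases hwy : w = y 0
  · subst hwy
    right; right; left
    have hall := eq_all_of_closed hF hv (fun e => ∃ k ≤ m, y k = e) (fun e => ∃ k ≤ l, x k = e)
      (.inl ⟨y 0, hwv, 0, by omega, rfl⟩) (fun e f h _ => hy.closed hR h)
      (fun e f h _ => hx.closed hR h) (fun e f h _ => by
        constructor
        · intro hmem
          rcases hends e hmem h.roleA with rfl | rfl
          · exact ⟨m, le_rfl, hz.right_unique hR h⟩
          · exact ⟨0, by omega, hw.right_unique hR h⟩
        · rintro ⟨k, hk, rfl⟩
          rcases hy.eq_end hk h.roleB with rfl | rfl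
          · rw [h.left_unique hR hw]; exact hzmem.2
          · rw [h.left_unique hR hz]; exact hzmem.1)
    refine ⟨l, m, x, y, hy, hx, hall.1, hall.2, ?_⟩
    rcases hxz' with ⟨h, h'⟩ | ⟨h, h'⟩
    · exact .inl ⟨h'.symm ▸ hw, h.symm ▸ hz⟩
    · exact .inr ⟨h'.symm ▸ hw, h.symm ▸ hz⟩
  · right; right; right
    obtain ⟨m', y', hy', hyw⟩ := exists_outChain hR hF hv hwv hw.roleB
    have hwout : ¬ ∃ k ≤ m, y k = w := by
      rintro ⟨k, hk, rfl⟩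
      rcases hy.eq_end hk hw.roleB with rfl | rfl
      · exact hwy rfl
      · exact hz'z (hw.left_unique hR hz)
    have hout : ∀ k' ≤ m', (∃ k ≤ m, y k = y' k') ↔ ∃ k ≤ m, y k = y' 0 := by
      intro k'
      induction k' with
      | zero => simp
      | succ k' ih => exact fun hk => (hy.closed hR (hy'.next k' hk)).symm.trans (ih (by omega))
    obtain ⟨z₂, hz₂⟩ := hy0.transit
    have hz₂v := hz₂.inAt (hy.mem 0 (by omega))
    obtain ⟨l', x', hx', hxz₂⟩ := exists_inChain hR hF hv hz₂v hz₂.roleA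
    have hz₂in : ¬ ∃ k ≤ l, x k = z₂ := by
      intro h
      rcases hends _ h hz₂.roleA with rfl | rfl
      · exact hne0m (hz₂.right_unique hR hz)
      · exact hwy (hw.right_unique hR hz₂)
    have hin : ∀ k' ≤ l', (∃ k ≤ l, x k = x' k') ↔ ∃ k ≤ l, x k = x' 0 := by
      intro k'
      induction k' with
      | zero => simp
      | succ k' ih => exact fun hk => (hx.closed hR (hx'.next k' hk)).symm.trans (ih (by omega))
    refine ⟨l, l', m, m', x, x', y, y', hy, hy', hx, hx', ?_, ?_, ?_, ?_⟩
    · intro k hk k' hk' h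
      have h0 := (hout k' hk').1 ⟨k, hk, h⟩
      rcases hyw with rfl | rfl
      · exact hwout h0
      · exact hwout ((hout m' le_rfl).2 h0)
    · intro k hk k' hk' h
      have h0 := (hin k' hk').1 ⟨k, hk, h⟩
      rcases hxz₂ with rfl | rfl
      · exact hz₂in h0
      · exact hz₂in ((hin l' le_rfl).2 h0)
    · rcases hxz' with ⟨h, h'⟩ | ⟨h, h'⟩
      · refine .inl ⟨h.symm ▸ hz, ?_⟩
        rcases hyw with rfl | rfl
        exacts [.inl (h'.symm ▸ hw), .inr (h'.symm ▸ hw)]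
      · refine .inr ⟨h.symm ▸ hz, ?_⟩
        rcases hyw with rfl | rfl
        exacts [.inl (h'.symm ▸ hw), .inr (h'.symm ▸ hw)]
    · rcases hxz₂ with rfl | rfl
      exacts [.inl hz₂, .inr hz₂]

/-! ### Counting edge ends -/

theorem card_ends [Finite D] (v : K.Vertex) (P : D → Prop) :
    Nat.card {d : D // K.tail d = v ∧ P d} =
      {e | K.OutAt v e ∧ P e}.ncard + {e | K.InAt v e ∧ P (K.rev e)}.ncard := by
  rw [← Set.ncard_image_of_injective {e | K.InAt v e ∧ P (K.rev e)} K.rev.injective,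
    ← Set.ncard_union_eq _ (Set.toFinite _) (Set.toFinite _)]
  · change Set.ncard {d | K.tail d = v ∧ P d} = _
    congr 1
    ext d
    simp only [Set.mem_ofPred_eq, Set.mem_union, Set.mem_image, OutAt, InAt]
    constructor
    · rintro ⟨h1, h2⟩
      by_cases hd : K.pos d
      · exact .inl ⟨⟨hd, h1⟩, h2⟩
      · exact .inr ⟨K.rev d, ⟨⟨(K.pos_rev d).2 hd, by rwa [head_rev]⟩, by rwa [K.rev_rev]⟩,
          K.rev_rev d⟩
    · rintro (⟨h1, h2⟩ | ⟨e, ⟨h1, h2⟩, rfl⟩)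
      exacts [⟨h1.2, h2⟩, ⟨h1.2, h2⟩]
  · rw [Set.disjoint_left]
    rintro _ h ⟨e, h', rfl⟩
    exact not_pos_rev h'.1.1 h.1.1

theorem degree_eq [Finite D] (v : K.Vertex) :
    K.degree v = {e | K.OutAt v e}.ncard + {e | K.InAt v e}.ncard := by
  have := card_ends v (fun _ => True)
  simpa [degree] using this

theorem coloured_rev (d : D) : K.Coloured (K.rev d) ↔ K.Coloured d := by
  rw [Coloured, Coloured, K.rev_rev, or_comm]

theorem uncoloured_eq [Finite D] (v : K.Vertex) :
    K.uncoloured v = {e | K.OutAt v e ∧ ¬ K.Coloured e}.ncard +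
      {e | K.InAt v e ∧ ¬ K.Coloured e}.ncard := by
  have := card_ends v (fun d => ¬ K.Coloured d)
  simp only [coloured_rev] at this
  exact this

theorem uncoloured_le_degree [Finite D] (v : K.Vertex) : K.uncoloured v ≤ K.degree v := by
  rw [uncoloured_eq, degree_eq]
  exact add_le_add (Set.ncard_le_ncard (fun e h => h.1)) (Set.ncard_le_ncard (fun e h => h.1))

theorem ncard_of_enum {α : Type*} {S : α → Prop} {m : ℕ} {y : ℕ → α} (P : α → Prop)
    [DecidablePred fun k => P (y k)] (hinj : Set.InjOn y (Set.Iio m)) (hS : ∀ k < m, S (y k))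
    (hall : ∀ e, S e → ∃ k < m, y k = e) :
    {e | S e ∧ P e}.ncard = ((Finset.range m).filter fun k => P (y k)).card := by
  rw [← Set.ncard_coe_finset, ← Set.InjOn.ncard_image (f := y)]
  · congr 1
    ext e
    simp only [Set.mem_ofPred_eq, Set.mem_image, Finset.coe_filter, Finset.mem_range]
    constructor
    · rintro ⟨h1, h2⟩
      obtain ⟨k, hk, rfl⟩ := hall e h1
      exact ⟨k, ⟨hk, h2⟩, rfl⟩
    · rintro ⟨k, ⟨hk, h2⟩, rfl⟩
      exact ⟨hS k hk, h2⟩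
  · intro j hj k hk h
    simp only [Finset.coe_filter, Finset.mem_range, Set.mem_ofPred_eq] at hj hk
    exact hinj hj.1 hk.1 h

theorem ncard_of_enum' {α : Type*} {S : α → Prop} {m : ℕ} {y : ℕ → α}
    (hinj : Set.InjOn y (Set.Iio m)) (hS : ∀ k < m, S (y k))
    (hall : ∀ e, S e → ∃ k < m, y k = e) : {e | S e}.ncard = m := by
  have := ncard_of_enum (fun _ => True) hinj hS hall
  simpa using this

/-! ### Vertices whose edges all point in the same direction -/

variable (K) in
/-- The standing assumptions on `n`, together with those on `K` that concern single faces
and pairs of adjacent faces: reducedness, and that all faces but the outer one carry relators. -/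
structure IsReducedDiagram : Prop where
  odd : Odd n
  le : 11 ≤ n
  reduced : K.Reduced
  filled : K.Filled

theorem IsReducedDiagram.dvd_of_two_mul (hK : K.IsReducedDiagram) {p : ℕ}
    (h : (2 * p : ZMod n) = 0) : n ∣ p := by
  have : n ∣ 2 * p := by
    rw [← ZMod.natCast_eq_zero_iff]; exact_mod_cast h
  exact (Nat.Coprime.dvd_of_dvd_mul_left (Nat.coprime_two_right.2 hK.odd) this)

theorem IsReducedDiagram.roles (hK : K.IsReducedDiagram) {e : D} (h : K.Inner e) :
    (K.RoleA e ∧ K.RoleB e ∧ ¬ K.RoleC e) ∨ (K.RoleA e ∧ ¬ K.RoleB e ∧ K.RoleC e) ∨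
      (¬ K.RoleA e ∧ K.RoleB e ∧ K.RoleC e) := h.roles hK.reduced hK.filled

theorem exists_end (v : K.Vertex) : ∃ e, K.OutAt v e ∨ K.InAt v e := by
  induction v using Quotient.inductionOn with
  | h d =>
    by_cases hd : K.pos d
    · exact ⟨d, .inl ⟨hd, rfl⟩⟩
    · exact ⟨K.rev d, .inr ⟨(K.pos_rev d).2 hd, head_rev d⟩⟩

theorem exists_out_cycle [Finite D] (hK : K.IsReducedDiagram) {v : K.Vertex} (hv : K.IsInterior v)
    (hin : ∀ e, ¬ K.InAt v e) (hB : ∀ e, K.OutAt v e → ¬ K.RoleB e) :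
    ∃ (p : ℕ) (y : ℕ → D), 0 < p ∧ n ∣ p ∧ (∀ k, K.OutAt v (y k)) ∧
      (∀ k, K.OutNext (y k) (y (k + 1))) ∧ y p = y 0 ∧ Set.InjOn y (Set.Iio p) ∧
      ∀ e, K.OutAt v e → ∃ k < p, y k = e := by
  obtain ⟨e, he | he⟩ := exists_end v
  swap
  · exact (hin e he).elim
  obtain ⟨p, y, hp, rfl, hmem, hnext, hyp, hinj⟩ := exists_cycle (R := K.OutNext) (S := K.OutAt v)
    (fun _ _ _ h h' => h.left_unique hK.reduced h') (fun a ha => by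
      have hr := hK.roles (ha.inner hv)
      have hb := hB a ha
      obtain ⟨f, hf⟩ := RoleA.outNext (e := a) (by tauto)
      exact ⟨f, hf.outAt ha, hf⟩) he
  have hlab : ∀ k : ℕ, K.lab (y k) = K.lab (y 0) + 2 * k := by
    intro k
    induction k with
    | zero => simp
    | succ k ih => rw [(hnext k).lab_eq, ih]; push_cast; ring
  refine ⟨p, y, hp, hK.dvd_of_two_mul ?_, hmem, hnext, hyp, hinj, ?_⟩
  · have := hlab p
    rw [hyp] at this
    exact (left_eq_add.1 this)
  · refine (eq_all_of_closed hK.filled hv (fun e => ∃ k < p, y k = e) (fun _ => False)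
      (.inl ⟨y 0, he, 0, hp, rfl⟩) (fun e f h _ => ⟨?_, ?_⟩) (fun e f h h' => (hin e h').elim)
      (fun e f h h' => (hin e h').elim)).1
    · rintro ⟨k, hk, rfl⟩
      rcases (Nat.succ_le_of_lt hk).lt_or_eq with hk' | hk'
      · exact ⟨k + 1, hk', (hnext k).right_unique hK.reduced h⟩
      · exact ⟨0, hp, by rw [← hyp, ← hk']; exact (hnext k).right_unique hK.reduced h⟩
    · rintro ⟨k, hk, rfl⟩
      rcases Nat.eq_zero_or_pos k with rfl | h0
      · refine ⟨p - 1, by omega, ?_⟩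
        have := hnext (p - 1)
        rw [Nat.sub_add_cancel hp, hyp] at this
        exact this.left_unique hK.reduced h
      · refine ⟨k - 1, by omega, ?_⟩
        have := hnext (k - 1)
        rw [Nat.sub_add_cancel h0] at this
        exact this.left_unique hK.reduced h

theorem exists_in_cycle [Finite D] (hK : K.IsReducedDiagram) {v : K.Vertex} (hv : K.IsInterior v)
    (hout : ∀ e, ¬ K.OutAt v e) (hA : ∀ e, K.InAt v e → ¬ K.RoleA e) :
    ∃ (p : ℕ) (x : ℕ → D), 0 < p ∧ n ∣ p ∧ (∀ k, K.InAt v (x k)) ∧ Set.InjOn x (Set.Iio p) ∧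
      ∀ e, K.InAt v e → ∃ k < p, x k = e := by
  obtain ⟨e, he | he⟩ := exists_end v
  · exact (hout e he).elim
  obtain ⟨p, y, hp, rfl, hmem, hnext, hyp, hinj⟩ := exists_cycle (R := K.InNext) (S := K.InAt v)
    (fun _ _ _ h h' => h.left_unique hK.reduced h') (fun a ha => by
      have hr := hK.roles (ha.inner hv)
      have hb := hA a ha
      obtain ⟨f, hf⟩ := RoleC.inNext (e := a) (by tauto)
      exact ⟨f, hf.inAt ha, hf⟩) he
  have hlab : ∀ k : ℕ, K.lab (y 0) = K.lab (y k) + k := by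
    intro k
    induction k with
    | zero => simp
    | succ k ih => rw [ih, (hnext k).lab_eq]; push_cast; ring
  refine ⟨p, y, hp, ?_, hmem, hinj, ?_⟩
  · have := hlab p
    rw [hyp] at this
    rw [← ZMod.natCast_eq_zero_iff]
    exact (left_eq_add.1 this)
  · refine (eq_all_of_closed hK.filled hv (fun _ => False) (fun e => ∃ k < p, y k = e)
      (.inr ⟨y 0, he, 0, hp, rfl⟩) (fun e f h h' => (hout e h').elim) (fun e f h _ => ⟨?_, ?_⟩)
      (fun e f h h' => (hout f (h.outAt h')).elim)).2
    · rintro ⟨k, hk, rfl⟩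
      rcases (Nat.succ_le_of_lt hk).lt_or_eq with hk' | hk'
      · exact ⟨k + 1, hk', (hnext k).right_unique hK.reduced h⟩
      · exact ⟨0, hp, by rw [← hyp, ← hk']; exact (hnext k).right_unique hK.reduced h⟩
    · rintro ⟨k, hk, rfl⟩
      rcases Nat.eq_zero_or_pos k with rfl | h0
      · refine ⟨p - 1, by omega, ?_⟩
        have := hnext (p - 1)
        rw [Nat.sub_add_cancel hp, hyp] at this
        exact this.left_unique hK.reduced h
      · refine ⟨k - 1, by omega, ?_⟩
        have := hnext (k - 1)
        rw [Nat.sub_add_cancel h0] at this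
        exact this.left_unique hK.reduced h

/-! ### Vertices with one outward and one inward sequence -/

section OneChain

variable {v : K.Vertex} {l m : ℕ} {x y : ℕ → D}

/-- Labels change by `2` along outward and by `-1` along inward sequences. -/
theorem OneChain.dvd_same (h : K.OneChain v l m x y) (h1 : K.Transit (x l) (y 0))
    (h2 : K.Transit (x 0) (y m)) : (n : ℤ) ∣ 2 * m - l := by
  rw [← ZMod.intCast_zmod_eq_zero_iff_dvd]
  push_cast
  have e1 := h1.lab_eq
  have e2 := h2.lab_eq
  rw [h.out.lab_eq le_rfl, h.inw.lab_eq le_rfl, e1] at e2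
  linear_combination e2

theorem OneChain.dvd_opposite (h : K.OneChain v l m x y) (h1 : K.Transit (x 0) (y 0))
    (h2 : K.Transit (x l) (y m)) : n ∣ 2 * m + l := by
  rw [← ZMod.natCast_eq_zero_iff]
  push_cast
  have e1 := h1.lab_eq
  have e2 := h2.lab_eq
  rw [h.out.lab_eq le_rfl, e1, h.inw.lab_eq le_rfl] at e2
  linear_combination e2

theorem OneChain.wheel (h : K.OneChain v l m x y) : K.IsWheel v (l + 1) (m + 1) x y where
  in_inj j hj k hk := h.inw.inj (Nat.lt_succ_iff.1 hj) (Nat.lt_succ_iff.1 hk)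
  in_mem d := ⟨fun hd => let ⟨k, hk, hd⟩ := h.in_all d hd; ⟨k, Nat.lt_succ_iff.2 hk, hd⟩,
    fun ⟨k, hk, hd⟩ => hd ▸ h.inw.mem k (Nat.lt_succ_iff.1 hk)⟩
  in_next k hk := h.inw.next k (by omega)
  out_inj j hj k hk := h.out.inj (Nat.lt_succ_iff.1 hj) (Nat.lt_succ_iff.1 hk)
  out_mem d := ⟨fun hd => let ⟨k, hk, hd⟩ := h.out_all d hd; ⟨k, Nat.lt_succ_iff.2 hk, hd⟩,
    fun ⟨k, hk, hd⟩ => hd ▸ h.out.mem k (Nat.lt_succ_iff.1 hk)⟩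
  out_next k hk := h.out.next k (by omega)

theorem IsWheel.ncard_out (h : K.IsWheel v l m x y) : {e | K.OutAt v e}.ncard = m :=
  ncard_of_enum' h.out_inj (fun k hk => (h.out_mem _).2 ⟨k, hk, rfl⟩) (fun e he => by
    simpa using (h.out_mem e).1 he)

theorem IsWheel.ncard_in (h : K.IsWheel v l m x y) : {e | K.InAt v e}.ncard = l :=
  ncard_of_enum' h.in_inj (fun k hk => (h.in_mem _).2 ⟨k, hk, rfl⟩) (fun e he => by
    simpa using (h.in_mem e).1 he)

end OneChain

theorem four_le_ncard {α : Type*} [Finite α] {S : Set α} {a b c d : α} (ha : a ∈ S) (hb : b ∈ S)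
    (hc : c ∈ S) (hd : d ∈ S) (hab : a ≠ b) (hac : a ≠ c) (had : a ≠ d) (hbc : b ≠ c)
    (hbd : b ≠ d) (hcd : c ≠ d) : 4 ≤ S.ncard := by
  classical
  have h : (({a, b, c, d} : Finset α) : Set α) ⊆ S := by
    intro e he
    simp only [Finset.coe_insert, Finset.coe_singleton, Set.mem_insert_iff,
      Set.mem_singleton_iff] at he
    rcases he with rfl | rfl | rfl | rfl <;> assumption
  have h' := Set.ncard_le_ncard h
  rwa [Set.ncard_coe_finset, Finset.card_insert_of_notMem (by simp [*]),
    Finset.card_insert_of_notMem (by simp [*]), Finset.card_pair hcd] at h'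

theorem OutChain.ends_ne {v : K.Vertex} {m : ℕ} {y : ℕ → D} (h : K.OutChain v m y) :
    y 0 ≠ y m := fun hh => by
  have := h.inj (Set.mem_Iic.2 (by omega)) (Set.mem_Iic.2 le_rfl) hh
  have := h.one_le
  omega

theorem InChain.ends_ne {v : K.Vertex} {m : ℕ} {x : ℕ → D} (h : K.InChain v m x) :
    x 0 ≠ x m := fun hh => by
  have := h.inj (Set.mem_Iic.2 (by omega)) (Set.mem_Iic.2 le_rfl) hh
  have := h.one_le
  omega

theorem TwoChains.le_degree [Finite D] {v : K.Vertex} {l l' m m' : ℕ} {x x' y y' : ℕ → D}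
    (h : K.TwoChains v l l' m m' x x' y y') : 8 ≤ K.degree v := by
  have hO : 4 ≤ {e | K.OutAt v e}.ncard :=
    four_le_ncard (h.out.mem _ (Nat.zero_le _)) (h.out.mem _ le_rfl) (h.out'.mem _ (Nat.zero_le _))
      (h.out'.mem _ le_rfl) h.out.ends_ne (h.out_ne _ (Nat.zero_le _) _ (Nat.zero_le _))
      (h.out_ne _ (Nat.zero_le _) _ le_rfl) (h.out_ne _ le_rfl _ (Nat.zero_le _))
      (h.out_ne _ le_rfl _ le_rfl) h.out'.ends_ne
  have hI : 4 ≤ {e | K.InAt v e}.ncard :=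
    four_le_ncard (h.inw.mem _ (Nat.zero_le _)) (h.inw.mem _ le_rfl) (h.inw'.mem _ (Nat.zero_le _))
      (h.inw'.mem _ le_rfl) h.inw.ends_ne (h.in_ne _ (Nat.zero_le _) _ (Nat.zero_le _))
      (h.in_ne _ (Nat.zero_le _) _ le_rfl) (h.in_ne _ le_rfl _ (Nat.zero_le _))
      (h.in_ne _ le_rfl _ le_rfl) h.inw'.ends_ne
  rw [degree_eq]
  omega

/-! ### Vertices of degree 5 -/

section FiveStar

variable {b c d e a : D}

namespace FiveStar

theorem first_in (h : K.FiveStar b c d e a) : ¬ K.RoleB b :=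
  fun hB => not_all_roles h.ab.roleA hB h.bc.roleC
theorem middle_in (h : K.FiveStar b c d e a) : ¬ K.RoleA c :=
  fun hA => not_all_roles hA h.bc.roleB h.cd.roleC
theorem last_in (h : K.FiveStar b c d e a) : ¬ K.RoleC d :=
  fun hC => not_all_roles h.de.roleA h.cd.roleB hC
theorem first_out (h : K.FiveStar b c d e a) : ¬ K.RoleC e :=
  fun hC => not_all_roles h.ea.roleA h.de.roleB hC
theorem last_out (h : K.FiveStar b c d e a) : ¬ K.RoleA a :=
  fun hA => not_all_roles hA h.ab.roleB h.ea.roleC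

theorem head_c (h : K.FiveStar b c d e a) : K.head c = K.head b := h.bc.head_eq
theorem tail_a (h : K.FiveStar b c d e a) : K.tail a = K.head b := h.ab.tail_eq

end FiveStar

/-- The star of a vertex of degree 5, with all its edges. -/
theorem exists_fiveStar [Finite D] (hK : K.IsReducedDiagram) {v : K.Vertex} (hv : K.IsFive v) :
    ∃ b c d e a, K.FiveStar b c d e a ∧ K.head b = v ∧
      (∀ f, K.InAt v f → f = b ∨ f = c ∨ f = d) ∧ ∀ f, K.OutAt v f → f = e ∨ f = a := by
  have hn := hK.le
  have hdeg := hv.2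
  have hdeg' := degree_eq v
  rcases interior_cases hK.reduced hK.filled hv.1 with
    ⟨hin, hB⟩ | ⟨hout, hA⟩ | ⟨l, m, x, y, h⟩ | ⟨l, l', m, m', x, x', y, y', h⟩
  · obtain ⟨p, y, hp, hnp, hmem, -, -, hinj, hall⟩ := exists_out_cycle hK hv.1 hin hB
    have := Nat.le_of_dvd hp hnp
    have := ncard_of_enum' hinj (fun k _ => hmem k) hall
    omega
  · obtain ⟨p, y, hp, hnp, hmem, hinj, hall⟩ := exists_in_cycle hK hv.1 hout hA
    have := Nat.le_of_dvd hp hnp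
    have := ncard_of_enum' hinj (fun k _ => hmem k) hall
    omega
  · rw [h.wheel.ncard_out, h.wheel.ncard_in] at hdeg'
    have hl := h.inw.one_le
    have hm := h.out.one_le
    have hlm : l + m = 3 := by omega
    rcases h.ends with ⟨h1, h2⟩ | ⟨h1, h2⟩
    · have hdvd := h.dvd_same h1 h2
      obtain ⟨rfl, rfl⟩ : l = 2 ∧ m = 1 := by
        by_contra hne
        obtain ⟨rfl, rfl⟩ : l = 1 ∧ m = 2 := by omega
        have := Int.le_of_dvd (by norm_num) hdvd
        push_cast at this
        omega
      refine ⟨x 0, x 1, x 2, y 0, y 1, ⟨?_, h.inw.next 0 (by omega), h.inw.next 1 (by omega), h1,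
        h.out.next 0 (by omega), h2⟩, (h.inw.mem 0 (by omega)).2, fun f hf => ?_, fun f hf => ?_⟩
      · rw [(h.inw.mem 0 (by omega)).2]; exact hv
      · obtain ⟨k, hk, rfl⟩ := h.in_all f hf
        interval_cases k <;> simp
      · obtain ⟨k, hk, rfl⟩ := h.out_all f hf
        interval_cases k <;> simp
    · have := Nat.le_of_dvd (by omega) (h.dvd_opposite h1 h2)
      omega
  · have := h.le_degree
    omega

theorem IsFive.star_of_first_in [Finite D] (hK : K.IsReducedDiagram) (hv : K.IsFive (K.head b))
    (hb : K.pos b) (hB : ¬ K.RoleB b) : ∃ c d e a, K.FiveStar b c d e a := by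
  obtain ⟨b', c, d, e, a, h, -, hin, -⟩ := exists_fiveStar hK hv
  rcases hin b ⟨hb, rfl⟩ with rfl | rfl | rfl
  · exact ⟨c, d, e, a, h⟩
  · exact absurd h.bc.roleB hB
  · exact absurd h.cd.roleB hB

theorem IsFive.star_of_middle_in [Finite D] (hK : K.IsReducedDiagram) (hv : K.IsFive (K.head c))
    (hc : K.pos c) (hA : ¬ K.RoleA c) : ∃ b d e a, K.FiveStar b c d e a := by
  obtain ⟨b, c', d, e, a, h, -, hin, -⟩ := exists_fiveStar hK hv
  rcases hin c ⟨hc, rfl⟩ with rfl | rfl | rfl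
  · exact absurd h.ab.roleA hA
  · exact ⟨b, d, e, a, h⟩
  · exact absurd h.de.roleA hA

theorem FiveStar.eq_of_transit (hK : K.IsReducedDiagram) (h : K.FiveStar b c d e a) {f : D}
    (hf : K.Transit f a) : f = b := hf.left_unique hK.reduced h.ab

/-! ### Colours -/

theorem Blue.five (h : K.Blue c) : K.IsFive (K.head c) := by
  obtain ⟨b, d, e, a, h, -⟩ := h
  rw [h.head_c]; exact h.five

theorem Blue.not_roleA (h : K.Blue c) : ¬ K.RoleA c := by
  obtain ⟨b, d, e, a, h, -⟩ := h
  exact h.middle_in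

theorem Green.five (h : K.Green a) : K.IsFive (K.tail a) := by
  obtain ⟨b, c, d, e, h, -⟩ := h
  rw [h.tail_a]; exact h.five

theorem Green.not_roleA (h : K.Green a) : ¬ K.RoleA a := by
  obtain ⟨b, c, d, e, h, -⟩ := h
  exact h.last_out

theorem Yellow.five (h : K.Yellow b) : K.IsFive (K.head b) := by
  obtain ⟨c, d, e, a, h, -⟩ := h
  exact h.five

theorem Blue.pos (h : K.Blue c) : K.pos c := by
  obtain ⟨b, d, e, a, h, -⟩ := h
  exact h.bc.roleB.pos

theorem Green.pos (h : K.Green a) : K.pos a := by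
  obtain ⟨b, c, d, e, h, -⟩ := h
  exact h.ab.roleB.pos

theorem Yellow.pos (h : K.Yellow b) : K.pos b := by
  obtain ⟨c, d, e, a, h, -⟩ := h
  exact h.bc.roleC.pos

theorem coloured_iff_of_out {v : K.Vertex} (hv : ¬ K.IsFive v) {f : D} (hf : K.OutAt v f) :
    K.Coloured f ↔ K.Blue f ∨ K.Yellow f := by
  have h := not_pos_rev hf.1
  constructor
  · rintro ((h' | h' | h') | (h' | h' | h'))
    · exact .inl h'
    · exact absurd (hf.2 ▸ h'.five) hv
    · exact .inr h'
    all_goals exact absurd h'.pos h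
  · rintro (h' | h')
    exacts [.inl (.inl h'), .inl (.inr (.inr h'))]

theorem coloured_iff_of_in {v : K.Vertex} (hv : ¬ K.IsFive v) {f : D} (hf : K.InAt v f) :
    K.Coloured f ↔ K.Green f := by
  have h := not_pos_rev hf.1
  constructor
  · rintro ((h' | h' | h') | (h' | h' | h'))
    · exact absurd (hf.2 ▸ h'.five) hv
    · exact h'
    · exact absurd (hf.2 ▸ h'.five) hv
    all_goals exact absurd h'.pos h
  · exact fun h' => .inl (.inr (.inl h'))

/-- The last of a sequence of outward edges is blue if and only if it leads to a 5 vertex and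
lies next to the last of a sequence of inward edges. -/
theorem blue_iff [Finite D] (hK : K.IsReducedDiagram) {f c : D} (hfc : K.Transit f c)
    (hA : ¬ K.RoleA c) (hfive : K.IsFive (K.head c)) : K.Blue c ↔ ¬ K.RoleC f := by
  obtain ⟨b, d, e, a, h⟩ := hfive.star_of_middle_in hK hfc.roleB.pos hA
  obtain ⟨f', hf'⟩ := h.bc
  -- The face between `b` and `c` has `f` as its first edge.
  obtain rfl : f' = f := Transit.left_unique hK.reduced ⟨b, hf'⟩ hfc
  constructor
  · rintro ⟨b₁, d₁, e₁, a₁, h₁, p, hp, hq⟩ hC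
    obtain rfl := h.bc.left_unique hK.reduced h₁.bc
    obtain rfl : p = f' := hp.left_unique hK.reduced ⟨c, hf'⟩
    obtain ⟨q, hq'⟩ := hC.outNext
    exact hq q hq'
  · exact fun hC => ⟨b, d, e, a, h, f', ⟨c, hf'⟩, fun q hq => hC hq.roleC⟩

/-- Consecutive inward edges are not both green: the second would be the last outward edge of a
5 vertex next to its last inward edge. -/
theorem Green.not_inNext (hK : K.IsReducedDiagram) {a a' : D} (h : K.Green a) (h' : K.Green a') :
    ¬ K.InNext a a' := by
  intro hn
  obtain ⟨b, c, d, e, hs, -⟩ := h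
  obtain ⟨b', c', d', e', hs', -⟩ := h'
  obtain ⟨f, hf⟩ := hs.ea
  obtain rfl : f = a' := InNext.right_unique hK.reduced ⟨e, hf⟩ hn
  obtain rfl := hs'.eq_of_transit hK ⟨a, hf⟩
  exact hs'.first_in hs.de.roleB

/-- If `e`, `e'` are consecutive outward edges and lead to 5 vertices, where `e` is neither first
nor last, then `e'` is not last: the last outward edge of the first 5 vertex precedes `e'` there.
-/
theorem not_roleB_of_five_of_five [Finite D] (hK : K.IsReducedDiagram) {e e' : D}
    (hn : K.OutNext e e') (hB : ¬ K.RoleB e) (h : K.IsFive (K.head e))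
    (h' : K.IsFive (K.head e')) : ¬ K.RoleB e' := by
  obtain ⟨c, d, f, a, hs⟩ := h.star_of_first_in hK hn.roleA.pos hB
  obtain ⟨g, hg⟩ := hn
  obtain rfl : g = a := Transit.right_unique hK.reduced ⟨e', hg⟩ hs.ab
  have hin : K.InNext e' g := ⟨e, hg⟩
  rw [← hin.head_eq] at h'
  obtain ⟨b', d', f', a', hs'⟩ := h'.star_of_middle_in hK hin.roleB.pos hs.last_out
  rw [hin.left_unique hK.reduced hs'.bc]
  exact hs'.first_in

/-- A yellow edge is followed by an edge that leads to a 5 vertex. -/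
theorem Yellow.next_five (hK : K.IsReducedDiagram) {e e' : D} (h : K.Yellow e)
    (hn : K.OutNext e e') : K.IsFive (K.head e') := by
  obtain ⟨c, d, f, a, hs, hg, hb, -⟩ := h
  obtain ⟨g, hg'⟩ := hn
  obtain rfl : g = a := Transit.right_unique hK.reduced ⟨e', hg'⟩ hs.ab
  rw [hg'.head_c]
  by_contra hne
  exact hg ⟨e, c, d, f, hs, hb, hne⟩

/-- An outward edge `e` that leads to a 5 vertex and has two predecessors: the edge `a` that
closes the face between `e` and the next edge `e'` is green unless `e'` leads to a 5 vertex. -/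
theorem exists_green [Finite D] (hK : K.IsReducedDiagram) {p q e e' : D} (h1 : K.OutNext p q)
    (h2 : K.OutNext q e) (h3 : K.OutNext e e') (hB : ¬ K.RoleB e) (h : K.IsFive (K.head e))
    (h' : ¬ K.IsFive (K.head e')) : ∃ a, K.InNext e' a ∧ K.Green a := by
  obtain ⟨c, d, f, a, hs⟩ := h.star_of_first_in hK h3.roleA.pos hB
  obtain ⟨g, hg⟩ := h3
  obtain rfl : g = a := Transit.right_unique hK.reduced ⟨e', hg⟩ hs.ab
  refine ⟨g, ⟨e, hg⟩, e, c, d, f, hs, ?_, by rwa [← hg.head_c]⟩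
  rintro ⟨b₁, d₁, e₁, a₁, h₁, r, hr, hr'⟩
  obtain rfl := hs.bc.left_unique hK.reduced h₁.bc
  obtain rfl := hr.left_unique hK.reduced h2
  exact hr' p h1

end FiveStar

end LabelledMap

/-! ### Discs in the spherical diagram -/

namespace SDFace

variable {n : ℕ}

/-- The faces of the spherical diagram at the pole `B` between the edges with indices
`s, …, s + r`, together with all the faces at the vertices `V_j`, `j ∈ F`. -/
def capSet (s : ZMod n) (r : ℕ) (F : Finset (ZMod n)) : Set (SDFace n) :=
  {t | match t with
    | top j => ∃ k < r, j = s + (k : ℕ)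
    | upper j => j ∈ F ∨ j + 1 ∈ F
    | lower j => j ∈ F
    | bottom _ => False}

theorem reachable_of_hasEdge {T : Set (SDFace n)} {t t' : SDFace n} (ht : t ∈ T) (ht' : t' ∈ T)
    (e : SDEdge n) (h : t.HasEdge e) (h' : t'.HasEdge e) :
    ((graph n).induce T).Reachable ⟨t, ht⟩ ⟨t', ht'⟩ := by
  by_cases heq : t = t'
  · subst heq; exact SimpleGraph.Reachable.refl _
  · refine SimpleGraph.Adj.reachable ?_
    rw [SimpleGraph.comap_adj]
    exact (SimpleGraph.fromRel_adj _ _ _).2 ⟨heq, .inl ⟨e, h, h'⟩⟩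

theorem preconnected_of_base {V : Type*} {G : SimpleGraph V} (b : V) (h : ∀ v, G.Reachable b v) :
    G.Preconnected := fun u v => (h u).symm.trans (h v)

theorem isSubdiagram_capSet (hn : n ≠ 0) {s : ZMod n} {r : ℕ} {F : Finset (ZMod n)} (hr : 0 < r)
    (hF : ∀ j ∈ F, ∃ k : ℕ, 0 < k ∧ k < r ∧ j = s + k) : IsSubdiagram (capSet s r F) := by
  have : NeZero n := ⟨hn⟩
  have htop : ∀ j, (j ∈ F ∨ j + 1 ∈ F) → top j ∈ capSet s r F := by
    rintro j (h | h)
    · obtain ⟨k, -, hk, rfl⟩ := hF _ h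
      exact ⟨k, hk, rfl⟩
    · obtain ⟨k, hk0, hk, hj⟩ := hF _ h
      refine ⟨k - 1, by omega, ?_⟩
      rw [Nat.cast_sub hk0]; push_cast
      linear_combination hj
  have hbase : top s ∈ capSet s r F := ⟨0, hr, by simp⟩
  refine ⟨⟨_, hbase⟩, preconnected_of_base ⟨top s, hbase⟩ ?_,
    preconnected_of_base ⟨bottom 0, id⟩ ?_⟩
  · have h1 : ∀ k (hk : k < r), ((graph n).induce (capSet s r F)).Reachable ⟨top s, hbase⟩
        ⟨top (s + (k : ℕ)), ⟨k, hk, rfl⟩⟩ := by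
      intro k
      induction k with
      | zero => 
        intro _
        exact reachable_of_hasEdge _ _ (SDEdge.BV s) (.inl rfl) (.inl (by simp [fst]))
      | succ k ih =>
        intro hk
        refine (ih (by omega)).trans (reachable_of_hasEdge _ _ (SDEdge.BV (s + k + 1))
          (.inr (.inr rfl)) (.inl ?_))
        simp [fst, add_assoc]
    have h2 : ∀ j (hj : j ∈ F ∨ j + 1 ∈ F), ((graph n).induce (capSet s r F)).Reachable
        ⟨top s, hbase⟩ ⟨upper j, hj⟩ := by
      intro j hj
      obtain ⟨k, hk, hjk⟩ := htop j hj
      subst hjk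
      exact (h1 k hk).trans (reachable_of_hasEdge _ _ (SDEdge.VV _) (.inr (.inl rfl))
        (.inr (.inr rfl)))
    rintro ⟨t | t | t | t, ht⟩
    · obtain ⟨k, hk, rfl⟩ := id ht
      exact h1 k hk
    · exact h2 t ht
    · exact (h2 t (.inl ht)).trans (reachable_of_hasEdge _ _ (SDEdge.VW t) (.inl rfl)
        (.inr (.inl rfl)))
    · exact ht.elim
  · have h1 : ∀ k : ℕ, ((graph n).induce (capSet s r F)ᶜ).Reachable ⟨bottom 0, id⟩
        ⟨bottom (k : ℕ), id⟩ := by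
      intro k
      induction k with
      | zero => exact reachable_of_hasEdge _ _ (SDEdge.PW 0) (.inl rfl) (.inl (by simp [fst]))
      | succ k ih =>
        exact ih.trans (reachable_of_hasEdge _ _ (SDEdge.PW (k + 1)) (.inr (.inr rfl))
          (.inl (by simp [fst])))
    have h2 : ∀ j, ((graph n).induce (capSet s r F)ᶜ).Reachable ⟨bottom 0, id⟩ ⟨bottom j, id⟩ := by
      intro j
      have := h1 j.val
      simpa only [ZMod.natCast_zmod_val] using this
    have h3 : ∀ j (hj : j ∉ F), ((graph n).induce (capSet s r F)ᶜ).Reachable ⟨bottom 0, id⟩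
        ⟨lower j, hj⟩ := fun j hj => (h2 (j - 1)).trans
      (reachable_of_hasEdge _ _ (SDEdge.WW (j - 1)) (.inr (.inl rfl)) (.inr (.inr rfl)))
    have h4 : ∀ j (hj : ¬ (j ∈ F ∨ j + 1 ∈ F)), ((graph n).induce (capSet s r F)ᶜ).Reachable
        ⟨bottom 0, id⟩ ⟨upper j, hj⟩ := fun j hj => (h3 j (fun h => hj (.inl h))).trans
      (reachable_of_hasEdge _ _ (SDEdge.VW j) (.inr (.inl rfl)) (.inl rfl))
    rintro ⟨t | t | t | t, ht⟩
    · exact (h4 t (fun h => ht (htop t h))).trans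
        (reachable_of_hasEdge _ _ (SDEdge.VV t) (.inr (.inr rfl)) (.inr (.inl rfl)))
    · exact h4 t ht
    · exact h3 t ht
    · exact h2 t

/-- A nonempty proper subset of a finite cyclic group grows when its translate by `-1` is added. -/
theorem card_lt_union_shift [NeZero n] {F U : Finset (ZMod n)} (hne : F.Nonempty) {s : ZMod n}
    (hs : s ∉ F) (hU : ∀ j, (j ∈ F ∨ j + 1 ∈ F) → j ∈ U) : F.card + 1 ≤ U.card := by
  by_contra! hlt
  have hsub : F ⊆ U := fun j hj => hU j (.inl hj)
  have hUF : U = F := (Finset.eq_of_subset_of_card_le hsub (by omega)).symm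
  obtain ⟨a, ha⟩ := hne
  have : ∀ k : ℕ, a - k ∈ F := by
    intro k
    induction k with
    | zero => simpa
    | succ k ih =>
      rw [← hUF]
      refine hU _ (.inr ?_)
      push_cast
      rwa [show a - (k + 1) + 1 = a - (k : ZMod n) by ring]
  refine hs ?_
  have h := this (a - s).val
  rwa [ZMod.natCast_zmod_val, sub_sub_cancel] at h

theorem le_ncard_capSet (hn : n ≠ 0) {s : ZMod n} {r : ℕ} {F : Finset (ZMod n)} (hr : r < n)
    (hne : F.Nonempty) (hs : s ∉ F) : r + 2 * F.card + 1 ≤ (capSet s r F).ncard := by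
  classical
  have : NeZero n := ⟨hn⟩
  let J : Finset (ZMod n) := (Finset.range r).image fun k : ℕ => s + k
  let U : Finset (ZMod n) := Finset.univ.filter fun j => j ∈ F ∨ j + 1 ∈ F
  have hJ : J.card = r := by
    rw [Finset.card_image_of_injOn, Finset.card_range]
    intro j hj k hk h
    simp only [Finset.coe_range, Set.mem_Iio] at hj hk
    have h' : ((j : ℕ) : ZMod n) = k := add_left_cancel h
    have := congrArg ZMod.val h'
    rwa [ZMod.val_natCast_of_lt (by omega), ZMod.val_natCast_of_lt (by omega)] at this
  have hU : F.card + 1 ≤ U.card := card_lt_union_shift hne hs (fun j hj => by simpa [U] using hj)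
  have hJ' : ∀ j ∈ J, ∃ k < r, j = s + (k : ℕ) := fun j hj => by
    obtain ⟨k, hk, rfl⟩ := Finset.mem_image.1 hj
    exact ⟨k, Finset.mem_range.1 hk, rfl⟩
  have hU' : ∀ j ∈ U, j ∈ F ∨ j + 1 ∈ F := fun j hj => (Finset.mem_filter.1 hj).2
  clear_value J U
  have hsub : ((J.image top ∪ U.image upper ∪ F.image lower : Finset (SDFace n)) :
      Set (SDFace n)) ⊆ capSet s r F := by
    intro t ht
    simp only [Finset.coe_union, Finset.coe_image, Set.mem_union, Set.mem_image,
      Finset.mem_coe] at ht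
    rcases ht with (⟨j, hj, rfl⟩ | ⟨j, hj, rfl⟩) | ⟨j, hj, rfl⟩
    exacts [hJ' j hj, hU' j hj, hj]
  have hfin : (capSet s r F).Finite := by
    have : Finite (SDFace n) := by
      refine Finite.of_surjective (α := ZMod n × Fin 4) (fun p => match p.2 with
        | 0 => top p.1 | 1 => upper p.1 | 2 => lower p.1 | 3 => bottom p.1) ?_
      rintro (j | j | j | j)
      exacts [⟨(j, 0), rfl⟩, ⟨(j, 1), rfl⟩, ⟨(j, 2), rfl⟩, ⟨(j, 3), rfl⟩]
    exact Set.toFinite _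
  have hle := Set.ncard_le_ncard hsub hfin
  rw [Set.ncard_coe_finset, Finset.card_union_of_disjoint, Finset.card_union_of_disjoint,
    Finset.card_image_of_injective _ (fun _ _ h => by injection h),
    Finset.card_image_of_injective _ (fun _ _ h => by injection h),
    Finset.card_image_of_injective _ (fun _ _ h => by injection h)] at hle
  · omega
  · rw [Finset.disjoint_left]
    intro t h h'
    obtain ⟨j, -, rfl⟩ := Finset.mem_image.1 h
    obtain ⟨j', -, h'⟩ := Finset.mem_image.1 h'
    cases h'
  · rw [Finset.disjoint_left]
    intro t h h'
    obtain ⟨j', -, rfl⟩ := Finset.mem_image.1 h'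
    rcases Finset.mem_union.1 h with h | h
    all_goals
      obtain ⟨j, -, h⟩ := Finset.mem_image.1 h
      cases h

end SDFace

namespace LabelledMap

variable {n : ℕ} {D : Type*} {K : LabelledMap n D}

/-! ### Few 5 vertices around a vertex -/

/-- Consider consecutive edges that leave a vertex, indexed so that their labels agree with those of
the edges `B → V_j`. The faces around the 5 vertices to which they lead match a disc of the
spherical diagram, so that there cannot be too many of them. -/
theorem le_two_mul_of_five [Finite D] (hK : K.IsReducedDiagram) (hsph : K.SphericallyReduced)
    (y : ZMod n → D) (s : ZMod n) {r : ℕ} (hr : r < n)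
    (hlab : ∀ k : ℕ, k ≤ r → K.lab (y (s + k)) = 2 * (s + k))
    (hnext : ∀ k : ℕ, k < r → K.OutNext (y (s + k)) (y (s + k + 1)))
    (hB : ∀ k : ℕ, k ≤ r → ¬ K.RoleB (y (s + k))) (F : Finset (ZMod n)) (hne : F.Nonempty)
    (hF : ∀ j ∈ F, ∃ k : ℕ, 0 < k ∧ k < r ∧ j = s + k ∧ K.IsFive (K.head (y j))) :
    r + 2 * F.card + 1 ≤ 2 * n := by
  have hn := hK.le
  have hR := hK.reduced
  by_contra! hlt
  have hr0 : 0 < r := by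
    obtain ⟨j, hj⟩ := hne
    obtain ⟨k, hk, hk', -⟩ := hF j hj
    omega
  have hs : s ∉ F := by
    intro hs
    obtain ⟨k, hk, hk', h, -⟩ := hF s hs
    have h0 : ((k : ℕ) : ZMod n) = 0 := left_eq_add.1 h
    have := Nat.le_of_dvd hk ((ZMod.natCast_eq_zero_iff _ _).1 h0)
    omega
  refine hsph _ (SDFace.isSubdiagram_capSet (by omega) hr0 (F := F) (s := s) (fun j hj => ?_))
    (hlt.trans_le (SDFace.le_ncard_capSet (by omega) hr hne hs)) ?_
  · obtain ⟨k, hk, hk', h, -⟩ := hF j hj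
    exact ⟨k, hk, hk', h⟩
  -- The index set of the faces at the common initial vertex.
  let J : ZMod n → Prop := fun j => ∃ k < r, j = s + (k : ℕ)
  have hJF : ∀ j ∈ F, J j := fun j hj => by
    obtain ⟨k, hk, hk', h, -⟩ := hF j hj
    exact ⟨k, hk', h⟩
  have hJF' : ∀ j, j + 1 ∈ F → J j := fun j hj => by
    obtain ⟨k, hk, hk', h, -⟩ := hF _ hj
    refine ⟨k - 1, by omega, ?_⟩
    rw [Nat.cast_sub hk]; push_cast
    linear_combination h
  have hnextJ : ∀ j, J j → K.OutNext (y j) (y (j + 1)) := by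
    rintro j ⟨k, hk, rfl⟩; exact hnext k hk
  have hBJ : ∀ j, J j → ¬ K.RoleB (y (j + 1)) := by
    rintro j ⟨k, hk, rfl⟩
    have := hB (k + 1) hk
    rwa [Nat.cast_succ, ← add_assoc] at this
  have hBJ' : ∀ j, J j → ¬ K.RoleB (y j) := by
    rintro j ⟨k, hk, rfl⟩; exact hB k hk.le
  have hlabJ : ∀ j, J j → K.lab (y j) = 2 * j := by
    rintro j ⟨k, hk, rfl⟩; exact hlab k hk.le
  choose vv hvv using fun j => show ∃ b, J j → K.Tri (y j) b (y (j + 1)) by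
    by_cases hj : J j
    · obtain ⟨b, hb⟩ := hnextJ j hj
      exact ⟨b, fun _ => hb⟩
    · exact ⟨y j, fun h => (hj h).elim⟩
  have hstar : ∀ j ∈ F, ∃ c d e a, K.FiveStar (y j) c d e a := fun j hj => by
    obtain ⟨k, hk, hk', h, hf⟩ := hF j hj
    exact hf.star_of_first_in hK (hnextJ j (hJF j hj)).roleA.pos (hBJ' j (hJF j hj))
  have hstar_a : ∀ j ∈ F, ∃ c d e, K.FiveStar (y j) c d e (vv j) := fun j hj => by
    obtain ⟨c, d, e, a, h⟩ := hstar j hj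
    obtain rfl : vv j = a := Transit.right_unique hR ⟨_, hvv j (hJF j hj)⟩ h.ab
    exact ⟨c, d, e, h⟩
  have hstar_c : ∀ j, j + 1 ∈ F → ∃ d e a, K.FiveStar (y (j + 1)) (vv j) d e a := fun j hj => by
    obtain ⟨c, d, e, a, h⟩ := hstar _ hj
    obtain rfl : vv j = c := InNext.right_unique hR ⟨_, hvv j (hJF' j hj)⟩ h.bc
    exact ⟨d, e, a, h⟩
  choose vw wv hup using fun j => show ∃ p q, (j ∈ F ∨ j + 1 ∈ F) → K.Tri p q (vv j) by
    by_cases hj : j ∈ F ∨ j + 1 ∈ F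
    · rcases id hj with h | h
      · obtain ⟨c, d, e, h⟩ := hstar_a j h
        obtain ⟨q, hq⟩ := h.ea
        exact ⟨_, _, fun _ => hq⟩
      · obtain ⟨d, e, a, h⟩ := hstar_c j h
        obtain ⟨p, hp⟩ := h.cd
        exact ⟨_, _, fun _ => hp⟩
    · exact ⟨y j, y j, fun h => (hj h).elim⟩
  choose ww hlow using fun j => show ∃ c, j + 1 ∈ F → K.Tri (wv j) (vw (j + 1)) c by
    by_cases hj : j + 1 ∈ F
    · obtain ⟨c, d, e, h⟩ := hstar_a _ hj
      obtain ⟨d', e', a', h'⟩ := hstar_c _ hj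
      obtain rfl := h.bc.right_unique hR h'.bc
      obtain rfl : d = wv j := by
        obtain ⟨p, hp⟩ := h.cd
        exact (hp.eq_of_c hR (hup j (.inr hj))).2
      obtain rfl : e = vw (j + 1) := by
        obtain ⟨q, hq⟩ := h.ea
        exact (hq.eq_of_c hR (hup (j + 1) (.inl hj))).1
      obtain ⟨f, hf⟩ := h.de
      exact ⟨f, fun _ => hf⟩
    · exact ⟨y j, fun h => (hj h).elim⟩
  have hlow' : ∀ j ∈ F, K.Tri (wv (j - 1)) (vw j) (ww (j - 1)) := fun j hj => by
    have := hlow (j - 1) (by rwa [sub_add_cancel])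
    rwa [sub_add_cancel] at this
  have hUJ : ∀ j, (j ∈ F ∨ j + 1 ∈ F) → J j := fun j hj => hj.elim (hJF j) (hJF' j)
  have hupJ : ∀ j ∈ F, K.Tri (vw (j - 1)) (wv (j - 1)) (vv (j - 1)) := fun j hj =>
    hup (j - 1) (.inr (by rwa [sub_add_cancel]))
  have lvv : ∀ j, J j → K.lab (vv j) = 2 * j + 1 := fun j hj => by
    rw [(hvv j hj).lab_b, hlabJ j hj]
  have lvw : ∀ j, (j ∈ F ∨ j + 1 ∈ F) → K.lab (vw j) = 2 * j - 1 := fun j hj => by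
    have h1 := (hup j hj).lab_c
    rw [lvv j (hUJ j hj)] at h1
    linear_combination -h1
  have lwv : ∀ j, (j ∈ F ∨ j + 1 ∈ F) → K.lab (wv j) = 2 * j := fun j hj => by
    rw [(hup j hj).lab_b, lvw j hj]; ring
  have cancel : ∀ {i j : ZMod n}, 2 * i = 2 * j → i = j := fun {i j} h => by
    have hu : IsUnit ((2 : ℕ) : ZMod n) :=
      (ZMod.isUnit_iff_coprime 2 n).2 (Nat.coprime_two_left.2 hK.odd)
    exact hu.mul_left_cancel (by exact_mod_cast h)
  -- The faces at the initial vertex and the upper ones all have the same orientation, which differs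
  -- from that of the lower ones.
  have sign_top : ∀ k : ℕ, k < r → (K.PosTri (y (s + k)) (vv (s + k)) (y (s + k + 1)) ↔
      K.PosTri (y s) (vv s) (y (s + 1))) := by
    intro k
    induction k with
    | zero => simp
    | succ k ih =>
      intro hk
      rw [← ih (by omega)]
      have h1 := hvv (s + (k + 1 : ℕ)) ⟨k + 1, hk, rfl⟩
      have h2 := hvv (s + k) ⟨k, by omega, rfl⟩
      rw [Nat.cast_succ, ← add_assoc] at h1 ⊢
      exact posTri_iff_of_a_c hR h1 h2
  have sign_up : ∀ j, (j ∈ F ∨ j + 1 ∈ F) → (K.PosTri (vw j) (wv j) (vv j) ↔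
      K.PosTri (y s) (vv s) (y (s + 1))) := fun j hj => by
    rw [← posTri_iff_of_b_c hR (hvv j (hUJ j hj)) (hup j hj)]
    obtain ⟨k, hk, rfl⟩ := hUJ j hj
    exact sign_top k hk
  have sign_low : ∀ j ∈ F, (K.PosTri (wv (j - 1)) (vw j) (ww (j - 1)) ↔
      ¬ K.PosTri (y s) (vv s) (y (s + 1))) := fun j hj => by
    rw [← sign_up j (.inl hj), posTri_iff_of_a_b hR (hup j (.inl hj)) (hlow' j hj), not_not]
  -- Labels tell apart the faces of one kind; roles and orientation tell apart the kinds.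
  have top_up : ∀ j j', J j → (j' ∈ F ∨ j' + 1 ∈ F) → y (j + 1) ≠ vv j' := fun j j' hj hj' h =>
    hBJ j hj ⟨_, _, h ▸ hvv j' (hUJ j' hj')⟩
  have top_low : ∀ j j', J j → j' ∈ F → y j ≠ wv (j' - 1) := fun j j' hj hj' h =>
    hBJ' j hj ⟨_, _, h ▸ hupJ j' hj'⟩
  have up_low : ∀ j j', (j ∈ F ∨ j + 1 ∈ F) → j' ∈ F →
      ¬ (vw j = wv (j' - 1) ∧ wv j = vw j' ∧ vv j = ww (j' - 1)) := by
    rintro j j' hj hj' ⟨h1, h2, h3⟩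
    have a := sign_up j hj
    have b := sign_low j' hj'
    rw [h1, h2, h3] at a
    tauto
  refine ⟨fun e => match e with
    | .BV j => y j | .VV j => vv j | .VW j => vw j | .WV j => wv j | .WW j => ww j
    | .PW j => y j, ?_, ?_, ?_⟩
  · rintro (j | j | j | j) ht e (rfl | rfl | rfl)
    · exact hlabJ j ht
    · exact lvv j ht
    · change K.lab (y (j + 1)) = 2 * (j + 1)
      rw [(hnextJ j ht).lab_eq, hlabJ j ht]; ring
    · exact lvw j ht
    · exact lwv j ht
    · exact lvv j (hUJ j ht)
    · exact lwv (j - 1) (.inr (by rwa [sub_add_cancel]))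
    · exact lvw j (.inl ht)
    · change K.lab (ww (j - 1)) = 2 * (j - 1) + 2
      rw [(hlow' j ht).lab_c, lwv (j - 1) (.inr (by rwa [sub_add_cancel]))]
    all_goals exact ht.elim
  · rintro (j | j | j | j) ht
    · exact hvv j ht
    · exact hup j ht
    · exact hlow' j ht
    · exact ht.elim
  · rintro (j | j | j | j) ht (j' | j' | j' | j') ht' heq
    all_goals
      first
      | exact ht.elim
      | exact ht'.elim
      | skip
    all_goals
      obtain ⟨h1, h2, h3⟩ := Prod.ext_iff.1 heq |>.imp id Prod.ext_iff.1
      simp only [SDFace.fst, SDFace.snd, SDFace.trd] at h1 h2 h3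
    · congr 1
      exact cancel (by rw [← hlabJ j ht, h1, hlabJ j' ht'])
    · exact (top_up j j' ht ht' h3).elim
    · exact (top_low j j' ht ht' h1).elim
    · exact (top_up j' j ht' ht h3.symm).elim
    · congr 1
      exact cancel (sub_left_injective (by
        change 2 * j - 1 = 2 * j' - 1
        rw [← lvw j ht, h1, lvw j' ht']))
    · exact (up_low j j' ht ht' ⟨h1, h2, h3⟩).elim
    · exact (top_low j' j ht' ht h1.symm).elim
    · exact (up_low j' j ht' ht ⟨h1.symm, h2.symm, h3.symm⟩).elim
    · congr 1
      exact cancel (sub_left_injective (by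
        change 2 * j - 1 = 2 * j' - 1
        rw [← lvw j (.inl ht), h2, lvw j' (.inl ht')]))

theorem IsReducedDiagram.exists_two_mul (hK : K.IsReducedDiagram) (c : ZMod n) :
    ∃ s, c = 2 * s := by
  have hu : IsUnit ((2 : ℕ) : ZMod n) :=
    (ZMod.isUnit_iff_coprime 2 n).2 (Nat.coprime_two_left.2 hK.odd)
  obtain ⟨s, hs⟩ := hu.dvd (a := c)
  exact ⟨s, by exact_mod_cast hs⟩

/-- The same as `le_two_mul_of_five`, with the edges numbered from `0`. -/
theorem le_two_mul_of_five_nat [Finite D] (hK : K.IsReducedDiagram) (hsph : K.SphericallyReduced)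
    (y : ℕ → D) {r : ℕ} (hr : r < n) (hnext : ∀ k < r, K.OutNext (y k) (y (k + 1)))
    (hB : ∀ k ≤ r, ¬ K.RoleB (y k)) (F : Finset ℕ) (hne : F.Nonempty)
    (hF : ∀ k ∈ F, 0 < k ∧ k < r ∧ K.IsFive (K.head (y k))) : r + 2 * F.card + 1 ≤ 2 * n := by
  have : NeZero n := ⟨by omega⟩
  obtain ⟨s, hs⟩ := hK.exists_two_mul (K.lab (y 0))
  let y' : ZMod n → D := fun j => y (j - s).val
  have hy' : ∀ k < n, y' (s + (k : ℕ)) = y k := fun k hk => by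
    simp only [y', add_sub_cancel_left, ZMod.val_natCast_of_lt hk]
  have hlab : ∀ k ≤ r, K.lab (y k) = 2 * (s + (k : ℕ)) := by
    intro k
    induction k with
    | zero => simp [hs]
    | succ k ih => intro hk; rw [(hnext k hk).lab_eq, ih (by omega)]; push_cast; ring
  have hcard : (F.image fun k : ℕ => s + (k : ZMod n)).card = F.card := by
    refine Finset.card_image_of_injOn fun j hj k hk h => ?_
    have hj := hF j hj
    have hk := hF k hk
    have h' : ((j : ℕ) : ZMod n) = k := add_left_cancel h
    have := congrArg ZMod.val h'
    rwa [ZMod.val_natCast_of_lt (by omega), ZMod.val_natCast_of_lt (by omega)] at this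
  rw [← hcard]
  refine le_two_mul_of_five hK hsph y' s hr (fun k hk => ?_) (fun k hk => ?_) (fun k hk => ?_) _
    (hne.image _) (fun j hj => ?_)
  · rw [hy' k (by omega), hlab k hk]
  · have := hy' (k + 1) (by omega)
    rw [Nat.cast_succ, ← add_assoc] at this
    rw [hy' k (by omega), this]
    exact hnext k hk
  · rw [hy' k (by omega)]
    exact hB k hk
  · obtain ⟨k, hk, rfl⟩ := Finset.mem_image.1 hj
    obtain ⟨h1, h2, h3⟩ := hF k hk
    exact ⟨k, h1, h2, rfl, by rwa [hy' k (by omega)]⟩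

theorem OutChain.not_all_five [Finite D] (hK : K.IsReducedDiagram) (hsph : K.SphericallyReduced)
    {v : K.Vertex} {m : ℕ} {y : ℕ → D} (h : K.OutChain v m y) (hm : n ≤ m + 1)
    (hfive : ∀ k, 2 ≤ k → k + 3 ≤ n → K.IsFive (K.head (y k))) : False := by
  have hn := hK.le
  have := le_two_mul_of_five_nat hK hsph (fun k => y (k + 1)) (r := n - 3) (by omega)
    (fun k hk => h.next (k + 1) (by omega))
    (fun k hk hB => not_all_roles (h.roleA (by omega)) hB (h.roleC (by omega) (by omega)))
    (Finset.Icc 1 (n - 4)) (Finset.nonempty_Icc.2 (by omega)) (fun k hk => by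
      rw [Finset.mem_Icc] at hk
      exact ⟨by omega, by omega, hfive (k + 1) (by omega) (by omega)⟩)
  rw [Nat.card_Icc] at this
  omega

/-! ### Vertices with outward edges only -/

/-- Of `n` consecutive outward edges, at least four do not lead to 5 vertices, even if the two outer
ones are not counted. -/
theorem four_le_card_not_five [Finite D] (hK : K.IsReducedDiagram) (hsph : K.SphericallyReduced)
    [DecidablePred K.IsFive] (y : ℕ → D) (hnext : ∀ k, K.OutNext (y k) (y (k + 1)))
    (hB : ∀ k, ¬ K.RoleB (y k)) (t : ℕ) :
    4 ≤ ((Finset.Icc (t + 1) (t + n - 2)).filter fun k => ¬ K.IsFive (K.head (y k))).card := by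
  have hn := hK.le
  have hsum := Finset.card_filter_add_card_filter_not (s := Finset.Icc (t + 1) (t + n - 2))
    fun k => K.IsFive (K.head (y k))
  rw [Nat.card_Icc] at hsum
  set F := (Finset.Icc (t + 1) (t + n - 2)).filter fun k => K.IsFive (K.head (y k)) with hF
  rcases F.eq_empty_or_nonempty with h | h
  · rw [h, Finset.card_empty] at hsum
    omega
  · have hFm : ∀ k ∈ F, t < k ∧ k < t + (n - 1) ∧ K.IsFive (K.head (y k)) := fun k hk => by
      rw [hF, Finset.mem_filter, Finset.mem_Icc] at hk
      exact ⟨by omega, by omega, hk.2⟩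
    have hc : (F.image fun k => k - t).card = F.card := by
      refine Finset.card_image_of_injOn fun j hj k hk h => ?_
      have := hFm j hj
      have := hFm k hk
      omega
    have := le_two_mul_of_five_nat hK hsph (fun k => y (k + t)) (r := n - 1) (by omega)
      (fun k _ => by rw [add_right_comm]; exact hnext (k + t)) (fun k _ => hB _)
      (F.image fun k => k - t) (h.image _) (fun j hj => by
        obtain ⟨k, hk, rfl⟩ := Finset.mem_image.1 hj
        obtain ⟨h1, h2, h3⟩ := hFm k hk
        refine ⟨by omega, by omega, ?_⟩
        rwa [Nat.sub_add_cancel h1.le])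
    omega

/-- A subset `G` of a cycle that gets at least six elements whenever two consecutive elements are
added to it: together with its translate it has at least seven elements. -/
theorem seven_le_card_union_shift (hn : 11 ≤ n) {G U : Finset (ZMod n)}
    (hG : ∀ t, 6 ≤ (insert t (insert (t + 1) G)).card)
    (hU : ∀ j, (j ∈ G ∨ j + 1 ∈ G) → j ∈ U) : 7 ≤ U.card := by
  have : NeZero n := ⟨by omega⟩
  have hGU : G ⊆ U := fun j hj => hU j (.inl hj)
  have hne : G.Nonempty := by
    rw [Finset.nonempty_iff_ne_empty]
    rintro rfl
    have h := hG 0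
    have h1 := Finset.card_insert_le (0 : ZMod n) (insert (0 + 1) ∅)
    have h2 := Finset.card_insert_le (0 + 1 : ZMod n) ∅
    rw [Finset.card_empty] at h2
    omega
  by_cases huniv : ∃ s, s ∉ G
  swap
  · push Not at huniv
    have : U = Finset.univ := Finset.eq_univ_iff_forall.2 fun j => hGU (huniv j)
    rw [this, Finset.card_univ, ZMod.card]
    omega
  obtain ⟨s, hs⟩ := huniv
  have hcard := SDFace.card_lt_union_shift hne hs hU
  by_cases hcons : ∃ t ∈ G, t + 1 ∈ G
  · obtain ⟨t, ht, ht'⟩ := hcons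
    have := hG t
    rw [Finset.insert_eq_of_mem ht', Finset.insert_eq_of_mem ht] at this
    omega
  · push Not at hcons
    obtain ⟨t, ht⟩ := hne
    have h5 := hG t
    rw [Finset.insert_comm, Finset.insert_eq_of_mem ht] at h5
    have h5' := Finset.card_insert_le (t + 1) G
    -- Without consecutive elements the translate is disjoint from the set.
    have hdisj : Disjoint G (G.image fun j => j - 1) := by
      rw [Finset.disjoint_left]
      intro j hj hj'
      obtain ⟨i, hi, rfl⟩ := Finset.mem_image.1 hj'
      exact hcons _ hj (by rwa [sub_add_cancel])
    have hsub : G ∪ (G.image fun j => j - 1) ⊆ U := by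
      refine Finset.union_subset hGU fun j hj => ?_
      obtain ⟨i, hi, rfl⟩ := Finset.mem_image.1 hj
      exact hU _ (.inr (by rwa [sub_add_cancel]))
    have := Finset.card_le_card hsub
    rw [Finset.card_union_of_disjoint hdisj, Finset.card_image_of_injective _
      (sub_left_injective)] at this
    omega

theorem seven_le_of_out_only [Finite D] (hK : K.IsReducedDiagram) (hsph : K.SphericallyReduced)
    {v : K.Vertex} (hv : K.IsInterior v) (hv5 : ¬ K.IsFive v) (hin : ∀ e, ¬ K.InAt v e)
    (hB : ∀ e, K.OutAt v e → ¬ K.RoleB e) : 7 ≤ K.uncoloured v := by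
  classical
  have hn := hK.le
  obtain ⟨p, y, hp, hnp, hmem, hnext, hyp, hinj, hall⟩ := exists_out_cycle hK hv hin hB
  have hByk : ∀ k, ¬ K.RoleB (y k) := fun k => hB _ (hmem k)
  have hcol : ∀ k, K.Coloured (y k) → K.Yellow (y k) := fun k hk => by
    rcases (coloured_iff_of_out hv5 (hmem k)).1 hk with h | h
    · obtain ⟨b, d, e, a, h, -⟩ := h
      exact absurd h.bc.roleB (hByk k)
    · exact h
  have hU : K.uncoloured v = ((Finset.range p).filter fun k => ¬ K.Coloured (y k)).card := by
    rw [uncoloured_eq, ncard_of_enum (S := K.OutAt v) (fun e => ¬ K.Coloured e) hinj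
      (fun k _ => hmem k) hall, Nat.add_eq_left, Set.ncard_eq_zero]
    exact Set.eq_empty_of_forall_notMem fun e he => hin e he.1
  rw [hU]
  obtain ⟨q, rfl⟩ := hnp
  have hq : q ≠ 0 := by rintro rfl; simp at hp
  rcases eq_or_ne q 1 with rfl | hq1
  · rw [mul_one] at hyp hinj ⊢
    have : NeZero n := ⟨by omega⟩
    obtain ⟨s, hs⟩ := hK.exists_two_mul (K.lab (y 0))
    let y' : ZMod n → D := fun j => y (j - s).val
    have hlabk : ∀ k, K.lab (y k) = 2 * (s + (k : ℕ)) := by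
      intro k
      induction k with
      | zero => simp [hs]
      | succ k ih => rw [(hnext k).lab_eq, ih]; push_cast; ring
    have hlab : ∀ j, K.lab (y' j) = 2 * j := fun j => by
      simp only [y', hlabk, ZMod.natCast_zmod_val]; ring
    have hnext' : ∀ j, K.OutNext (y' j) (y' (j + 1)) := fun j => by
      have h := hnext (j - s).val
      have hlt := ZMod.val_lt (j - s)
      have hcast : (((j - s).val + 1 : ℕ) : ZMod n) = j + 1 - s := by
        push_cast; rw [ZMod.natCast_zmod_val]; ring
      rcases (Nat.succ_le_of_lt hlt).lt_or_eq with h' | h'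
      · have : (j + 1 - s).val = (j - s).val + 1 := by
          rw [← hcast, ZMod.val_natCast_of_lt h']
        simpa only [y', this] using h
      · have : (j + 1 - s).val = 0 := by
          rw [← hcast, ← Nat.succ_eq_add_one, h', ZMod.natCast_self, ZMod.val_zero]
        simp only [y', this]
        rwa [← Nat.succ_eq_add_one, h', hyp] at h
    have hy'inj : Function.Injective y' := fun i j h => by
      have := hinj (ZMod.val_lt (i - s)) (ZMod.val_lt (j - s)) h
      exact sub_left_injective (ZMod.val_injective n this)
    let G : Finset (ZMod n) := Finset.univ.filter fun j => ¬ K.IsFive (K.head (y' j))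
    let U : Finset (ZMod n) := Finset.univ.filter fun j => ¬ K.Coloured (y' j)
    have h7 : 7 ≤ U.card := by
      refine seven_le_card_union_shift hn (G := G) (fun t => ?_) (fun j hj => ?_)
      · -- The 5 vertices at the ends of the other edges.
        by_contra! hlt
        have hc := Finset.card_compl (insert t (insert (t + 1) G))
        rw [ZMod.card] at hc
        set F := (insert t (insert (t + 1) G))ᶜ with hF
        have hr : ((n - 2 : ℕ) : ZMod n) = -2 := by
          rw [Nat.cast_sub (by omega)]; simp
        have := le_two_mul_of_five hK hsph y' (t + 1) (r := n - 1) (by omega)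
          (fun k _ => hlab _) (fun k _ => hnext' _) (fun k _ => hByk _) F
          (Finset.card_pos.1 (by omega)) (fun j hj => by
            simp only [hF, Finset.mem_compl, Finset.mem_insert, G, Finset.mem_filter,
              Finset.mem_univ, true_and, not_or, not_not] at hj
            obtain ⟨h1, h2, h3⟩ := hj
            have hlt := ZMod.val_lt (j - (t + 1))
            refine ⟨(j - (t + 1)).val, ?_, ?_, ?_, h3⟩
            · rw [Nat.pos_iff_ne_zero, Ne, ZMod.val_eq_zero, sub_eq_zero]; exact h2
            · by_contra! hge
              have heq : (j - (t + 1)).val = n - 1 := by omega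
              have := congrArg (Nat.cast : ℕ → ZMod n) heq
              rw [ZMod.natCast_zmod_val, Nat.cast_sub (by omega)] at this
              refine h1 ?_
              simp only [ZMod.natCast_self, Nat.cast_one, zero_sub] at this
              linear_combination this
            · rw [ZMod.natCast_zmod_val]; ring)
        omega
      · simp only [G, U, Finset.mem_filter, Finset.mem_univ, true_and] at hj ⊢
        intro hc
        have hy := hcol _ hc
        exact hj.elim (fun h => h hy.five) (fun h => h (hy.next_five hK (hnext' j)))
    refine h7.trans (Finset.card_le_card_of_injOn (fun j => (j - s).val) (fun j hj => ?_) ?_)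
    · have := (Finset.mem_filter.1 hj).2
      simp only [Finset.coe_filter, Finset.mem_range, Set.mem_ofPred_eq]
      exact ⟨ZMod.val_lt _, this⟩
    · intro i _ j _ h
      exact sub_left_injective (ZMod.val_injective n h)
  · have h2n : 2 * n ≤ n * q := by
      rw [mul_comm 2 n]; exact Nat.mul_le_mul_left n (by omega)
    have h1 := four_le_card_not_five hK hsph y hnext hByk 0
    have h2 := four_le_card_not_five hK hsph y hnext hByk n
    have hsub : ((Finset.Icc (0 + 1) (0 + n - 2)).filter fun k => ¬ K.IsFive (K.head (y k))) ∪
        ((Finset.Icc (n + 1) (n + n - 2)).filter fun k => ¬ K.IsFive (K.head (y k))) ⊆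
        (Finset.range (n * q)).filter fun k => ¬ K.Coloured (y k) := by
      intro k hk
      simp only [Finset.mem_union, Finset.mem_filter, Finset.mem_Icc, Finset.mem_range] at hk ⊢
      exact ⟨by omega, fun hc => hk.elim (fun h => h.2 (hcol k hc).five)
        (fun h => h.2 (hcol k hc).five)⟩
    have hle := Finset.card_le_card hsub
    rw [Finset.card_union_of_disjoint] at hle
    · omega
    · rw [Finset.disjoint_left]
      intro k hk hk'
      simp only [Finset.mem_filter, Finset.mem_Icc] at hk hk'
      omega

/-! ### Vertices with inward edges only -/

theorem fiveG_or_seven_le [Finite D] (hK : K.IsReducedDiagram) {v : K.Vertex}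
    (hv : K.IsInterior v) (hv5 : ¬ K.IsFive v) (hout : ∀ e, ¬ K.OutAt v e)
    (hA : ∀ e, K.InAt v e → ¬ K.RoleA e) : K.IsFiveG v ∨ 7 ≤ K.uncoloured v := by
  have hn := hK.le
  obtain ⟨p, x, hp, hnp, hmem, hinj, hall⟩ := exists_in_cycle hK hv hout hA
  have hI : {e | K.InAt v e}.ncard = p := ncard_of_enum' hinj (fun k _ => hmem k) hall
  have hU : K.uncoloured v = {e | K.InAt v e ∧ ¬ K.Coloured e}.ncard := by
    rw [uncoloured_eq, Nat.add_eq_right, Set.ncard_eq_zero]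
    exact Set.eq_empty_of_forall_notMem fun e he => hout e he.1
  have hsum : {e | K.InAt v e ∧ K.Coloured e}.ncard + {e | K.InAt v e ∧ ¬ K.Coloured e}.ncard =
      p := by
    rw [← hI, ← Set.ncard_union_eq _ (Set.toFinite _) (Set.toFinite _)]
    · congr 1
      ext e
      simp only [Set.mem_union, Set.mem_ofPred_eq]
      tauto
    · rw [Set.disjoint_left]
      exact fun e h h' => h'.2 h.2
  -- Every green edge is followed by an uncoloured one.
  have hle : {e | K.InAt v e ∧ K.Coloured e}.ncard ≤
      {e | K.InAt v e ∧ ¬ K.Coloured e}.ncard := by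
    have hs : ∀ e, ∃ f, K.InAt v e → K.InNext e f := fun e => by
      by_cases he : K.InAt v e
      · have hr := hK.roles (he.inner hv)
        have ha := hA e he
        obtain ⟨f, hf⟩ := RoleC.inNext (e := e) (by tauto)
        exact ⟨f, fun _ => hf⟩
      · exact ⟨e, fun h => (he h).elim⟩
    choose f hf using hs
    refine Set.ncard_le_ncard_of_injOn f (fun e he => ?_) (fun e he e' he' h => ?_)
      (Set.toFinite _)
    · have hfe := (hf e he.1).inAt he.1
      refine ⟨hfe, fun hc => ?_⟩
      exact ((coloured_iff_of_in hv5 he.1).1 he.2).not_inNext hK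
        ((coloured_iff_of_in hv5 hfe).1 hc) (hf e he.1)
    · exact (hf e he.1).left_unique hK.reduced (h ▸ hf e' he'.1)
  by_cases h7 : 7 ≤ K.uncoloured v
  · exact .inr h7
  left
  obtain ⟨q, hq⟩ := id hnp
  have hpn := Nat.le_of_dvd hp hnp
  have hq1 : q = 1 := by
    have h0 : q ≠ 0 := by rintro rfl; omega
    by_contra h1
    have : n * 2 ≤ n * q := Nat.mul_le_mul_left n (by omega)
    omega
  subst hq1
  have hodd := hK.odd
  have hp11 : p = 11 := by
    obtain ⟨j, hj⟩ := hodd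
    omega
  have hdeg : K.degree v = p := by
    rw [degree_eq, hI, Nat.add_eq_right, Set.ncard_eq_zero]
    exact Set.eq_empty_of_forall_notMem fun e he => hout e he
  refine ⟨⟨hv, by omega⟩, by omega, fun d hd hpos => hout d ⟨hpos, hd⟩, ?_⟩
  have : Nat.card {d // K.head d = v ∧ K.Green d} = {e | K.InAt v e ∧ K.Coloured e}.ncard := by
    change Set.ncard {d | K.head d = v ∧ K.Green d} = _
    congr 1
    ext e
    simp only [Set.mem_ofPred_eq]
    constructor
    · exact fun h => ⟨⟨h.2.pos, h.1⟩, (coloured_iff_of_in hv5 ⟨h.2.pos, h.1⟩).2 h.2⟩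
    · exact fun h => ⟨h.1.2, (coloured_iff_of_in hv5 h.1).1 h.2⟩
  rw [this]
  omega

/-! ### Vertices with several outward sequences -/

theorem Yellow.roleC {e : D} (h : K.Yellow e) : K.RoleC e := by
  obtain ⟨c, d, f, a, hs, -⟩ := h
  exact hs.bc.roleC

section

variable {v : K.Vertex} {m : ℕ} {x y : ℕ → D}

theorem OutChain.roleB_last (hK : K.IsReducedDiagram) (hv : K.IsInterior v)
    (h : K.OutChain v m y) : K.RoleB (y m) := by
  have h1 := hK.roles ((h.mem m le_rfl).inner hv)
  have h2 := h.last
  tauto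

theorem InChain.roleA_first (hK : K.IsReducedDiagram) (hv : K.IsInterior v)
    (h : K.InChain v m x) : K.RoleA (x 0) := by
  have h1 := hK.roles ((h.mem 0 (Nat.zero_le _)).inner hv)
  have h2 := h.first
  tauto

theorem InChain.roleA_last (hK : K.IsReducedDiagram) (hv : K.IsInterior v)
    (h : K.InChain v m x) : K.RoleA (x m) := by
  have h1 := hK.roles ((h.mem m le_rfl).inner hv)
  have h2 := h.last
  tauto

theorem not_coloured_of_in (hv5 : ¬ K.IsFive v) {e : D} (he : K.InAt v e) (hA : K.RoleA e) :
    ¬ K.Coloured e := fun hc => ((coloured_iff_of_in hv5 he).1 hc).not_roleA hA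

theorem OutChain.not_coloured_first (hv5 : ¬ K.IsFive v) (h : K.OutChain v m y) :
    ¬ K.Coloured (y 0) := fun hc => by
  rcases (coloured_iff_of_out hv5 (h.mem 0 (Nat.zero_le _))).1 hc with hc | hc
  · exact hc.not_roleA (h.roleA h.one_le)
  · exact h.first hc.roleC

/-- A yellow edge is neither among the first two nor among the last two of a sequence. -/
theorem OutChain.bounds_of_yellow (hK : K.IsReducedDiagram) (h : K.OutChain v m y) {k : ℕ}
    (hk : k ≤ m) (hy : K.Yellow (y k)) : 2 ≤ k ∧ k + 2 ≤ m := by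
  obtain ⟨c, d, f, a, -, -, -, p, q, r, s, h1, h2, h3, h4⟩ := hy
  constructor
  · by_contra! hlt
    have hk0 : k ≠ 0 := by rintro rfl; exact h.first h2.roleC
    obtain rfl : k = 1 := by omega
    obtain rfl := (h.next 0 (by omega)).left_unique hK.reduced h2
    exact h.first h1.roleC
  · by_contra! hlt
    have hkm : k ≠ m := by rintro rfl; exact h.last h3.roleA
    obtain rfl : m = k + 1 := by omega
    obtain rfl := (h.next k (by omega)).right_unique hK.reduced h3
    exact h.last h4.roleA

/-- If everything inside an inward sequence is green, then the sequence has at most three edges. -/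
theorem InChain.le_two (hK : K.IsReducedDiagram) (hv5 : ¬ K.IsFive v) (h : K.InChain v m x)
    (hc : ∀ k, 0 < k → k < m → K.Coloured (x k)) : m ≤ 2 := by
  by_contra! hlt
  exact ((coloured_iff_of_in hv5 (h.mem 1 (by omega))).1 (hc 1 (by omega) (by omega))).not_inNext
    hK ((coloured_iff_of_in hv5 (h.mem 2 (by omega))).1 (hc 2 (by omega) (by omega)))
    (h.next 1 (by omega))

/-- If all but the first edge of an outward sequence are coloured, then there are just two edges and
the second one is blue. -/
theorem OutChain.blue_of_coloured (hK : K.IsReducedDiagram) (hv5 : ¬ K.IsFive v)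
    (h : K.OutChain v m y) (hc : ∀ k, 0 < k → k ≤ m → K.Coloured (y k)) :
    m = 1 ∧ K.Blue (y m) := by
  have h1 := h.one_le
  have hm := h.mem 1 h1
  rcases (coloured_iff_of_out hv5 hm).1 (hc 1 (by omega) h1) with hb | hy
  · have : m = 1 := by
      by_contra hne
      exact hb.not_roleA (h.roleA (by omega))
    subst this
    exact ⟨rfl, hb⟩
  · have := h.bounds_of_yellow hK h1 hy
    omega

end

theorem TwoChains.seven_le [Finite D] (hK : K.IsReducedDiagram) {v : K.Vertex}
    (hv : K.IsInterior v) (hv5 : ¬ K.IsFive v) {l l' m m' : ℕ} {x x' y y' : ℕ → D}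
    (h : K.TwoChains v l l' m m' x x' y y') : 7 ≤ K.uncoloured v := by
  classical
  have hn := hK.le
  obtain ⟨hy, hy', hx, hx', hyy, hxx, hlink, hlink'⟩ := h
  by_contra! hlt
  rw [uncoloured_eq] at hlt
  set O := {e | K.OutAt v e ∧ ¬ K.Coloured e}
  set I := {e | K.InAt v e ∧ ¬ K.Coloured e}
  -- The first outward edges and the first and last inward edges are the only uncoloured ones.
  have hO : (({y 0, y' 0} : Finset D) : Set D) ⊆ O := by
    intro e he
    simp only [Finset.coe_insert, Finset.coe_singleton, Set.mem_insert_iff,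
      Set.mem_singleton_iff] at he
    rcases he with rfl | rfl
    · exact ⟨hy.mem 0 (Nat.zero_le _), hy.not_coloured_first hv5⟩
    · exact ⟨hy'.mem 0 (Nat.zero_le _), hy'.not_coloured_first hv5⟩
  have hI : (({x 0, x l, x' 0, x' l'} : Finset D) : Set D) ⊆ I := by
    intro e he
    simp only [Finset.coe_insert, Finset.coe_singleton, Set.mem_insert_iff,
      Set.mem_singleton_iff] at he
    rcases he with rfl | rfl | rfl | rfl
    · have := hx.mem 0 (Nat.zero_le _)
      exact ⟨this, not_coloured_of_in hv5 this (hx.roleA_first hK hv)⟩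
    · have := hx.mem l le_rfl
      exact ⟨this, not_coloured_of_in hv5 this (hx.roleA_last hK hv)⟩
    · have := hx'.mem 0 (Nat.zero_le _)
      exact ⟨this, not_coloured_of_in hv5 this (hx'.roleA_first hK hv)⟩
    · have := hx'.mem l' le_rfl
      exact ⟨this, not_coloured_of_in hv5 this (hx'.roleA_last hK hv)⟩
  have hO2 : ({y 0, y' 0} : Finset D).card = 2 :=
    Finset.card_pair (hyy _ (Nat.zero_le _) _ (Nat.zero_le _))
  have hI4 : ({x 0, x l, x' 0, x' l'} : Finset D).card = 4 := by
    have := hx.ends_ne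
    have := hx'.ends_ne
    have := hxx 0 (Nat.zero_le _) 0 (Nat.zero_le _)
    have := hxx 0 (Nat.zero_le _) l' le_rfl
    have := hxx l le_rfl 0 (Nat.zero_le _)
    have := hxx l le_rfl l' le_rfl
    rw [Finset.card_insert_of_notMem (by simp [*]), Finset.card_insert_of_notMem (by simp [*]),
      Finset.card_pair ‹_›]
  have hOle := Set.ncard_le_ncard hO
  have hIle := Set.ncard_le_ncard hI
  rw [Set.ncard_coe_finset, hO2] at hOle
  rw [Set.ncard_coe_finset, hI4] at hIle
  have hOeq := Set.eq_of_subset_of_ncard_le hO (by rw [Set.ncard_coe_finset, hO2]; omega)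
  have hIeq := Set.eq_of_subset_of_ncard_le hI (by rw [Set.ncard_coe_finset, hI4]; omega)
  have colO : ∀ e, K.OutAt v e → e ≠ y 0 → e ≠ y' 0 → K.Coloured e := fun e he h1 h2 => by
    by_contra hc
    have : e ∈ O := ⟨he, hc⟩
    rw [← hOeq] at this
    simp [h1, h2] at this
  have colI : ∀ e, K.InAt v e → ¬ K.Coloured e → e = x 0 ∨ e = x l ∨ e = x' 0 ∨ e = x' l' :=
    fun e he hc => by
      have : e ∈ I := ⟨he, hc⟩
      rw [← hIeq] at this
      simpa using this
  obtain ⟨hm, hb⟩ := hy.blue_of_coloured hK hv5 fun k hk hkm => colO _ (hy.mem k hkm)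
    (fun h => hk.ne' (hy.inj hkm (Nat.zero_le m) h)) (hyy _ hkm _ (Nat.zero_le _))
  obtain ⟨hm', hb'⟩ := hy'.blue_of_coloured hK hv5 fun k hk hkm => colO _ (hy'.mem k hkm)
    (hyy _ (Nat.zero_le _) _ hkm).symm (fun h => hk.ne' (hy'.inj hkm (Nat.zero_le m') h))
  have hl : l ≤ 2 := hx.le_two hK hv5 fun k hk hkl => by
    by_contra hc
    rcases colI _ (hx.mem k hkl.le) hc with h | h | h | h
    · exact hk.ne' (hx.inj hkl.le (Nat.zero_le l) h)
    · exact hkl.ne (hx.inj hkl.le (Set.mem_Iic.2 le_rfl) h)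
    · exact hxx _ hkl.le _ (Nat.zero_le _) h
    · exact hxx _ hkl.le _ le_rfl h
  have hl' : l' ≤ 2 := hx'.le_two hK hv5 fun k hk hkl => by
    by_contra hc
    rcases colI _ (hx'.mem k hkl.le) hc with h | h | h | h
    · exact hxx _ (Nat.zero_le _) _ hkl.le h.symm
    · exact hxx _ le_rfl _ hkl.le h.symm
    · exact hk.ne' (hx'.inj hkl.le (Nat.zero_le l') h)
    · exact hkl.ne (hx'.inj hkl.le (Set.mem_Iic.2 le_rfl) h)
  -- The neighbour of a blue edge is a last inward edge.
  have nb : ∀ f, K.Transit f (y m) → ¬ K.RoleC f := fun f hf =>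
    (blue_iff hK hf hb.not_roleA hb.five).1 hb
  have nb' : ∀ f, K.Transit f (y' m') → ¬ K.RoleC f := fun f hf =>
    (blue_iff hK hf hb'.not_roleA hb'.five).1 hb'
  have hC0 : K.RoleC (x 0) := hx.roleC hx.one_le
  have hC0' : K.RoleC (x' 0) := hx'.roleC hx'.one_le
  obtain ⟨t1, t2⟩ : K.Transit (x l) (y m) ∧ K.Transit (x 0) (y' 0) := by
    rcases hlink with ⟨h, -⟩ | ⟨h, h' | h'⟩
    · exact absurd hC0 (nb _ h)
    · exact ⟨h, h'⟩
    · exact absurd hC0 (nb' _ h')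
  obtain ⟨f, hf⟩ := (hy'.roleB_last hK hv).transit
  have hfin := hf.inAt (hy'.mem m' le_rfl)
  have t3 : K.Transit (x' l') (y' m') := by
    rcases colI f hfin (not_coloured_of_in hv5 hfin hf.roleA) with rfl | rfl | rfl | rfl
    · exact absurd hC0 (nb' _ hf)
    · exact absurd (t1.right_unique hK.reduced hf) (hyy _ le_rfl _ le_rfl)
    · exact absurd hC0' (nb' _ hf)
    · exact hf
  have t4 : K.Transit (x' 0) (y 0) := hlink'.resolve_right fun h =>
    hyy _ (Nat.zero_le _) _ le_rfl (h.right_unique hK.reduced t3)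
  -- Once around the vertex the label grows by `4 + l + l'`.
  have hsum : ((4 + l + l' : ℕ) : ZMod n) = 0 := by
    have e1 := t1.lab_eq
    have e2 := t2.lab_eq
    have e3 := t3.lab_eq
    have e4 := t4.lab_eq
    rw [hy.lab_eq le_rfl, hm] at e1
    rw [hy'.lab_eq le_rfl, hm'] at e3
    rw [hx.lab_eq le_rfl] at e2
    rw [hx'.lab_eq le_rfl] at e4
    push_cast at e1 e3 ⊢
    linear_combination e1 - e2 + e3 - e4
  have := Nat.le_of_dvd (by omega) ((ZMod.natCast_eq_zero_iff _ _).1 hsum)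
  omega

/-! ### Types of vertices with one outward and one inward sequence -/

/-- Among the numbers `0, …, l` more than half fail `P`, if `0` and `l` do and no two consecutive
numbers satisfy `P`. -/
theorem le_two_mul_card_not (P : ℕ → Prop) [DecidablePred P] {l : ℕ} (h0 : ¬ P 0) (hl : ¬ P l)
    (h : ∀ k < l, P k → ¬ P (k + 1)) :
    l + 2 ≤ 2 * ((Finset.range (l + 1)).filter fun k => ¬ P k).card := by
  have key : ∀ j ≤ l, j + 1 ≤ 2 * ((Finset.range (j + 1)).filter fun k => ¬ P k).card ∧
      (¬ P j → j + 2 ≤ 2 * ((Finset.range (j + 1)).filter fun k => ¬ P k).card) := by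
    intro j
    induction j with
    | zero => intro _; simp [Finset.filter_singleton, h0]
    | succ j ih =>
      intro hj
      obtain ⟨h1, h2⟩ := ih (by omega)
      rw [Finset.range_add_one (n := j + 1), Finset.filter_insert]
      by_cases hP : P (j + 1)
      · have := h2 (fun hPj => h j (by omega) hPj hP)
        simp only [hP, not_true_eq_false, if_false]
        exact ⟨by omega, fun h => h.elim⟩
      · rw [if_pos hP, Finset.card_insert_of_notMem (by simp)]
        exact ⟨by omega, fun _ => by omega⟩
  exact (key l le_rfl).2 hl

variable (K) in
/-- The vertex is of one of the types of deg-6 vertices. -/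
def IsTyped (v : K.Vertex) : Prop :=
  K.IsGG v ∨ K.IsYB v ∨ K.IsYPlus v ∨ K.IsYMinus v ∨ K.IsFiveG v

section OneChain

variable {v : K.Vertex} {l m : ℕ} {x y : ℕ → D}

theorem OneChain.uncoloured_eq [Finite D] (h : K.OneChain v l m x y)
    [DecidablePred K.Coloured] : K.uncoloured v =
      ((Finset.range (m + 1)).filter fun k => ¬ K.Coloured (y k)).card +
        ((Finset.range (l + 1)).filter fun k => ¬ K.Coloured (x k)).card := by
  have hw := h.wheel
  rw [LabelledMap.uncoloured_eq, ncard_of_enum (S := K.OutAt v) (fun e => ¬ K.Coloured e) hw.out_inj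
    (fun k hk => (hw.out_mem _).2 ⟨k, hk, rfl⟩) (fun e he => by simpa using (hw.out_mem e).1 he),
    ncard_of_enum (S := K.InAt v) (fun e => ¬ K.Coloured e) hw.in_inj
    (fun k hk => (hw.in_mem _).2 ⟨k, hk, rfl⟩) (fun e he => by simpa using (hw.in_mem e).1 he)]

theorem OneChain.le_in [Finite D] (hK : K.IsReducedDiagram) (hv : K.IsInterior v)
    (hv5 : ¬ K.IsFive v) (h : K.OneChain v l m x y) [DecidablePred K.Coloured] :
    l + 2 ≤ 2 * ((Finset.range (l + 1)).filter fun k => ¬ K.Coloured (x k)).card := by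
  refine le_two_mul_card_not (fun k => K.Coloured (x k))
    (not_coloured_of_in hv5 (h.inw.mem 0 (Nat.zero_le _)) (h.inw.roleA_first hK hv))
    (not_coloured_of_in hv5 (h.inw.mem l le_rfl) (h.inw.roleA_last hK hv)) fun k hk h1 h2 => ?_
  exact ((coloured_iff_of_in hv5 (h.inw.mem k hk.le)).1 h1).not_inNext hK
    ((coloured_iff_of_in hv5 (h.inw.mem (k + 1) hk)).1 h2) (h.inw.next k hk)

theorem OutChain.coloured_cases (hK : K.IsReducedDiagram) (hv5 : ¬ K.IsFive v)
    (h : K.OutChain v m y) {k : ℕ} (hk : k ≤ m) (hc : K.Coloured (y k)) :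
    (k = m ∧ K.Blue (y m)) ∨ (2 ≤ k ∧ k + 2 ≤ m ∧ K.Yellow (y k)) := by
  rcases (coloured_iff_of_out hv5 (h.mem k hk)).1 hc with hb | hy
  · have : k = m := by
      by_contra hne
      exact hb.not_roleA (h.roleA (by omega))
    subst this
    exact .inl ⟨rfl, hb⟩
  · have := h.bounds_of_yellow hK hk hy
    exact .inr ⟨this.1, this.2, hy⟩

/-- If the last but two of a sequence of outward edges is yellow, then the last but one leads to a
5 vertex, hence the last one does not. -/
theorem OutChain.last_not_five_of_yellow [Finite D] (hK : K.IsReducedDiagram) (hv : K.IsInterior v)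
    (h : K.OutChain v m y) (hm : 2 ≤ m) (hy : K.Yellow (y (m - 2))) :
    ¬ K.IsFive (K.head (y m)) := by
  intro hb
  have h1 := h.next (m - 2) (by omega)
  have h2 := h.next (m - 1) (by omega)
  rw [show m - 2 + 1 = m - 1 by omega] at h1
  rw [show m - 1 + 1 = m by omega] at h2
  exact not_roleB_of_five_of_five hK h2
    (fun hB => not_all_roles h2.roleA hB h1.roleC) (hy.next_five hK h1) hb (h.roleB_last hK hv)

theorem card_filter_not_of_subset {P : ℕ → Prop} [DecidablePred P] {m : ℕ} (S : Finset ℕ)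
    (hS : ∀ k ≤ m, P k → k ∈ S) :
    m + 1 ≤ ((Finset.range (m + 1)).filter fun k => ¬ P k).card + S.card ∧
      (((Finset.range (m + 1)).filter fun k => ¬ P k).card + S.card ≤ m + 1 → ∀ k ∈ S, P k) := by
  have hsum := Finset.card_filter_add_card_filter_not (s := Finset.range (m + 1)) P
  rw [Finset.card_range] at hsum
  have hsub : (Finset.range (m + 1)).filter P ⊆ S := fun k hk => by
    rw [Finset.mem_filter, Finset.mem_range] at hk
    exact hS k (by omega) hk.2
  have hle := Finset.card_le_card hsub
  refine ⟨by omega, fun hge k hk => ?_⟩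
  rw [← Finset.eq_of_subset_of_card_le hsub (by omega), Finset.mem_filter] at hk
  exact hk.2

/-- Without a blue edge, at most the edges `y 2, …, y (m - 2)` of an outward sequence are
coloured. -/
theorem OutChain.le_out (hK : K.IsReducedDiagram) (hv5 : ¬ K.IsFive v) (h : K.OutChain v m y)
    (hb : ¬ K.Blue (y m)) [DecidablePred K.Coloured] :
    m + 1 ≤ ((Finset.range (m + 1)).filter fun k => ¬ K.Coloured (y k)).card + (m - 3) ∧
      (((Finset.range (m + 1)).filter fun k => ¬ K.Coloured (y k)).card + (m - 3) ≤ m + 1 →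
        ∀ k, 2 ≤ k → k + 2 ≤ m → K.Yellow (y k)) := by
  have key := card_filter_not_of_subset (P := fun k => K.Coloured (y k)) (Finset.Icc 2 (m - 2))
    (fun k hk hc => by
      rcases h.coloured_cases hK hv5 hk hc with ⟨-, h'⟩ | ⟨h1, h2, -⟩
      · exact absurd h' hb
      · exact Finset.mem_Icc.2 ⟨h1, by omega⟩)
  rw [Nat.card_Icc, show m - 2 + 1 - 2 = m - 3 by omega] at key
  refine ⟨key.1, fun hle k h1 h2 => ?_⟩
  rcases h.coloured_cases hK hv5 (by omega) (key.2 hle k (Finset.mem_Icc.2 ⟨h1, by omega⟩)) with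
    ⟨rfl, -⟩ | ⟨-, -, h'⟩
  · omega
  · exact h'

/-- With a blue edge `y m`, at most `y m` and the edges `y 2, …, y (m - 3)` are coloured. -/
theorem OutChain.le_out_of_blue [Finite D] (hK : K.IsReducedDiagram) (hv : K.IsInterior v)
    (hv5 : ¬ K.IsFive v) (h : K.OutChain v m y) (hb : K.Blue (y m)) [DecidablePred K.Coloured] :
    m ≤ ((Finset.range (m + 1)).filter fun k => ¬ K.Coloured (y k)).card + (m - 4) ∧
      (((Finset.range (m + 1)).filter fun k => ¬ K.Coloured (y k)).card + (m - 4) ≤ m →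
        ∀ k, 2 ≤ k → k + 3 ≤ m → K.Yellow (y k)) := by
  have key := card_filter_not_of_subset (P := fun k => K.Coloured (y k))
    (insert m (Finset.Icc 2 (m - 3))) (fun k hk hc => by
      rcases h.coloured_cases hK hv5 hk hc with ⟨rfl, -⟩ | ⟨h1, h2, hy⟩
      · exact Finset.mem_insert_self _ _
      · refine Finset.mem_insert_of_mem (Finset.mem_Icc.2 ⟨h1, ?_⟩)
        by_contra! hlt
        obtain rfl : k = m - 2 := by omega
        exact h.last_not_five_of_yellow hK hv (by omega) hy hb.five)
  have h1 := h.one_le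
  rw [Finset.card_insert_of_notMem (by rw [Finset.mem_Icc]; omega), Nat.card_Icc,
    show m - 3 + 1 - 2 = m - 4 by omega] at key
  refine ⟨by omega, fun hle k h1 h2 => ?_⟩
  rcases h.coloured_cases hK hv5 (by omega) (key.2 (by omega) k
    (Finset.mem_insert_of_mem (Finset.mem_Icc.2 ⟨h1, by omega⟩))) with ⟨rfl, -⟩ | ⟨-, -, h'⟩
  · omega
  · exact h'

theorem OutChain.five_of_yellow (hK : K.IsReducedDiagram) (h : K.OutChain v m y) {b : ℕ}
    (hb : b < m) (hy : ∀ k, 2 ≤ k → k ≤ b → K.Yellow (y k)) (k : ℕ) (h2 : 2 ≤ k) (hk : k ≤ b + 1)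
    (h2b : 2 ≤ b) : K.IsFive (K.head (y k)) := by
  rcases hk.lt_or_eq with hk | rfl
  · exact (hy k h2 (by omega)).five
  · exact (hy b h2b le_rfl).next_five hK (h.next b hb)

theorem eq_of_dvd_of_odd {c : ℕ} (hdvd : n ∣ c) (hc : Odd c) :
    c = n ∨ 3 * n ≤ c := by
  obtain ⟨q, rfl⟩ := hdvd
  have hq : Odd q := (Nat.odd_mul.1 hc).2
  obtain ⟨j, rfl⟩ := hq
  rcases Nat.eq_zero_or_pos j with rfl | hj
  · left; ring
  · right
    rw [mul_comm 3 n]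
    exact Nat.mul_le_mul_left n (by omega)

theorem OneChain.typed_or_seven_le_of_same [Finite D] (hK : K.IsReducedDiagram)
    (hsph : K.SphericallyReduced) (hv : K.IsInterior v) (hv5 : ¬ K.IsFive v)
    (h : K.OneChain v l m x y) (h1 : K.Transit (x l) (y 0)) (h2 : K.Transit (x 0) (y m)) :
    K.IsTyped v ∨ 7 ≤ K.uncoloured v := by
  classical
  by_cases h7 : 7 ≤ K.uncoloured v
  · exact .inr h7
  left
  have hn := hK.le
  have hl := h.inw.one_le
  have hm := h.out.one_le
  have hdvd := h.dvd_same h1 h2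
  have hU := h.uncoloured_eq
  have hin := h.le_in hK hv hv5
  have hsame : K.SameOrientation v (l + 1) (m + 1) x y := ⟨h.wheel, h1, h2⟩
  have hblue : ¬ K.Blue (y m) := fun hb =>
    (blue_iff hK h2 hb.not_roleA hb.five).1 hb (h.inw.roleC hl)
  obtain ⟨hout, hyel⟩ := h.out.le_out hK hv5 hblue
  have hall5 : (∀ k, 2 ≤ k → k + 2 ≤ m → K.Yellow (y k)) → n ≤ m + 1 → False := fun hy hge =>
    h.out.not_all_five hK hsph hge fun k hk hkn =>
      h.out.five_of_yellow hK (b := m - 2) (by omega) (fun k hk hkm => hy k hk (by omega)) k hk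
        (by omega) (by omega)
  have hdeg : l + m ≠ 3 := fun hlm => hv5 ⟨hv, by
    have h1 := h.wheel.ncard_in
    have h2 := h.wheel.ncard_out
    rw [degree_eq, h1, h2]; omega⟩
  have hsmall : m ≤ 2 → l = 2 * m ∨ n ≤ l - 2 * m := fun hm2 => by
    rcases lt_trichotomy (2 * m : ℤ) l with hlt | heq | hlt
    · have := Int.le_of_dvd (by omega) ((dvd_sub_comm).1 hdvd)
      omega
    · omega
    · have := Int.le_of_dvd (by omega) hdvd
      omega
  obtain ⟨q, hq⟩ := hdvd
  rcases (by omega : m = 1 ∨ m = 2 ∨ 3 ≤ m) with rfl | rfl | hm3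
  · -- `l = 2` would be a 5 vertex, other `l` are too large.
    omega
  · have hl4 : l = 4 := by omega
    subst hl4
    refine .inl ⟨⟨hv, by omega⟩, x, y, hsame, ?_⟩
    have hnc : ∀ k < 4, K.Coloured (x k) → ¬ K.Coloured (x (k + 1)) := fun k hk c1 c2 =>
      ((coloured_iff_of_in hv5 (h.inw.mem k (by omega))).1 c1).not_inNext hK
        ((coloured_iff_of_in hv5 (h.inw.mem (k + 1) (by omega))).1 c2) (h.inw.next k (by omega))
    have c0 := not_coloured_of_in hv5 (h.inw.mem 0 (by omega)) (h.inw.roleA_first hK hv)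
    have c4 := not_coloured_of_in hv5 (h.inw.mem 4 (by omega)) (h.inw.roleA_last hK hv)
    have h3 : ((Finset.range (4 + 1)).filter fun k => ¬ K.Coloured (x k)).card ≤ 3 := by omega
    have n1 := hnc 1 (by omega)
    have n2 := hnc 2 (by omega)
    rw [Finset.card_filter] at h3
    simp only [Finset.sum_range_succ, Finset.sum_range_zero] at h3
    have : K.Coloured (x 1) ∧ K.Coloured (x 3) := by
      by_cases c1 : K.Coloured (x 1) <;> by_cases c2 : K.Coloured (x 2) <;>
        by_cases c3 : K.Coloured (x 3) <;> simp_all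
    exact ⟨(coloured_iff_of_in hv5 (h.inw.mem 1 (by omega))).1 this.1,
      (coloured_iff_of_in hv5 (h.inw.mem 3 (by omega))).1 this.2⟩
  · have hyel := hyel (by omega)
    rcases (by omega : l = 1 ∨ l = 2) with rfl | rfl
    · have hdvd' : n ∣ 2 * m - 1 := by
        zify [show 1 ≤ 2 * m by omega]
        exact ⟨q, hq⟩
      rcases eq_of_dvd_of_odd hdvd' ⟨m - 1, by omega⟩ with heq | hge
      · have ho : (n + 3) / 2 = m + 1 := by omega
        refine .inr (.inr (.inr (.inl ⟨⟨hv, by omega⟩, x, y, ?_, ?_⟩)))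
        · rw [ho]; exact hsame
        · intro k hk1 hk2
          exact hyel k hk1 (by omega)
      · exact (hall5 hyel (by omega)).elim
    · have hdvd' : n ∣ m - 1 := by
        refine hK.dvd_of_two_mul ?_
        rw [Nat.cast_sub (by omega)]
        have : ((2 * m - (2 : ℕ) : ℤ) : ZMod n) = ((n * q : ℤ) : ZMod n) := congrArg _ hq
        push_cast at this ⊢
        rw [ZMod.natCast_self, zero_mul] at this
        linear_combination this
      have := Nat.le_of_dvd (by omega) hdvd'
      exact (hall5 hyel (by omega)).elim

theorem OneChain.typed_or_seven_le_of_opposite [Finite D] (hK : K.IsReducedDiagram)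
    (hsph : K.SphericallyReduced) (hv : K.IsInterior v) (hv5 : ¬ K.IsFive v)
    (h : K.OneChain v l m x y) (h1 : K.Transit (x 0) (y 0)) (h2 : K.Transit (x l) (y m)) :
    K.IsTyped v ∨ 7 ≤ K.uncoloured v := by
  classical
  by_cases h7 : 7 ≤ K.uncoloured v
  · exact .inr h7
  left
  have hn := hK.le
  have hl := h.inw.one_le
  have hm := h.out.one_le
  have hdvd := h.dvd_opposite h1 h2
  have hge := Nat.le_of_dvd (by omega) hdvd
  have hU := h.uncoloured_eq
  have hin := h.le_in hK hv hv5
  have hopp : K.OppositeOrientation v (l + 1) (m + 1) x y := ⟨h.wheel, h1, h2⟩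
  have hl2 : l = 2 → n ≤ m + 1 := by
    rintro rfl
    refine Nat.le_of_dvd (by omega) (hK.dvd_of_two_mul ?_)
    rw [← ZMod.natCast_eq_zero_iff] at hdvd
    push_cast at hdvd ⊢
    linear_combination hdvd
  have hl1 : l = 1 → 2 * m + 1 = n ∨ n ≤ m + 1 := by
    rintro rfl
    rcases eq_of_dvd_of_odd hdvd ⟨m, rfl⟩ with h | h
    · exact .inl h
    · right; omega
  by_cases hblue : K.Blue (y m)
  · obtain ⟨hout, hyel⟩ := h.out.le_out_of_blue hK hv hv5 hblue
    have hm4 : 4 ≤ m := by omega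
    have hyel := hyel (by omega)
    have hall5 : n ≤ m + 1 → False := fun hge =>
      h.out.not_all_five hK hsph hge fun k hk hkn =>
        h.out.five_of_yellow hK (b := m - 3) (by omega) (fun k hk hkm => hyel k hk (by omega)) k hk
          (by omega) (by omega)
    rcases (by omega : l = 1 ∨ l = 2) with rfl | rfl
    · rcases hl1 rfl with heq | hge
      · have ho : (n + 1) / 2 = m + 1 := by omega
        refine .inr (.inl ⟨⟨hv, by omega⟩, x, y, ?_, ?_, ?_⟩)
        · rw [ho]; exact hopp
        · rw [ho]; exact hblue
        · intro k hk1 hk2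
          exact hyel k hk1 (by omega)
      · exact (hall5 hge).elim
    · exact (hall5 (hl2 rfl)).elim
  · obtain ⟨hout, hyel⟩ := h.out.le_out hK hv5 hblue
    have hm4 : 4 ≤ m := by omega
    have hyel := hyel (by omega)
    have hall5 : n ≤ m + 1 → False := fun hge =>
      h.out.not_all_five hK hsph hge fun k hk hkn =>
        h.out.five_of_yellow hK (b := m - 2) (by omega) (fun k hk hkm => hyel k hk (by omega)) k hk
          (by omega) (by omega)
    rcases (by omega : l = 1 ∨ l = 2) with rfl | rfl
    · rcases hl1 rfl with heq | hge
      · have ho : (n + 1) / 2 = m + 1 := by omega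
        refine .inr (.inr (.inl ⟨⟨hv, by omega⟩, x, y, ?_, ?_⟩))
        · rw [ho]; exact hopp
        · intro k hk1 hk2
          exact hyel k hk1 (by omega)
      · exact (hall5 hge).elim
    · exact (hall5 (hl2 rfl)).elim

end OneChain

/-- An interior vertex that is neither a 5 nor a deg-7 vertex is one of the typed deg-6 vertices. -/
theorem typed_of_interior [Finite D] (hK : K.IsReducedDiagram) (hsph : K.SphericallyReduced)
    {v : K.Vertex} (hv : K.IsInterior v) (hv5 : ¬ K.IsFive v) : K.IsTyped v ∨ K.IsDegSeven v := by
  suffices K.IsTyped v ∨ 7 ≤ K.uncoloured v from this.imp id fun h => ⟨hv, h⟩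
  rcases interior_cases hK.reduced hK.filled hv with
    ⟨hin, hB⟩ | ⟨hout, hA⟩ | ⟨l, m, x, y, h⟩ | ⟨l, l', m, m', x, x', y, y', h⟩
  · exact .inr (seven_le_of_out_only hK hsph hv hv5 hin hB)
  · exact (fiveG_or_seven_le hK hv hv5 hout hA).imp (fun h => .inr (.inr (.inr (.inr h)))) id
  · rcases h.ends with ⟨h1, h2⟩ | ⟨h1, h2⟩
    · exact h.typed_or_seven_le_of_same hK hsph hv hv5 h1 h2
    · exact h.typed_or_seven_le_of_opposite hK hsph hv hv5 h1 h2
  · exact .inr (h.seven_le hK hv hv5)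

/-! ### The typed vertices in terms of chains -/

section Typed

variable {v : K.Vertex} {l m : ℕ} {x y : ℕ → D}

theorem IsWheel.oneChain (h : K.IsWheel v (l + 1) (m + 1) x y) (hl : 1 ≤ l) (hm : 1 ≤ m)
    (hends : (K.Transit (x l) (y 0) ∧ K.Transit (x 0) (y m)) ∨
      (K.Transit (x 0) (y 0) ∧ K.Transit (x l) (y m))) : K.OneChain v l m x y := by
  have outn : ∀ k < m, K.OutNext (y k) (y (k + 1)) := fun k hk => h.out_next k (by omega)
  have inn : ∀ k < l, K.InNext (x k) (x (k + 1)) := fun k hk => h.in_next k (by omega)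
  have hAx0 : K.RoleA (x 0) := hends.elim (fun h => h.2.roleA) (fun h => h.1.roleA)
  have hAxl : K.RoleA (x l) := hends.elim (fun h => h.1.roleA) (fun h => h.2.roleA)
  have hBy0 : K.RoleB (y 0) := hends.elim (fun h => h.1.roleB) (fun h => h.1.roleB)
  have hBym : K.RoleB (y m) := hends.elim (fun h => h.2.roleB) (fun h => h.2.roleB)
  have hout := outn (m - 1) (by omega)
  have hin := inn (l - 1) (by omega)
  rw [Nat.sub_add_cancel hm] at hout
  rw [Nat.sub_add_cancel hl] at hin
  refine ⟨⟨hm, fun k hk => (h.out_mem _).2 ⟨k, by omega, rfl⟩,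
      fun j hj k hk => h.out_inj (Nat.lt_succ_of_le hj) (Nat.lt_succ_of_le hk), outn,
      fun hC => not_all_roles (outn 0 hm).roleA hBy0 hC,
      fun hA => not_all_roles hA hBym hout.roleC⟩,
    ⟨hl, fun k hk => (h.in_mem _).2 ⟨k, by omega, rfl⟩,
      fun j hj k hk => h.in_inj (Nat.lt_succ_of_le hj) (Nat.lt_succ_of_le hk), inn,
      fun hB => not_all_roles hAx0 hB (inn 0 hl).roleC,
      fun hC => not_all_roles hAxl hin.roleB hC⟩,
    fun e he => ?_, fun e he => ?_, hends⟩
  · obtain ⟨k, hk, rfl⟩ := (h.out_mem e).1 he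
    exact ⟨k, by omega, rfl⟩
  · obtain ⟨k, hk, rfl⟩ := (h.in_mem e).1 he
    exact ⟨k, by omega, rfl⟩

theorem IsGG.chain (h : K.IsGG v) : ∃ x y, K.OneChain v 4 2 x y ∧ K.Transit (x 4) (y 0) ∧
    K.Transit (x 0) (y 2) ∧ K.Green (x 1) := by
  obtain ⟨-, x, y, ⟨hw, h1, h2⟩, h3, -⟩ := h
  exact ⟨x, y, hw.oneChain (l := 4) (m := 2) (by omega) (by omega) (.inl ⟨h1, h2⟩), h1, h2, h3⟩

theorem IsYB.chain (hK : K.IsReducedDiagram) (h : K.IsYB v) : ∃ m x y, 5 ≤ m ∧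
    m + 1 = (n + 1) / 2 ∧ K.OneChain v 1 m x y ∧ K.Transit (x 0) (y 0) ∧ K.Transit (x 1) (y m) ∧
    K.Blue (y m) ∧ ∀ k, 2 ≤ k → k + 3 ≤ m → K.Yellow (y k) := by
  have hn := hK.le
  obtain ⟨-, x, y, ⟨hw, h1, h2⟩, h3, h4⟩ := h
  obtain ⟨m, hm⟩ : ∃ m, (n + 1) / 2 = m + 1 := ⟨(n + 1) / 2 - 1, by omega⟩
  rw [hm] at hw h2 h3 h4
  exact ⟨m, x, y, by omega, hm.symm,
    hw.oneChain (l := 1) le_rfl (by omega) (.inr ⟨h1, h2⟩), h1, h2, h3,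
    fun k hk hkm => h4 k hk (by omega)⟩

theorem IsYPlus.chain (hK : K.IsReducedDiagram) (h : K.IsYPlus v) : ∃ m x y, 5 ≤ m ∧
    m + 1 = (n + 1) / 2 ∧ K.OneChain v 1 m x y ∧ K.Transit (x 0) (y 0) ∧ K.Transit (x 1) (y m) ∧
    ∀ k, 2 ≤ k → k + 2 ≤ m → K.Yellow (y k) := by
  have hn := hK.le
  obtain ⟨-, x, y, ⟨hw, h1, h2⟩, h4⟩ := h
  obtain ⟨m, hm⟩ : ∃ m, (n + 1) / 2 = m + 1 := ⟨(n + 1) / 2 - 1, by omega⟩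
  rw [hm] at hw h2 h4
  exact ⟨m, x, y, by omega, hm.symm,
    hw.oneChain (l := 1) le_rfl (by omega) (.inr ⟨h1, h2⟩), h1, h2,
    fun k hk hkm => h4 k hk (by omega)⟩

theorem IsYMinus.chain (hK : K.IsReducedDiagram) (h : K.IsYMinus v) : ∃ m x y, 5 ≤ m ∧
    m + 1 = (n + 3) / 2 ∧ K.OneChain v 1 m x y ∧ K.Transit (x 1) (y 0) ∧ K.Transit (x 0) (y m) ∧
    ∀ k, 2 ≤ k → k + 2 ≤ m → K.Yellow (y k) := by
  have hn := hK.le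
  obtain ⟨-, x, y, ⟨hw, h1, h2⟩, h4⟩ := h
  obtain ⟨m, hm⟩ : ∃ m, (n + 3) / 2 = m + 1 := ⟨(n + 3) / 2 - 1, by omega⟩
  rw [hm] at hw h2 h4
  exact ⟨m, x, y, by omega, hm.symm,
    hw.oneChain (l := 1) le_rfl (by omega) (.inl ⟨h1, h2⟩), h1, h2,
    fun k hk hkm => h4 k hk (by omega)⟩

theorem IsFiveG.not_outAt (h : K.IsFiveG v) (e : D) : ¬ K.OutAt v e :=
  fun he => h.2.2.1 e he.2 he.1

theorem IsTyped.degSix (h : K.IsTyped v) : K.IsDegSix v := by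
  rcases h with h | h | h | h | h <;> exact h.1

theorem IsFive.uncoloured_le [Finite D] (h : K.IsFive v) : K.uncoloured v ≤ 5 :=
  h.2 ▸ uncoloured_le_degree v

theorem IsTyped.not_five [Finite D] (h : K.IsTyped v) : ¬ K.IsFive v := fun h5 => by
  have := h5.uncoloured_le
  have := h.degSix.2
  omega

variable (K) in
/-- The vertex is in the first layer. -/
def IsTop (v : K.Vertex) : Prop := K.IsBoundary v ∨ K.IsDegSeven v

theorem IsTyped.not_top (h : K.IsTyped v) : ¬ K.IsTop v := by
  rintro (h' | h')
  · exact h' h.degSix.1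
  · have := h.degSix.2
    have := h'.2
    omega

theorem top_or_typed_or_five [Finite D] (hK : K.IsReducedDiagram) (hsph : K.SphericallyReduced)
    (v : K.Vertex) : K.IsTop v ∨ K.IsTyped v ∨ K.IsFive v := by
  by_cases hv : K.IsInterior v
  · by_cases hv5 : K.IsFive v
    · exact .inr (.inr hv5)
    · rcases typed_of_interior hK hsph hv hv5 with h | h
      · exact .inr (.inl h)
      · exact .inl (.inr h)
  · exact .inl (.inl hv)

theorem OneChain.eq_last_of_not_roleA (h : K.OneChain v l m x y) {f : D} (hf : K.OutAt v f)
    (hA : ¬ K.RoleA f) : f = y m := by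
  obtain ⟨k, hk, rfl⟩ := h.out_all f hf
  rcases hk.lt_or_eq with hk | rfl
  · exact absurd (h.out.roleA hk) hA
  · rfl

theorem IsFive.roleC_of_transit [Finite D] (hK : K.IsReducedDiagram) (h : K.IsFive v) {e f : D}
    (hf : K.OutAt v f) (hef : K.Transit e f) (hA : ¬ K.RoleA f) : K.RoleC e := by
  obtain ⟨b, c, d, g, a, hs, -, -, hout⟩ := exists_fiveStar hK h
  rcases hout f hf with rfl | rfl
  · exact absurd hs.ea.roleA hA
  · rw [hs.eq_of_transit hK hef]
    exact hs.bc.roleC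

theorem IsFive.not_roleA_and_roleC [Finite D] (hK : K.IsReducedDiagram) (h : K.IsFive v) {f : D}
    (hf : K.OutAt v f) (hA : K.RoleA f) : ¬ K.RoleC f := by
  obtain ⟨b, c, d, g, a, hs, -, -, hout⟩ := exists_fiveStar hK h
  rcases hout f hf with rfl | rfl
  · exact hs.first_out
  · exact absurd hA hs.last_out

/-- A vertex where a last outward edge is next to a last inward edge is YB or Y+. -/
theorem IsTyped.of_last_last (hK : K.IsReducedDiagram) (h : K.IsTyped v) {e f : D}
    (hf : K.OutAt v f) (hef : K.Transit e f) (hA : ¬ K.RoleA f) (hC : ¬ K.RoleC e) :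
    K.IsYB v ∨ K.IsYPlus v := by
  rcases h with h | h | h | h | h
  · obtain ⟨x, y, hc, -, h2, -⟩ := h.chain
    obtain rfl := hc.eq_last_of_not_roleA hf hA
    rw [hef.left_unique hK.reduced h2] at hC
    exact absurd (hc.inw.roleC (by omega)) hC
  · exact .inl h
  · exact .inr h
  · obtain ⟨m, x, y, -, -, hc, -, h2, -⟩ := h.chain hK
    obtain rfl := hc.eq_last_of_not_roleA hf hA
    rw [hef.left_unique hK.reduced h2] at hC
    exact absurd (hc.inw.roleC (by omega)) hC
  · exact absurd hf (h.not_outAt f)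

/-- A vertex where a last outward edge is next to a first inward edge is GG or Y-. -/
theorem IsTyped.of_first_last (hK : K.IsReducedDiagram) (h : K.IsTyped v) {e f : D}
    (hf : K.OutAt v f) (hef : K.Transit e f) (hA : ¬ K.RoleA f) (hC : K.RoleC e) :
    K.IsGG v ∨ K.IsYMinus v := by
  rcases h with h | h | h | h | h
  · exact .inl h
  · obtain ⟨m, x, y, -, -, hc, -, h2, -⟩ := h.chain hK
    obtain rfl := hc.eq_last_of_not_roleA hf hA
    rw [hef.left_unique hK.reduced h2] at hC
    exact absurd hC hc.inw.last
  · obtain ⟨m, x, y, -, -, hc, -, h2, -⟩ := h.chain hK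
    obtain rfl := hc.eq_last_of_not_roleA hf hA
    rw [hef.left_unique hK.reduced h2] at hC
    exact absurd hC hc.inw.last
  · exact .inr h
  · exact absurd hf (h.not_outAt f)

theorem IsYPlus.last_not_five [Finite D] (hK : K.IsReducedDiagram) (h : K.IsYPlus v) {f : D}
    (hf : K.OutAt v f) (hA : ¬ K.RoleA f) : ¬ K.IsFive (K.head f) := by
  have hv := h.1.1
  obtain ⟨m, x, y, hm, -, hc, -, -, hy⟩ := h.chain hK
  obtain rfl := hc.eq_last_of_not_roleA hf hA
  exact hc.out.last_not_five_of_yellow hK hv (by omega) (hy _ (by omega) (by omega))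

theorem IsYMinus.last_not_five [Finite D] (hK : K.IsReducedDiagram) (h : K.IsYMinus v) {f : D}
    (hf : K.OutAt v f) (hA : ¬ K.RoleA f) : ¬ K.IsFive (K.head f) := by
  have hv := h.1.1
  obtain ⟨m, x, y, hm, -, hc, -, -, hy⟩ := h.chain hK
  obtain rfl := hc.eq_last_of_not_roleA hf hA
  exact hc.out.last_not_five_of_yellow hK hv (by omega) (hy _ (by omega) (by omega))

theorem IsYB.not_isYPlus [Finite D] (hK : K.IsReducedDiagram) (h : K.IsYB v) : ¬ K.IsYPlus v := by
  intro h'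
  obtain ⟨m, x, y, -, -, hc, -, -, hb, -⟩ := h.chain hK
  exact h'.last_not_five hK (hc.out.mem m le_rfl) hc.out.last hb.five

/-- A deg-6 vertex with a blue outward edge is YB. -/
theorem IsTyped.isYB_of_blue [Finite D] (hK : K.IsReducedDiagram) (h : K.IsTyped v) {e f : D}
    (hf : K.OutAt v f) (hef : K.Transit e f) (hb : K.Blue f) : K.IsYB v := by
  rcases h.of_last_last hK hf hef hb.not_roleA
    ((blue_iff hK hef hb.not_roleA hb.five).1 hb) with h | h
  · exact h
  · exact absurd hb.five (h.last_not_five hK hf hb.not_roleA)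

/-! ### Neighbours in higher layers -/

theorem OutChain.index_next (hK : K.IsReducedDiagram) (h : K.OutChain v m y) {k : ℕ} (hk : k ≤ m)
    {f : D} (hf : K.OutNext (y k) f) : k < m ∧ f = y (k + 1) := by
  have hlt : k < m := by
    rcases hk.lt_or_eq with h' | rfl
    · exact h'
    · exact absurd hf.roleA h.last
  exact ⟨hlt, hf.right_unique hK.reduced (h.next k hlt)⟩

/-- The first inward edge `x 0` of a GG vertex comes from a vertex `u` in the first layer. As
`x 1` is green, the edge before `x 0` at `u` leads to a 5 vertex and has two predecessors but is not
yellow, so that `u` could only be YB with `x 0` as its last but one outward edge. Then its last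
one would be blue, hence the middle inward edge of a 5 vertex, and the next inward edge there,
which is a last one, would be the last outward edge of the GG vertex. But a last inward and a last
outward edge lack different roles. -/
theorem IsGG.top_of_first_in [Finite D] (hK : K.IsReducedDiagram) (hsph : K.SphericallyReduced)
    (h : K.IsGG v) {e₀ : D} (he₀ : K.InAt v e₀) (hB₀ : ¬ K.RoleB e₀) : K.IsTop (K.tail e₀) := by
  have hv5 : ¬ K.IsFive v := IsTyped.not_five (.inl h)
  obtain ⟨x, y, hc, -, h02, hg⟩ := h.chain
  obtain rfl : x 0 = e₀ := by
    obtain ⟨k, hk, rfl⟩ := hc.in_all e₀ he₀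
    rcases Nat.eq_zero_or_pos k with rfl | h0
    · rfl
    · exact absurd (hc.inw.roleB h0 hk) hB₀
  obtain ⟨b, c, d, e, hs, hb, -⟩ := hg
  obtain ⟨c₃, hc₃⟩ := hs.ab
  obtain rfl : c₃ = x 0 :=
    InNext.left_unique hK.reduced ⟨b, hc₃⟩ (hc.inw.next 0 (by omega))
  have n3 : K.OutNext b (x 0) := ⟨_, hc₃⟩
  obtain ⟨a', ha'⟩ := hs.bc
  have n2 : K.OutNext a' b := ⟨_, ha'⟩
  obtain ⟨q, n1⟩ : ∃ q, K.OutNext q a' := by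
    by_contra! hq
    exact hb ⟨b, d, e, x 1, hs, a', n2, hq⟩
  obtain ⟨z, hz⟩ := h02
  have n4 : K.OutNext (x 0) z := ⟨_, hz⟩
  have hx0 : K.OutAt (K.tail (x 0)) (x 0) := ⟨n4.roleA.pos, rfl⟩
  have hbu := n3.outAt' hx0
  have hqu := n1.outAt' (n2.outAt' hbu)
  -- In a chain at the initial vertex these edges have consecutive indices.
  have idx : ∀ {l m x' y'}, K.OneChain (K.tail (x 0)) l m x' y' → ∃ k, k + 4 ≤ m ∧
      y' (k + 2) = b ∧ y' (k + 4) = z := fun {l m x' y'} hc' => by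
    obtain ⟨k, hk, rfl⟩ := hc'.out_all q hqu
    obtain ⟨hk, rfl⟩ := hc'.out.index_next hK hk n1
    obtain ⟨hk, rfl⟩ := hc'.out.index_next hK hk n2
    obtain ⟨hk, hk'⟩ := hc'.out.index_next hK hk n3
    rw [hk'] at n4
    obtain ⟨hk, rfl⟩ := hc'.out.index_next hK hk n4
    exact ⟨k, hk, rfl, rfl⟩
  have not_yellow : ¬ K.Yellow b := fun hy => hv5 (he₀.2 ▸ hy.next_five hK n3)
  rcases top_or_typed_or_five hK hsph (K.tail (x 0)) with hu | (hu | hu | hu | hu | hu) | hu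
  · exact hu
  · obtain ⟨x', y', hc', -⟩ := hu.chain
    obtain ⟨k, hk, -⟩ := idx hc'
    omega
  · obtain ⟨m, x', y', -, -, hc', -, -, hbl, hy⟩ := hu.chain hK
    obtain ⟨k, hk, hkb, hkz⟩ := idx hc'
    rcases hk.lt_or_eq with hk | rfl
    · exact (not_yellow (hkb ▸ hy _ (by omega) (by omega))).elim
    · rw [hkz] at hbl
      obtain ⟨b', d', e', a'', hs'⟩ := hbl.five.star_of_middle_in hK n4.roleC.pos hbl.not_roleA
      obtain rfl : y 2 = d' := InNext.right_unique hK.reduced ⟨_, hz⟩ hs'.cd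
      exact absurd (hc.out.roleC (by omega) le_rfl) hs'.last_in
  · obtain ⟨m, x', y', -, -, hc', -, -, hy⟩ := hu.chain hK
    obtain ⟨k, hk, hkb, -⟩ := idx hc'
    exact (not_yellow (hkb ▸ hy _ (by omega) (by omega))).elim
  · obtain ⟨m, x', y', -, -, hc', -, -, hy⟩ := hu.chain hK
    obtain ⟨k, hk, hkb, -⟩ := idx hc'
    exact (not_yellow (hkb ▸ hy _ (by omega) (by omega))).elim
  · exact (hu.not_outAt _ hx0).elim
  · exact (hu.not_roleA_and_roleC hK hx0 n4.roleA n3.roleC).elim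

theorem joined_head {e : D} (he : K.OutAt v e) : K.Joined v (K.head e) := ⟨e, he.2, rfl⟩

theorem joined_tail {e : D} (he : K.InAt v e) : K.Joined v (K.tail e) :=
  ⟨K.rev e, he.2, head_rev e⟩

theorem IsGG.joined_top [Finite D] (hK : K.IsReducedDiagram) (hsph : K.SphericallyReduced)
    (h : K.IsGG v) : ∃ w, K.Joined v w ∧ K.IsTop w := by
  obtain ⟨x, y, hc, -⟩ := h.chain
  have h0 := hc.inw.mem 0 (Nat.zero_le _)
  exact ⟨_, joined_tail h0, h.top_of_first_in hK hsph h0 hc.inw.first⟩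

/-- The last but one outward edge of a YB vertex leads to the first layer: it is a first inward edge
there and precedes a green edge, so that its end could only be GG. -/
theorem IsYB.joined_top [Finite D] (hK : K.IsReducedDiagram) (hsph : K.SphericallyReduced)
    (h : K.IsYB v) : ∃ w, K.Joined v w ∧ K.IsTop w := by
  have hv := h.1.1
  have htyp : K.IsTyped v := .inr (.inl h)
  obtain ⟨m, x, y, hm, -, hc, -, -, hb, hy⟩ := h.chain hK
  obtain ⟨m, rfl⟩ : ∃ j, m = j + 5 := ⟨m - 5, by omega⟩
  have n1 := hc.out.next (m + 1) (by omega)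
  have n2 := hc.out.next (m + 2) (by omega)
  have n3 := hc.out.next (m + 3) (by omega)
  have n4 := hc.out.next (m + 4) (by omega)
  have hB3 : ¬ K.RoleB (y (m + 3)) := fun hB => not_all_roles n3.roleA hB n2.roleC
  have hB4 : ¬ K.RoleB (y (m + 4)) := fun hB => not_all_roles n4.roleA hB n3.roleC
  have h5 : K.IsFive (K.head (y (m + 3))) := (hy (m + 2) (by omega) (by omega)).next_five hK n2
  have hZ5 : ¬ K.IsFive (K.head (y (m + 4))) := fun h' =>
    not_roleB_of_five_of_five hK n4 hB4 h' hb.five (hc.out.roleB_last hK hv)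
  obtain ⟨a, ha, hg⟩ := exists_green hK n1 n2 n3 hB3 h5 hZ5
  have hin : K.InAt (K.head (y (m + 4))) (y (m + 4)) := ⟨n4.roleA.pos, rfl⟩
  have hain := ha.inAt hin
  refine ⟨_, joined_head (hc.out.mem (m + 4) (by omega)), ?_⟩
  -- With just two inward edges, both are next to outward edges, and neither is green.
  have two : ∀ {m' x' y'}, K.IsInterior (K.head (y (m + 4))) →
      K.OneChain (K.head (y (m + 4))) 1 m' x' y' → False := fun {m' x' y'} hi hc' => by
    obtain ⟨k, hk, hka⟩ := hc'.in_all a hain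
    refine hg.not_roleA (hka ▸ ?_)
    rcases (by omega : k = 0 ∨ k = 1) with rfl | rfl
    · exact hc'.inw.roleA_first hK hi
    · exact hc'.inw.roleA_last hK hi
  rcases top_or_typed_or_five hK hsph (K.head (y (m + 4))) with hu | (hu | hu | hu | hu | hu) | hu
  · exact hu
  · have := hu.top_of_first_in hK hsph hin hB4
    rw [(hc.out.mem (m + 4) (by omega)).2] at this
    exact absurd this htyp.not_top
  · obtain ⟨m', x', y', -, -, hc', -⟩ := hu.chain hK
    exact (two hu.1.1 hc').elim
  · obtain ⟨m', x', y', -, -, hc', -⟩ := hu.chain hK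
    exact (two hu.1.1 hc').elim
  · obtain ⟨m', x', y', -, -, hc', -⟩ := hu.chain hK
    exact (two hu.1.1 hc').elim
  · obtain ⟨f, hf⟩ := n4.roleA.transit
    exact (hu.not_outAt _ (hf.outAt hin)).elim
  · exact absurd hu hZ5

/-- If the third outward edge `y 2` leads to a 5 vertex, then `y 1` leads to the first layer or to
a GG vertex, or else to a 5 vertex, and then `y 0` leads to the first layer or to a YB vertex. -/
theorem OneChain.joined_upper [Finite D] (hK : K.IsReducedDiagram) (hsph : K.SphericallyReduced)
    (h : K.OneChain v l m x y) (hm : 3 ≤ m) (h5 : K.IsFive (K.head (y 2))) :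
    ∃ w, K.Joined v w ∧ (K.IsTop w ∨ K.IsGG w ∨ K.IsYB w) := by
  have n0 := h.out.next 0 (by omega)
  have n1 := h.out.next 1 (by omega)
  have n2 := h.out.next 2 (by omega)
  have hB1 : ¬ K.RoleB (y 1) := fun hB => not_all_roles n1.roleA hB n0.roleC
  have hB2 : ¬ K.RoleB (y 2) := fun hB => not_all_roles n2.roleA hB n1.roleC
  obtain ⟨c₂, hc₂⟩ := id n1
  obtain ⟨c, d, e, a, hs⟩ := h5.star_of_first_in hK n2.roleA.pos hB2
  obtain rfl : c₂ = c := InNext.right_unique hK.reduced ⟨_, hc₂⟩ hs.bc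
  have t2 : K.Transit (y 1) c₂ := ⟨_, hc₂⟩
  have hin : K.InAt (K.head (y 1)) (y 1) := ⟨n1.roleA.pos, rfl⟩
  have hj1 := joined_head (h.out.mem 1 (by omega))
  rcases top_or_typed_or_five hK hsph (K.head (y 1)) with hu | hu | hu
  · exact ⟨_, hj1, .inl hu⟩
  · rcases hu.of_first_last hK (t2.outAt hin) t2 hs.middle_in n0.roleC with hu | hu
    · exact ⟨_, hj1, .inr (.inl hu)⟩
    · refine absurd ?_ (hu.last_not_five hK (t2.outAt hin) hs.middle_in)
      rwa [hs.head_c]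
  · obtain ⟨c₁, hc₁⟩ := id n0
    obtain ⟨c, d, e, a, hs⟩ := hu.star_of_first_in hK n1.roleA.pos hB1
    obtain rfl : c₁ = c := InNext.right_unique hK.reduced ⟨_, hc₁⟩ hs.bc
    have t1 : K.Transit (y 0) c₁ := ⟨_, hc₁⟩
    have hb : K.Blue c₁ := (blue_iff hK t1 hs.middle_in (by rwa [hs.head_c])).2 h.out.first
    have hin0 : K.InAt (K.head (y 0)) (y 0) := ⟨n0.roleA.pos, rfl⟩
    refine ⟨_, joined_head (h.out.mem 0 (by omega)), ?_⟩
    rcases top_or_typed_or_five hK hsph (K.head (y 0)) with hw | hw | hw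
    · exact .inl hw
    · exact .inr (.inr (hw.isYB_of_blue hK (t1.outAt hin0) t1 hb))
    · exact absurd (hw.roleC_of_transit hK (t1.outAt hin0) t1 hb.not_roleA) h.out.first

/-- The edge after a green one at a 5G vertex is a last outward edge next to a last inward edge at
its other end. -/
theorem IsFiveG.joined_upper [Finite D] (hK : K.IsReducedDiagram) (hsph : K.SphericallyReduced)
    (h : K.IsFiveG v) : ∃ w, K.Joined v w ∧ (K.IsTop w ∨ K.IsYB w ∨ K.IsYPlus w) := by
  obtain ⟨a, ha, hg⟩ : ∃ a, K.head a = v ∧ K.Green a := by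
    have hne : Nat.card {d // K.head d = v ∧ K.Green d} ≠ 0 := by rw [h.2.2.2]; norm_num
    obtain ⟨⟨a, ha⟩⟩ := (Nat.card_ne_zero.1 hne).1
    exact ⟨a, ha⟩
  have hav : K.InAt v a := ⟨hg.pos, ha⟩
  obtain ⟨b, c, d, e, hs, -⟩ := hg
  obtain ⟨f, hf⟩ := hs.ea
  have hfv : K.InAt v f := InNext.inAt ⟨_, hf⟩ hav
  have hA : ¬ K.RoleA f := fun hA => by
    obtain ⟨g, hg⟩ := hA.transit
    exact h.not_outAt g (hg.outAt hfv)
  have hef : K.Transit e f := ⟨_, hf⟩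
  have hfo : K.OutAt (K.tail f) f := ⟨hfv.1, rfl⟩
  -- `e` is the first outward edge of a 5 vertex, hence a last inward edge at its other end.
  have hC : ¬ K.RoleC e := hs.first_out
  refine ⟨_, joined_tail hfv, ?_⟩
  rcases top_or_typed_or_five hK hsph (K.tail f) with hw | hw | hw
  · exact .inl hw
  · exact .inr (hw.of_last_last hK hfo hef hA hC)
  · exact absurd (hw.roleC_of_transit hK hfo hef hA) hC

/-- The first inward edge of a 5 vertex does not come from a 5 vertex, where it would be neither the
first nor the last outward edge. -/
theorem IsFive.joined_upper [Finite D] (hK : K.IsReducedDiagram) (hsph : K.SphericallyReduced)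
    (h : K.IsFive v) : ∃ w, K.Joined v w ∧ (K.IsTop w ∨ K.IsTyped w) := by
  obtain ⟨b, c, d, e, a, hs, hb, -⟩ := exists_fiveStar hK h
  refine ⟨_, joined_tail ⟨hs.ab.roleA.pos, hb⟩, ?_⟩
  rcases top_or_typed_or_five hK hsph (K.tail b) with hw | hw | hw
  · exact .inl hw
  · exact .inr hw
  · exact absurd hs.bc.roleC (hw.not_roleA_and_roleC hK ⟨hs.ab.roleA.pos, rfl⟩ hs.ab.roleA)

/-! ### The layers -/

theorem IsTyped.exists_inLayer (h : K.IsTyped v) : ∃ l, 1 < l ∧ l < 5 ∧ K.InLayer l v := by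
  rcases h with h | h | h | h | h
  exacts [⟨2, by omega, by omega, .inl h⟩, ⟨2, by omega, by omega, .inr h⟩,
    ⟨3, by omega, by omega, h⟩, ⟨4, by omega, by omega, .inl h⟩, ⟨4, by omega, by omega, .inr h⟩]

/-- The layers are told apart by the number of uncoloured and of outward edges, except for YB and
Y+. -/
theorem InLayer.invariants [Finite D] (hK : K.IsReducedDiagram) {i : ℕ} (h : K.InLayer i v) :
    (i = 1 ∧ (K.IsBoundary v ∨ 7 ≤ K.uncoloured v)) ∨
    (i = 2 ∧ K.IsInterior v ∧ K.uncoloured v = 6 ∧ {e | K.OutAt v e}.ncard = 3) ∨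
    (i = 2 ∧ K.IsInterior v ∧ K.uncoloured v = 6 ∧ {e | K.OutAt v e}.ncard = (n + 1) / 2 ∧
      K.IsYB v) ∨
    (i = 3 ∧ K.IsInterior v ∧ K.uncoloured v = 6 ∧ {e | K.OutAt v e}.ncard = (n + 1) / 2 ∧
      K.IsYPlus v) ∨
    (i = 4 ∧ K.IsInterior v ∧ K.uncoloured v = 6 ∧ ({e | K.OutAt v e}.ncard = (n + 3) / 2 ∨
      {e | K.OutAt v e}.ncard = 0)) ∨
    (i = 5 ∧ K.IsInterior v ∧ K.uncoloured v ≤ 5) := by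
  match i, h with
  | 1, h => exact .inl ⟨rfl, h.imp id fun h => h.2⟩
  | 2, .inl h =>
    obtain ⟨x, y, hc, -⟩ := h.chain
    exact .inr (.inl ⟨rfl, h.1.1, h.1.2, hc.wheel.ncard_out⟩)
  | 2, .inr h =>
    obtain ⟨m, x, y, -, hm, hc, -⟩ := h.chain hK
    exact .inr (.inr (.inl ⟨rfl, h.1.1, h.1.2, hm ▸ hc.wheel.ncard_out, h⟩))
  | 3, h =>
    have h : K.IsYPlus v := h
    obtain ⟨m, x, y, -, hm, hc, -⟩ := h.chain hK
    exact .inr (.inr (.inr (.inl ⟨rfl, h.1.1, h.1.2, hm ▸ hc.wheel.ncard_out, h⟩)))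
  | 4, .inl h =>
    obtain ⟨m, x, y, -, hm, hc, -⟩ := h.chain hK
    exact .inr (.inr (.inr (.inr (.inl ⟨rfl, h.1.1, h.1.2, .inl (hm ▸ hc.wheel.ncard_out)⟩))))
  | 4, .inr h =>
    refine .inr (.inr (.inr (.inr (.inl ⟨rfl, h.1.1, h.1.2, .inr ?_⟩))))
    rw [Set.ncard_eq_zero]
    exact Set.eq_empty_of_forall_notMem h.not_outAt
  | 5, h =>
    have h : K.IsFive v := h
    exact .inr (.inr (.inr (.inr (.inr ⟨rfl, h.1, h.uncoloured_le⟩))))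

theorem InLayer.unique [Finite D] (hK : K.IsReducedDiagram) {i j : ℕ} (hi : K.InLayer i v)
    (hj : K.InLayer j v) : i = j := by
  have hn := hK.le
  have hYB : K.IsYB v → K.IsYPlus v → False := fun h h' => h.not_isYPlus hK h'
  have hi := hi.invariants hK
  have hj := hj.invariants hK
  by_cases hv : K.IsInterior v
  · have hv' : ¬ K.IsBoundary v := not_not.2 hv
    simp only [hv, hv', false_or, true_and] at hi hj
    by_cases h1 : K.IsYB v
    · have h2 : ¬ K.IsYPlus v := hYB h1
      simp only [h2, and_false, false_or] at hi hj
      omega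
    · simp only [h1, and_false, false_or] at hi hj
      omega
  · simp only [hv, false_and, and_false, or_false] at hi hj
    omega

end Typed

end LabelledMap

theorem lemma5 {n : ℕ} (hodd : Odd n) (hn : 11 ≤ n) {D : Type*} [Finite D]
    (K : VanKampenDiagram n D) (hred : K.Reduced) (hsph : K.SphericallyReduced) :
    (∀ v : K.Vertex, ∃! l : ℕ, K.InLayer l v) ∧
    ∀ (v : K.Vertex) (l : ℕ), K.InLayer l v → 1 < l →
      ∃ (w : K.Vertex) (m : ℕ), K.Joined v w ∧ m < l ∧ K.InLayer m w := by
  have hK : K.IsReducedDiagram := ⟨hodd, hn, hred, K.relator⟩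
  constructor
  · intro v
    refine existsUnique_of_exists_of_unique ?_ fun i j hi hj => hi.unique hK hj
    rcases LabelledMap.top_or_typed_or_five hK hsph v with h | h | h
    · exact ⟨1, h⟩
    · obtain ⟨l, -, -, hl⟩ := h.exists_inLayer
      exact ⟨l, hl⟩
    · exact ⟨5, h⟩
  · intro v l hl h1
    have upper : ∀ {w}, K.IsTop w ∨ K.IsGG w ∨ K.IsYB w → ∃ m < 3, K.InLayer m w := by
      rintro w (h | h | h)
      exacts [⟨1, by omega, h⟩, ⟨2, by omega, .inl h⟩, ⟨2, by omega, .inr h⟩]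
    match l, hl with
    | 1, _ => omega
    | 2, .inl h =>
      obtain ⟨w, hw, ht⟩ := h.joined_top hK hsph
      exact ⟨w, 1, hw, by omega, ht⟩
    | 2, .inr h =>
      obtain ⟨w, hw, ht⟩ := h.joined_top hK hsph
      exact ⟨w, 1, hw, by omega, ht⟩
    | 3, h =>
      obtain ⟨m, x, y, hm, -, hc, -, -, hy⟩ := LabelledMap.IsYPlus.chain hK h
      obtain ⟨w, hw, ht⟩ := hc.joined_upper hK hsph (by omega) (hy 2 le_rfl (by omega)).five
      obtain ⟨j, hj, hjw⟩ := upper ht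
      exact ⟨w, j, hw, hj, hjw⟩
    | 4, .inl h =>
      obtain ⟨m, x, y, hm, -, hc, -, -, hy⟩ := LabelledMap.IsYMinus.chain hK h
      obtain ⟨w, hw, ht⟩ := hc.joined_upper hK hsph (by omega) (hy 2 le_rfl (by omega)).five
      obtain ⟨j, hj, hjw⟩ := upper ht
      exact ⟨w, j, hw, by omega, hjw⟩
    | 4, .inr h =>
      obtain ⟨w, hw, ht | ht | ht⟩ := h.joined_upper hK hsph
      exacts [⟨w, 1, hw, by omega, ht⟩, ⟨w, 2, hw, by omega, .inr ht⟩, ⟨w, 3, hw, by omega, ht⟩]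
    | 5, h =>
      obtain ⟨w, hw, ht | ht⟩ := LabelledMap.IsFive.joined_upper hK hsph h
      · exact ⟨w, 1, hw, by omega, ht⟩
      · obtain ⟨j, -, hj, hjw⟩ := ht.exists_inLayer
        exact ⟨w, j, hw, hj, hjw⟩
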